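/- **Setting.** Let $k$ be an algebraically closed field and let $p$ be its characteristic exponent ($p=1$ in characteristic $0$). Let $P$ be a closed point of a nonsingular $k$-variety $W$ of dimension $d$, let $\widehat{\mathcal O}=k[[x_1,\dots,x_d]]$ be the completed local ring at $P$, with maximal ideal $\mathfrak m$, and work in the analytic neighbourhood $\operatorname{Spec}\widehat{\mathcal O}$. An idealistic filtration $\mathcal R$ is a sequence of ideals $\widehat{\mathcal O}=I_0\supset I_1\supset\cdots$ with $I_iI_j\subset I_{i+j}$; write $(f,i)\in\mathcal R$ for $f\in I_i$, and $\mathrm{Sing}(\mathcal R)=\{Q\mid \mathrm{ord}_Q f\ge i\ \ \forall (f,i)\in\mathcal R\}$. Let $E$ be a finite set of hypersurfaces $D=\{x_D=0\}$ with distinct $x_D\in\{x_2,\dots,x_d\}$, indexed by elements $\lambda$ of a totally ordered set. Assume that $(W,\mathcal R,E)$ is in the monomial case with $\tau=1$ at $P$: put $q=p^e$; there are $h=x_1^{q}+a_1x_1^{q-1}+\dots+a_{q}$ with $(h,q)\in\mathcal R$, $a_i\in k[[x_2,\dots,x_d]]$, $\mathrm{ord}_P(a_i)>i$, and a monomial $M=\prod_{D\in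 E}x_D^{m_D}$ and an integer $a>0$ with $(M,a)\in\mathcal R$ and $\sum m_D>a$, such that (i) for all $(f,i)\in\mathcal R$ with expansion $f=\sum_b c_bh^b$ ($c_b$ of degree $<q$ in $x_1$) and all $D\in E$, $x_D^{\lceil m_Di/a\rceil}$ divides $c_0$; (ii) $\mathcal R$ is closed under the Hasse derivatives in $x_1$, that is, $(f,i)\in\mathcal R$ implies $(\partial_{x_1}^jf,\max\{0,i-j\})\in\mathcal R$ for all $j\ge 0$. Let $\xi_D$ be the generic point of $D$, $\mu(\xi_D)=m_D/a$, $\mu(P)=\sum_D m_D/a$. For $\xi\in\{P\}\cup\{\xi_D\}$ let $\mathrm{Slope}(\xi)=\min\{\mathrm{ord}_\xi(a_q)/q,\mu(\xi)\}$. Then $h$ is called well-adapted at $\xi$ if $\mathrm{Slope}(\xi)=\mu(\xi)$, or if $\mathrm{ord}_\xi(a_q)/q<\mu(\xi)$ and the initial form of $a_q$ at $\xi$ is not a $q$-th power. Assume that $h$ is well-adapted at $P$ and at all $\xi_D$, $D\in E$, and put $\mathrm H(\xi)=\mathrm{Slope}(\xi)$, $M_{\rm tight}=\prod_D x_D^{\mathrm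 H(\xi_D)}$, $M_{\rm usual}=M^{1/a}$. The tight monomial case is the case $\mathrm H(P)=\mathrm{ord}_P(M_{\rm tight})$. Type I means $\mathrm{ord}_P(a_q)/q=\mathrm{ord}_P(M_{\rm tight})$, and Type II means $\mathrm{ord}_P(M_{\rm usual})=\mathrm{ord}_P(M_{\rm tight})$. For $Q\in\operatorname{Spec}\widehat{\mathcal O}$ let $\Gamma_{\rm tight}(Q)$ be the lexicographic maximum of $(-r,\sum_{i=1}^r \mathrm H(\xi_{D_{\lambda_i}}),(\lambda_1,\dots,\lambda_r))$ over all $\lambda_1<\dots<\lambda_r$ with $Q\in\bigcap_i D_{\lambda_i}$ and $\sum_i\mathrm H(\xi_{D_{\lambda_i}})\ge1$ (it is $-\infty$ if there are none). Let $\sigma(P)=(d-l_0,d-l_1,\dots)$, ordered lexicographically, where $l_j$ is the dimension of the space of forms $\sum_i c_ix_i^{p^j}$ ($c_i\in k$) that are the class modulo $\mathfrak m^{p^j+1}$ of some $f$ at level $p^j$ of the differential saturation of $\mathcal R$ (the smallest idealistic filtration that contains $\mathcal R$ and is closed under all Hasse derivatives $(f,i)\mapsto(\partial^If,\max\{0,i-|I|\})$).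 **Claim (1).** We are in the tight monomial case if and only if we are in Type I or in Type II. Type I holds if and only if $\mathrm H(\xi_D)q=\mathrm{ord}_{\xi_D}(a_q)$ is an integer for all $D\in E$ and $a_q=u\cdot (M_{\rm tight})^{q}$ with a unit $u\in\widehat{\mathcal O}$. Type II holds if and only if $\mathrm H(\xi_D)a=\mu(\xi_D)a=\mathrm{ord}_{\xi_D}(M)$ is an integer for all $D\in E$ and $(M_{\rm tight})^a=M$. **Claim (2).** Suppose that we are in the tight monomial case. Then $$C:=\{x_1=0\}\cap\mathrm{MaxLocus}(\Gamma_{\rm tight})=\mathrm{Sing}(\mathcal R)\cap \mathrm{MaxLocus}(\Gamma_{\rm tight}),$$ and $C=V(x_j\mid j\in S)$ for some set $S$ of indices. Let $\pi$ be the blow-up along $C$, with exceptional divisor $\widetilde F=\{x_{\widetilde F}=0\}$ at the point considered, and let $\widetilde{\mathcal R}$ be the idealistic filtration generated by all $(\pi^*f/x_{\widetilde F}^{\,i},i)$ with $(f,i)\in\mathcal R$. Let $\widetilde P\in\pi^{-1}(P)\cap\mathrm{Sing}(\widetilde{\mathcal R})$ be a closed point, and let $\widetilde E$ consist of $\widetilde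 F$ (with any index not used in $E$) and of the strict transforms through $\widetilde P$ of the $D\in E$ (with their old indices). Then either $\sigma(\widetilde P)<\sigma(P)$, or $\sigma(\widetilde P)=\sigma(P)$ and the following holds. At $\widetilde P$ we are again in the monomial case with $\tau=1$, in the induced parameters, with the transforms $\widetilde h=\pi^*h/x_{\widetilde F}^{\,q}$ and $\pi^*M/x_{\widetilde F}^{\,a}$ (up to a unit) of $h$ and $M$ and the same $q$ and $a$; $\widetilde h$ is well-adapted at $\widetilde P$ and at the generic points of all components of $\widetilde E$; we are again in the tight monomial case, of Type I if $P$ is of Type I and of Type II if $P$ is of Type II; the tight monomial at $\widetilde P$ is the transform $\pi^*(M_{\rm tight})/x_{\widetilde F}$ of $M_{\rm tight}$ up to a unit; and $\widetilde\Gamma_{\rm tight}(\widetilde P)<\Gamma_{\rm tight}(P)$. Finally, the procedure ends after finitely many steps: there is no infinite sequence of such transformations and points, starting from $P$, with a well-adapted monomial case in the induced parameters at every point, in which $\sigma$ never strictly decreases. -/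

import Mathlib

open MvPowerSeries

noncomputable section

/-! ### Idealistic filtrations -/

/-- An idealistic filtration on a ring `A`: a graded `A`-algebra `⨁ (I_i, i)` given by a decreasing
chain of ideals `A = I_0 ⊇ I_1 ⊇ I_2 ⊇ ⋯` with `I_i I_j ⊆ I_{i+j}`. We write `(f, i) ∈ R` for
`f ∈ R.level i`. Finite generation is not required. -/
structure IdealisticFiltration (A : Type*) [CommRing A] where
  /-- the ideal `I_i` of elements at level `i` -/
  level : ℕ → Ideal A
  level_zero : level 0 = ⊤
  antitone : Antitone level
  mul_le : ∀ i j, level i * level j ≤ level (i + j)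

namespace IdealisticFiltration

variable {A : Type*} [CommRing A]

/-- The singular locus `{Q | ord_Q (f) ≥ i for all (f, i) ∈ R}`, where `ord_Q (f) ≥ i` means that
`f` lies in the `i`-th power of the maximal ideal of the local ring at `Q`. -/
def sing (R : IdealisticFiltration A) : Set (PrimeSpectrum A) :=
  {Q | ∀ i, ∀ f ∈ R.level i, algebraMap A (Localization.AtPrime Q.asIdeal) f ∈
    IsLocalRing.maximalIdeal (Localization.AtPrime Q.asIdeal) ^ i}

/-- The transform of `R` under a homomorphism `π` (the pull-back to the blow-up), where `t` is an
equation of the exceptional divisor: the idealistic filtration generated by the pairs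
`(π f / t ^ j, j)` with `(f, j) ∈ R`. -/
def transform (R : IdealisticFiltration A) (π : A →+* A) (t : A) : IdealisticFiltration A where
  level i := Ideal.span {g | ∃ j, i ≤ j ∧ ∃ f ∈ R.level j, π f = t ^ j * g}
  level_zero := by
    rw [Ideal.eq_top_iff_one]
    refine Ideal.subset_span ⟨0, le_rfl, 1, ?_, by simp⟩
    rw [R.level_zero]; trivial
  antitone := by
    intro i i' h
    apply Ideal.span_mono
    rintro g ⟨j, hj, f, hf, e⟩
    exact ⟨j, h.trans hj, f, hf, e⟩
  mul_le := by
    intro i i'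
    rw [Ideal.span_mul_span', Ideal.span_le]
    rintro _ ⟨g, ⟨j, hj, f, hf, e⟩, g', ⟨j', hj', f', hf', e'⟩, rfl⟩
    refine Ideal.subset_span ⟨j + j', by omega, f * f',
      R.mul_le _ _ (Ideal.mul_mem_mul hf hf'), ?_⟩
    change π (f * f') = t ^ (j + j') * (g * g')
    rw [map_mul, e, e']; ring

end IdealisticFiltration

/-! ### The completed local ring of a nonsingular variety at a closed point -/

/-- The completed local ring at a closed point of a nonsingular variety of dimension `n + 1` over
`k`, with a regular system of parameters `x_1, x_2, …, x_{n+1}`, which are the variables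
`X 0, X 1, …, X n`. -/
abbrev CompletedRing (k : Type*) [Field k] (n : ℕ) := MvPowerSeries (Fin (n + 1)) k

section

variable {k : Type*} [Field k] {n : ℕ}

/-- The Hasse derivative `∂^I` with respect to the parameters:
`∂^I (x^J) = ∏ i, (J_i choose I_i) x^{J - I}`. -/
def hasse (I : Fin (n + 1) →₀ ℕ) (f : CompletedRing k n) : CompletedRing k n :=
  fun s => ((∏ i, (s i + I i).choose (I i) : ℕ) : k) * coeff (s + I) f

/-- `f` does not involve the parameter `x_1`, i.e. `f ∈ k[[x_2, …, x_d]]`. -/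
def FreeOfX1 (f : CompletedRing k n) : Prop :=
  ∀ s : Fin (n + 1) →₀ ℕ, s 0 ≠ 0 → coeff s f = 0

/-- `f` has degree `< q` in `x_1`, i.e. `f = ∑_{0 ≤ j < q} c_j x_1 ^ j`, `c_j ∈ k[[x_2, …, x_d]]`. -/
def DegX1LT (q : ℕ) (f : CompletedRing k n) : Prop :=
  ∀ s : Fin (n + 1) →₀ ℕ, q ≤ s 0 → coeff s f = 0

/-- `f = ∑_b c_b h ^ b` is the power series expansion of `f` with respect to `h`, where each `c_b`
has degree `< q` in `x_1`; the equality says that `f` and the partial sums agree modulo every power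
of `h`. -/
def IsExpansion (q : ℕ) (h f : CompletedRing k n) (c : ℕ → CompletedRing k n) : Prop :=
  (∀ b, DegX1LT q (c b)) ∧ ∀ N, h ^ N ∣ f - ∑ b ∈ Finset.range N, c b * h ^ b

/-- The order of `f` at the generic point of the hypersurface `{x_i = 0}`. -/
def divOrder (i : Fin (n + 1)) (f : CompletedRing k n) : ℕ∞ := emultiplicity (X i) f

/-- The initial form of `f` at the closed point. -/
def initialForm (f : CompletedRing k n) : CompletedRing k n :=
  homogeneousComponent f.order.toNat f

open Classical in
/-- The initial form of `f` at the generic point of `{x_i = 0}`: if `f = x_i ^ r (g + x_i ω)`, where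
`g ≠ 0` does not involve `x_i`, then it is `x_i ^ r g`. -/
def divInitialForm (i : Fin (n + 1)) (f : CompletedRing k n) : CompletedRing k n :=
  fun s => if (s i : ℕ∞) = divOrder i f then coeff s f else 0

/-- The quotient of an order (possibly `∞`) by `q`. -/
def ordQuot (o : ℕ∞) (q : ℕ) : WithTop ℚ := WithTop.map (fun j : ℕ => (j : ℚ) / q) o

/-! ### The invariant `σ` -/

namespace IdealisticFiltration

/-- `R` is closed under all (Hasse) derivatives: `(f, i) ∈ R` implies
`(∂^I f, max {0, i - |I|}) ∈ R`. -/
def DSaturated (R : IdealisticFiltration (CompletedRing k n)) : Prop :=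
  ∀ i, ∀ f ∈ R.level i, ∀ I : Fin (n + 1) →₀ ℕ, hasse I f ∈ R.level (i - I.degree)

/-- The differential saturation of `R`, the smallest differentially saturated idealistic filtration
that contains `R`. -/
def dSaturation (R : IdealisticFiltration (CompletedRing k n)) :
    IdealisticFiltration (CompletedRing k n) where
  level i := ⨅ R' : {R' : IdealisticFiltration (CompletedRing k n) //
    DSaturated R' ∧ ∀ j, R.level j ≤ R'.level j}, R'.1.level i
  level_zero := by
    rw [iInf_eq_top]
    exact fun R' => R'.1.level_zero
  antitone := fun _ _ h => iInf_mono fun R' => R'.1.antitone h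
  mul_le := fun i j => le_iInf fun R' =>
    (Ideal.mul_mono (iInf_le _ R') (iInf_le _ R')).trans (R'.1.mul_le i j)

/-- The part of degree `p ^ j` of the pure part of the leading algebra of `R`: the forms
`∑ c_i x_i ^ (p ^ j)` (over a perfect field: the `p ^ j`-th powers of the linear forms) that occur
as the class in `𝔪 ^ (p ^ j) / 𝔪 ^ (p ^ j + 1)` of an element of `R` at level `p ^ j`. A form is
given by its vector of coefficients. -/
def leadingPure (p : ℕ) (R : IdealisticFiltration (CompletedRing k n)) (j : ℕ) :
    Submodule k (Fin (n + 1) → k) where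
  carrier := {c | ∃ f ∈ R.level (p ^ j),
    ((p ^ j : ℕ) : ℕ∞) < (f - ∑ i, c i • (X i : CompletedRing k n) ^ (p ^ j)).order}
  add_mem' := by
    rintro c c' ⟨f, hf, h⟩ ⟨f', hf', h'⟩
    refine ⟨f + f', Ideal.add_mem _ hf hf', lt_of_lt_of_le (lt_min h h') ?_⟩
    have : f + f' - ∑ i, (c + c') i • (X i : CompletedRing k n) ^ (p ^ j) =
        (f - ∑ i, c i • (X i : CompletedRing k n) ^ (p ^ j)) +
        (f' - ∑ i, c' i • (X i : CompletedRing k n) ^ (p ^ j)) := by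
      simp only [Pi.add_apply, add_smul, Finset.sum_add_distrib]; ring
    rw [this]
    exact min_order_le_add
  zero_mem' := ⟨0, Ideal.zero_mem _, by simp⟩
  smul_mem' := by
    rintro a c ⟨f, hf, h⟩
    refine ⟨a • f, Submodule.smul_of_tower_mem _ a hf, lt_of_lt_of_le h ?_⟩
    have : a • f - ∑ i, (a • c) i • (X i : CompletedRing k n) ^ (p ^ j) =
        a • (f - ∑ i, c i • (X i : CompletedRing k n) ^ (p ^ j)) := by
      simp only [Pi.smul_apply, smul_sub, Finset.smul_sum, smul_eq_mul, mul_smul]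
    rw [this]
    exact le_order_smul

/-- The invariant `σ = (d - l_0, d - l_1, d - l_2, …)`, where `l_j` is the dimension of the pure
part in degree `p ^ j` of the leading algebra of the differential saturation. Its values are
compared lexicographically. -/
def sigma (p : ℕ) (R : IdealisticFiltration (CompletedRing k n)) : Lex (ℕ → ℕ) :=
  toLex fun j => (n + 1) - Module.finrank k (R.dSaturation.leadingPure p j)

end IdealisticFiltration

end

/-! ### Triplets and the monomial case -/

/-- A triplet `(W, R, E)` near a closed point `P`, in the completed local ring: an idealistic
filtration `R`, and the finite set `E = E_young` of the components of the boundary divisor that pass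
through `P`, named by elements of a totally ordered set `Λ`, the component `D_l` being
`{x_{pos l} = 0}`. -/
structure Triplet (k : Type*) [Field k] (n : ℕ) (Λ : Type*) where
  /-- the idealistic filtration -/
  R : IdealisticFiltration (CompletedRing k n)
  /-- the components of the boundary through the point -/
  E : Finset Λ
  /-- the parameter that defines a component -/
  pos : Λ → Fin (n + 1)

/-- The further data of the monomial case with `τ = 1`: the exponent `e` and the coefficients
`a_i = coef i`, `1 ≤ i ≤ p ^ e`, of the element `h` at level `p ^ e`, the multiplicities `m_D` of
the monomial `M = ∏ x_D ^ m_D`, and the level `a` of `M`. -/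
structure MonomialDatum (k : Type*) [Field k] (n : ℕ) (Λ : Type*) where
  e : ℕ
  coef : ℕ → CompletedRing k n
  m : Λ → ℕ
  a : ℕ

namespace MonomialDatum

variable {k : Type*} [Field k] {n : ℕ} {Λ : Type*}

/-- `h = x_1 ^ q + a_1 x_1 ^ (q - 1) + ⋯ + a_{q - 1} x_1 + a_q`, `q = p ^ e`. -/
def h (F : MonomialDatum k n Λ) (p : ℕ) : CompletedRing k n :=
  X 0 ^ p ^ F.e + ∑ i ∈ Finset.Icc 1 (p ^ F.e), F.coef i * X 0 ^ (p ^ F.e - i)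

/-- The last coefficient `a_{p ^ e}` of `h`. -/
def last (F : MonomialDatum k n Λ) (p : ℕ) : CompletedRing k n := F.coef (p ^ F.e)

/-- The monomial `M = ∏ x_D ^ m_D`. -/
def M (F : MonomialDatum k n Λ) (T : Triplet k n Λ) : CompletedRing k n :=
  ∏ l ∈ T.E, X (T.pos l) ^ F.m l

/-- `(W, R, E)` is at `P` in the monomial case with `τ = 1`, with respect to the regular system of
parameters `X`, the element `(h, p ^ e)` in Weierstrass form, and the monomial `(M, a)`. -/
structure IsMonomialCase (p : ℕ) (T : Triplet k n Λ) (F : MonomialDatum k n Λ) : Prop where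
  /-- The components of `E` are distinct, and each is defined by one of `x_2, …, x_d`. -/
  pos_injOn : Set.InjOn T.pos T.E
  pos_ne : ∀ l ∈ T.E, T.pos l ≠ 0
  /-- Weierstrass form of `h`; in particular `h = x_1 ^ q` modulo `𝔪 ^ (q + 1)`. -/
  coef_free : ∀ i ∈ Finset.Icc 1 (p ^ F.e), FreeOfX1 (F.coef i)
  coef_order : ∀ i ∈ Finset.Icc 1 (p ^ F.e), (i : ℕ∞) < (F.coef i).order
  h_mem : F.h p ∈ T.R.level (p ^ F.e)
  /-- The monomial `M` is in `R` at level `a`, and has order `> a`. -/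
  a_pos : 0 < F.a
  M_mem : F.M T ∈ T.R.level F.a
  lt_sum_m : F.a < ∑ l ∈ T.E, F.m l
  /-- If `(f, i) ∈ R`, then `(M ^ (1 / a)) ^ i` divides the constant term `c_0` of the power series
  expansion `f = ∑ c_b h ^ b`. -/
  dvd_const : ∀ i, ∀ f ∈ T.R.level i, ∀ c, IsExpansion (p ^ F.e) (F.h p) f c →
    ∀ l ∈ T.E, X (T.pos l) ^ ⌈((F.m l * i : ℕ) : ℚ) / F.a⌉₊ ∣ c 0
  /-- `R` is closed under the (Hasse) derivatives with respect to `x_1`. -/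
  hasse_mem : ∀ i, ∀ f ∈ T.R.level i, ∀ j : ℕ, hasse (Finsupp.single 0 j) f ∈ T.R.level (i - j)

/-- `μ(ξ_D) = m_D / a`. -/
def muDiv (F : MonomialDatum k n Λ) (l : Λ) : ℚ := F.m l / F.a

/-- `μ(P) = ord_P (M) / a = ∑ m_D / a = ord_P (M_usual)`. -/
def mu (F : MonomialDatum k n Λ) (T : Triplet k n Λ) : ℚ := ∑ l ∈ T.E, F.muDiv l

/-- The slope at `P`: `min {ord_P (a_q) / q, μ(P)}`. -/
def slope (F : MonomialDatum k n Λ) (p : ℕ) (T : Triplet k n Λ) : ℚ :=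
  (min (ordQuot (F.last p).order (p ^ F.e)) (F.mu T : WithTop ℚ)).untopD 0

/-- The slope at the generic point `ξ_D` of `D`: `min {ord_{ξ_D} (a_q) / q, μ(ξ_D)}`. -/
def slopeDiv (F : MonomialDatum k n Λ) (p : ℕ) (T : Triplet k n Λ) (l : Λ) : ℚ :=
  (min (ordQuot (divOrder (T.pos l) (F.last p)) (p ^ F.e)) (F.muDiv l : WithTop ℚ)).untopD 0

/-- `h` is well-adapted at `P`. -/
def WellAdaptedAtPoint (F : MonomialDatum k n Λ) (p : ℕ) (T : Triplet k n Λ) : Prop :=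
  F.slope p T = F.mu T ∨
  (ordQuot (F.last p).order (p ^ F.e) < (F.mu T : WithTop ℚ) ∧
    ¬ ∃ g : CompletedRing k n, initialForm (F.last p) = g ^ p ^ F.e)

/-- `h` is well-adapted at the generic point `ξ_D` of `D`. -/
def WellAdaptedAtDiv (F : MonomialDatum k n Λ) (p : ℕ) (T : Triplet k n Λ) (l : Λ) : Prop :=
  F.slopeDiv p T l = F.muDiv l ∨
  (ordQuot (divOrder (T.pos l) (F.last p)) (p ^ F.e) < (F.muDiv l : WithTop ℚ) ∧
    ¬ ∃ g : CompletedRing k n, divInitialForm (T.pos l) (F.last p) = g ^ p ^ F.e)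

/-- `h` is well-adapted simultaneously at `P` and at the generic points of all the components of
`E` through `P`. Then `H(P)` is the slope at `P`, and `H(ξ_D)` is the slope at `ξ_D`. -/
def WellAdapted (F : MonomialDatum k n Λ) (p : ℕ) (T : Triplet k n Λ) : Prop :=
  F.WellAdaptedAtPoint p T ∧ ∀ l ∈ T.E, F.WellAdaptedAtDiv p T l

/-- The order at `P` of the tight monomial `M_tight = ∏ x_D ^ H(ξ_D)`. -/
def ordTight (F : MonomialDatum k n Λ) (p : ℕ) (T : Triplet k n Λ) : ℚ :=
  ∑ l ∈ T.E, F.slopeDiv p T l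

/-- The invariant `inv_{MON,♥} (P) = H(P) - ord_P (M_tight)`. -/
def invHeart (F : MonomialDatum k n Λ) (p : ℕ) (T : Triplet k n Λ) : ℚ :=
  F.slope p T - F.ordTight p T

/-- The tight monomial case. -/
def IsTight (F : MonomialDatum k n Λ) (p : ℕ) (T : Triplet k n Λ) : Prop :=
  F.invHeart p T = 0

/-- Type I: `ord_P (a_q) / q = ord_P (M_tight)`. -/
def TypeI (F : MonomialDatum k n Λ) (p : ℕ) (T : Triplet k n Λ) : Prop :=
  ordQuot (F.last p).order (p ^ F.e) = (F.ordTight p T : WithTop ℚ)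

/-- Type II: `ord_P (M_usual) = ord_P (M_tight)`. -/
def TypeII (F : MonomialDatum k n Λ) (p : ℕ) (T : Triplet k n Λ) : Prop :=
  F.mu T = F.ordTight p T

end MonomialDatum

/-! ### The invariant `Γ` and the blow-up -/

namespace Triplet

variable {k : Type*} [Field k] {n : ℕ} {Λ : Type*} [LinearOrder Λ]

open Classical in
/-- The invariant `Γ` at a point `Q` of the monomial `∏ x_D ^ H(D)`: the maximum, over the sets
`{D_{l_1}, …, D_{l_r}}` (`l_1 < ⋯ < l_r`) of components through `Q` with `∑ H(D_{l_i}) ≥ 1`, of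
`(-r, ∑ H(D_{l_i}), (l_1, …, l_r))` in the lexicographic order. It is `⊥` (that is, `-∞`) if there
is no such set. -/
def gamma (T : Triplet k n Λ) (H : Λ → ℚ) (Q : PrimeSpectrum (CompletedRing k n)) :
    WithBot (ℤ ×ₗ ℚ ×ₗ List Λ) :=
  ((T.E.filter fun l => X (T.pos l) ∈ Q.asIdeal).powerset.filter fun s => 1 ≤ ∑ l ∈ s, H l).sup
    fun s => ((toLex (-(s.card : ℤ), toLex (∑ l ∈ s, H l, s.sort)) : ℤ ×ₗ ℚ ×ₗ List Λ) :
      WithBot (ℤ ×ₗ ℚ ×ₗ List Λ))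

/-- The locus where `Γ` takes its maximum. -/
def maxLocus (T : Triplet k n Λ) (H : Λ → ℚ) : Set (PrimeSpectrum (CompletedRing k n)) :=
  {Q | ∀ Q', T.gamma H Q' ≤ T.gamma H Q}

end Triplet

section

variable {k : Type*} [Field k] {n : ℕ}

/-- The linear subspace `{x_j = 0 for all j ∈ S}`. -/
def coordLocus (k : Type*) [Field k] {n : ℕ} (S : Finset (Fin (n + 1))) :
    Set (PrimeSpectrum (CompletedRing k n)) :=
  PrimeSpectrum.zeroLocus ((fun j => (X j : CompletedRing k n)) '' (S : Set (Fin (n + 1))))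

/-- The pull-backs of the parameters to the point with coordinates `x_j / x_G = b_j` (`j ∈ S`,
`j ≠ G`) of the fibre over `P` of the blow-up along `{x_j = 0 for all j ∈ S}`, in its `x_G`-chart,
in terms of the parameters `x_G`, `x_j / x_G - b_j` (`j ∈ S`, `j ≠ G`) and `x_j` (`j ∉ S`) there. -/
def blowupImage (S : Finset (Fin (n + 1))) (G : Fin (n + 1)) (b : Fin (n + 1) → k)
    (j : Fin (n + 1)) : CompletedRing k n :=
  if j = G then X G else if j ∈ S then X G * (X j + C (b j)) else X j

theorem hasSubst_blowupImage (S : Finset (Fin (n + 1))) (G : Fin (n + 1)) (b : Fin (n + 1) → k) :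
    HasSubst (blowupImage S G b) := by
  apply hasSubst_of_constantCoeff_zero
  intro j
  unfold blowupImage
  split_ifs <;> simp

/-- The pull-back homomorphism `π^*` of completed local rings at that point of the blow-up. -/
def blowupHom (S : Finset (Fin (n + 1))) (G : Fin (n + 1)) (b : Fin (n + 1) → k) :
    CompletedRing k n →ₐ[k] CompletedRing k n :=
  substAlgHom (hasSubst_blowupImage S G b)

end

namespace Triplet

variable {k : Type*} [Field k] {n : ℕ} {Λ : Type*} [LinearOrder Λ]

open Classical in
/-- The transform of the triplet at that point of the blow-up. The components of the boundary
through the point are the exceptional divisor `{x_G = 0}`, which gets the name `ε`, and the strict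
transforms of the components that contain the point. -/
def blowup (T : Triplet k n Λ) (S : Finset (Fin (n + 1))) (G : Fin (n + 1)) (b : Fin (n + 1) → k)
    (ε : Λ) : Triplet k n Λ where
  R := T.R.transform (blowupHom S G b).toRingHom (X G)
  E := insert ε (T.E.filter fun l => T.pos l ∈ S → T.pos l ≠ G ∧ b (T.pos l) = 0)
  pos := Function.update T.pos ε G

/-- The exponents of the transform `π^* (∏ x_D ^ H(D)) / x_G` of the monomial `∏ x_D ^ H(D)`, up to
multiplication by a unit, with respect to the components of the transformed boundary. -/
def transformExponents (T : Triplet k n Λ) (S : Finset (Fin (n + 1))) (ε : Λ) (H : Λ → ℚ) : Λ → ℚ :=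
  Function.update H ε (∑ l ∈ T.E.filter (fun l => T.pos l ∈ S), H l - 1)

/-- The centre of the blow-up, `Sing (R) ∩ MaxLocus (Γ)`, is `{x_j = 0 for all j ∈ S}`. -/
def IsCenter (T : Triplet k n Λ) (H : Λ → ℚ) (S : Finset (Fin (n + 1))) : Prop :=
  coordLocus k S = T.R.sing ∩ T.maxLocus H

/-- The closed point belongs to the singular locus. -/
def IsSingular (T : Triplet k n Λ) : Prop :=
  IsLocalRing.closedPoint (CompletedRing k n) ∈ T.R.sing

/-- `T'` is obtained from `T` by blowing up the centre `Sing (R) ∩ MaxLocus (Γ)`, and then choosing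
a closed point in the fibre over `P` that belongs to the singular locus of the transform. -/
def Step (T : Triplet k n Λ) (H : Λ → ℚ) (T' : Triplet k n Λ) : Prop :=
  ∃ (S : Finset (Fin (n + 1))) (G : Fin (n + 1)) (b : Fin (n + 1) → k) (ε : Λ),
    T.IsCenter H S ∧ G ∈ S ∧ ε ∉ T.E ∧ T' = T.blowup S G b ε ∧ T'.IsSingular

end Triplet

end

/-! Write q = p^e, H_D = H(ξ_D), and s_1, s_D for the exponents of x_1 and x_D in a monomial x^s.
Everything is read off from exponents of monomials.

The central estimate is the Newton polyhedron bound `slopeDiv_mul_sub_le`: a monomial x^s of an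
element at level i satisfies H_D (i - s_1) ≤ s_D for all D. It holds for the terms of h, since
x_1-derivatives of h isolate its coefficients at the right level, and for remainders modulo h by
hypothesis (i). A weighted leading-monomial argument extends it to every element.

Claim (1) follows because M_tight^q bounds every monomial of a_q from below and M_tight divides
M_usual. Both terms of the minimum defining H(P) are therefore at least ord_P(M_tight), and
tightness says that one of them is equal to it (`isTight_iff`, `typeI_iff`, `typeII_iff`).

In the tight case ∑ H_D > 1. Summing the bound over D shows that an element at level i has order at
least i, and that only x_1^i can occur in degree i, with q ∣ i. This persists in the differential
saturation, so σ depends only on n, p and q (`sigma_eq`, `sigmaRef`). Summing instead over the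
unique set s of components that realizes Γ, where ∑_s H_D ≥ 1, places every element at level i in
the i-th power of the ideal of x_1 and the x_D with D ∈ s. This identifies the centre.

At a singular point over P, the transform of h excludes the chart of x_1 and puts the point on the
strict transform of {x_1 = 0} (`exists_isBlowupData`). There x_1 pulls back to x_G x_1 and π^*
preserves the degree in x_1, so division by h and x_1-derivatives are compatible with the blow-up.
What could fail is the strict inequality ∑ H' > 1. In Type II, equality would make the transform of
M a leading monomial free of x_1, and then σ drops (`false_of_monomial_leading_form`). In Type I
without Type II, well-adaptedness gives an exponent of a_q not divisible by q. Such an exponent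
persists, so a leading term of a_q in degree q would not be a pure q-th power, and again σ drops.
The same exponent gives well-adaptedness at the new point.

The new exponent ∑_s H - 1 is smaller than each H_D with D ∈ s, by the minimality of the cardinality
of s. Since s itself does not survive, Γ decreases (`IsGammaMax.gammaKey_lt`). The values of Γ need
not be well ordered, as new components get arbitrary indices; termination uses a measure in which
the list of indices is replaced by a count (`gammaMeasure_lt`). The data along a sequence need not
be the constructed transforms, so q, μ and the slopes are shown not to depend on the choice of h and
M. -/

noncomputable section

/-! ### Coefficients of products of power series -/

section PowerSeriesCoefficients

variable {k : Type*} [Field k] {n : ℕ}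

/-- The power series with given coefficients. -/
def ofCoeff (c : (Fin (n + 1) →₀ ℕ) → k) : CompletedRing k n := c

theorem coeff_ofCoeff (c : (Fin (n + 1) →₀ ℕ) → k) (s : Fin (n + 1) →₀ ℕ) :
    coeff s (ofCoeff c) = c s := rfl

theorem exists_coeff_ne_zero_of_mul {f g : CompletedRing k n} {s : Fin (n + 1) →₀ ℕ}
    (hs : coeff s (f * g) ≠ 0) : ∃ u v, u + v = s ∧ coeff u f ≠ 0 ∧ coeff v g ≠ 0 := by
  classical
  rw [coeff_mul] at hs
  obtain ⟨x, hx, hne⟩ := Finset.exists_ne_zero_of_sum_ne_zero hs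
  exact ⟨x.1, x.2, Finset.HasAntidiagonal.mem_antidiagonal.1 hx, left_ne_zero_of_mul hne, right_ne_zero_of_mul hne⟩

/-- Underlies the leading-monomial arguments: an extremal monomial of a product arises from a single
pair of monomials, so nothing can cancel it. -/
theorem coeff_mul_eq_of_unique {f g : CompletedRing k n} {s u v : Fin (n + 1) →₀ ℕ}
    (huv : u + v = s)
    (h : ∀ u' v', u' + v' = s → coeff u' f ≠ 0 → coeff v' g ≠ 0 → u' = u ∧ v' = v) :
    coeff s (f * g) = coeff u f * coeff v g := by
  classical
  rw [coeff_mul]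
  refine Finset.sum_eq_single (u, v) ?_ ?_
  · rintro ⟨u', v'⟩ hx hne
    by_contra hc
    obtain ⟨rfl, rfl⟩ := h u' v' (Finset.HasAntidiagonal.mem_antidiagonal.1 hx) (left_ne_zero_of_mul hc)
      (right_ne_zero_of_mul hc)
    exact hne rfl
  · intro hx
    exact absurd (Finset.HasAntidiagonal.mem_antidiagonal.2 huv) hx

theorem exists_coeff_ne_zero_of_add {f g : CompletedRing k n} {s : Fin (n + 1) →₀ ℕ}
    (hs : coeff s (f + g) ≠ 0) : coeff s f ≠ 0 ∨ coeff s g ≠ 0 := by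
  by_contra! h
  exact hs (by rw [map_add, h.1, h.2, add_zero])

theorem monomial_dvd_iff {d : Fin (n + 1) →₀ ℕ} {f : CompletedRing k n} :
    (monomial d (1 : k) : CompletedRing k n) ∣ f ↔ ∀ s, coeff s f ≠ 0 → d ≤ s := by
  constructor
  · rintro ⟨g, rfl⟩ s hs
    rw [coeff_monomial_mul] at hs
    by_contra hc
    exact hs (if_neg hc)
  · intro h
    refine ⟨ofCoeff fun s => coeff (s + d) f, ?_⟩
    ext s
    rw [coeff_monomial_mul]
    split_ifs with hd
    · rw [one_mul, coeff_ofCoeff, tsub_add_cancel_of_le hd]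
    · by_contra hc
      exact hd (h s hc)

theorem X_pow_dvd_iff_le {i : Fin (n + 1)} {N : ℕ} {f : CompletedRing k n} :
    (X i : CompletedRing k n) ^ N ∣ f ↔ ∀ s, coeff s f ≠ 0 → N ≤ s i := by
  rw [X_pow_dvd_iff]
  refine forall_congr' fun s => ?_
  constructor
  · intro h h'
    by_contra! hc
    exact h' (h hc)
  · intro h h'
    by_contra hc
    exact absurd (h hc) (not_le.2 h')

theorem natCast_le_divOrder_iff {i : Fin (n + 1)} {N : ℕ} {f : CompletedRing k n} :
    (N : ℕ∞) ≤ divOrder i f ↔ ∀ s, coeff s f ≠ 0 → N ≤ s i := by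
  rw [divOrder, ← pow_dvd_iff_le_emultiplicity, X_pow_dvd_iff_le]

theorem natCast_le_order_iff {N : ℕ} {f : CompletedRing k n} :
    (N : ℕ∞) ≤ f.order ↔ ∀ s, coeff s f ≠ 0 → N ≤ s.degree := by
  constructor
  · intro h s hs
    exact_mod_cast h.trans (order_le hs)
  · intro h
    refine nat_le_order fun d hd => ?_
    by_contra hc
    exact absurd (h d hc) (not_le.2 hd)

theorem natCast_lt_order_iff {N : ℕ} {f : CompletedRing k n} :
    (N : ℕ∞) < f.order ↔ ∀ s, coeff s f ≠ 0 → N < s.degree := by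
  rw [← ENat.add_one_le_iff (ENat.natCast_ne_top N)]
  exact_mod_cast natCast_le_order_iff (N := N + 1)

theorem prod_X_pow_eq_monomial {ι : Type*} (E : Finset ι) (pos : ι → Fin (n + 1)) (r : ι → ℕ) :
    (∏ l ∈ E, X (pos l) ^ r l : CompletedRing k n) =
      monomial (∑ l ∈ E, Finsupp.single (pos l) (r l)) 1 := by
  classical
  induction E using Finset.induction_on with
  | empty => simp [monomial_zero_one]
  | insert a s ha ih =>
    rw [Finset.prod_insert ha, Finset.sum_insert ha, ih, X_pow_eq, monomial_mul_monomial, one_mul]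

theorem sum_single_apply_of_injOn {ι : Type*} {E : Finset ι} {pos : ι → Fin (n + 1)} {r : ι → ℕ}
    (hinj : Set.InjOn pos E) {l : ι} (hl : l ∈ E) :
    (∑ l ∈ E, Finsupp.single (pos l) (r l)) (pos l) = r l := by
  classical
  rw [Finsupp.finsetSum_apply, Finset.sum_eq_single l]
  · simp
  · intro b hb hne
    rw [Finsupp.single_apply, if_neg]
    exact fun h => hne (hinj hb hl h)
  · exact fun h => absurd hl h

theorem sum_single_apply_of_notMem {ι : Type*} {E : Finset ι} {pos : ι → Fin (n + 1)} {r : ι → ℕ}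
    {j : Fin (n + 1)} (hj : ∀ l ∈ E, pos l ≠ j) :
    (∑ l ∈ E, Finsupp.single (pos l) (r l)) j = 0 := by
  classical
  rw [Finsupp.finsetSum_apply]
  refine Finset.sum_eq_zero fun l hl => ?_
  rw [Finsupp.single_apply, if_neg (hj l hl)]

theorem degree_sum_single {ι : Type*} (E : Finset ι) (pos : ι → Fin (n + 1)) (r : ι → ℕ) :
    (∑ l ∈ E, Finsupp.single (pos l) (r l)).degree = ∑ l ∈ E, r l := by
  rw [map_sum]
  simp

theorem prod_X_pow_dvd_iff {ι : Type*} {E : Finset ι} {pos : ι → Fin (n + 1)} {r : ι → ℕ}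
    (hinj : Set.InjOn pos E) {f : CompletedRing k n} :
    ∏ l ∈ E, X (pos l) ^ r l ∣ f ↔ ∀ s, coeff s f ≠ 0 → ∀ l ∈ E, r l ≤ s (pos l) := by
  rw [prod_X_pow_eq_monomial, monomial_dvd_iff]
  refine forall_congr' fun s => forall_congr' fun _ => ?_
  constructor
  · intro h l hl
    have := h (pos l)
    rwa [sum_single_apply_of_injOn hinj hl] at this
  · intro h j
    by_cases hj : ∃ l ∈ E, pos l = j
    · obtain ⟨l, hl, rfl⟩ := hj
      rw [sum_single_apply_of_injOn hinj hl]
      exact h l hl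
    · push Not at hj
      rw [sum_single_apply_of_notMem hj]
      exact Nat.zero_le _

theorem sum_apply_le_degree {ι : Type*} {E : Finset ι} {pos : ι → Fin (n + 1)}
    (hinj : Set.InjOn pos E) (s : Fin (n + 1) →₀ ℕ) :
    ∑ l ∈ E, s (pos l) ≤ s.degree := by
  classical
  rw [Finsupp.degree_eq_sum, ← Finset.sum_image (f := fun j => s j) (g := pos) hinj]
  exact Finset.sum_le_sum_of_subset (Finset.subset_univ _)

theorem add_sum_apply_le_degree {ι : Type*} {E : Finset ι} {pos : ι → Fin (n + 1)}
    (hinj : Set.InjOn pos E) (h0 : ∀ l ∈ E, pos l ≠ 0) (s : Fin (n + 1) →₀ ℕ) :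
    s 0 + ∑ l ∈ E, s (pos l) ≤ s.degree := by
  classical
  rw [Finsupp.degree_eq_sum, ← Finset.sum_image (f := fun j => s j) (g := pos) hinj,
    ← Finset.sum_insert (f := fun j => s j)]
  · exact Finset.sum_le_sum_of_subset (Finset.subset_univ _)
  · intro h
    obtain ⟨l, hl, he⟩ := Finset.mem_image.1 h
    exact h0 l hl he

/-- A power series all of whose monomials have degree at least `i` in the variables of `S` belongs
to the `i`-th power of the ideal generated by these variables. -/
theorem mem_span_X_pow_of_coeff (S : Finset (Fin (n + 1))) (i : ℕ) :
    ∀ f : CompletedRing k n, (∀ s, coeff s f ≠ 0 → i ≤ ∑ j ∈ S, s j) →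
      f ∈ Ideal.span ((fun j => (X j : CompletedRing k n)) '' (S : Set (Fin (n + 1)))) ^ i := by
  classical
  induction i with
  | zero => intro f _; simp
  | succ i ih =>
    intro f hf
    have hex : ∀ s : Fin (n + 1) →₀ ℕ, coeff s f ≠ 0 → ∃ j ∈ S, 0 < s j := by
      intro s hs
      by_contra! hc
      have := hf s hs
      rw [Finset.sum_eq_zero fun j hj => Nat.le_zero.1 (hc j hj)] at this
      omega
    -- Each monomial of `f` is assigned to one variable of `S` dividing it. This splits the infinite
    -- series into the finitely many pieces `X j * F j`.
    choose! c hcS hc0 using hex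
    let F : Fin (n + 1) → CompletedRing k n := fun j => ofCoeff fun s =>
      if c (s + Finsupp.single j 1) = j then coeff (s + Finsupp.single j 1) f else 0
    have hFc : ∀ j s, coeff s (F j) =
        if c (s + Finsupp.single j 1) = j then coeff (s + Finsupp.single j 1) f else 0 :=
      fun _ _ => rfl
    have hsum : f = ∑ j ∈ S, X j * F j := by
      ext s
      rw [map_sum]
      by_cases hs : coeff s f = 0
      · rw [hs]
        symm
        refine Finset.sum_eq_zero fun j _ => ?_
        rw [X, coeff_monomial_mul]
        split_ifs with hle
        · rw [hFc, tsub_add_cancel_of_le hle, hs]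
          simp
        · rfl
      · have hle : Finsupp.single (c s) 1 ≤ s := by
          rw [Finsupp.single_le_iff]
          exact hc0 s hs
        rw [Finset.sum_eq_single (c s)]
        · rw [X, coeff_monomial_mul, if_pos hle, hFc, tsub_add_cancel_of_le hle, if_pos rfl,
            one_mul]
        · intro j _ hne
          rw [X, coeff_monomial_mul]
          split_ifs with hle'
          · rw [hFc, tsub_add_cancel_of_le hle', if_neg (fun h => hne h.symm), mul_zero]
          · rfl
        · exact fun h => absurd (hcS s hs) h
    rw [hsum, pow_succ']
    refine Ideal.sum_mem _ fun j hj => Ideal.mul_mem_mul (Ideal.subset_span ⟨j, hj, rfl⟩) ?_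
    refine ih _ fun s hs => ?_
    rw [hFc] at hs
    split_ifs at hs with hcs
    · have := hf _ hs
      have h2 : ∑ x ∈ S, (s + Finsupp.single j 1 : Fin (n + 1) →₀ ℕ) x = ∑ x ∈ S, s x + 1 := by
        simp only [Finsupp.add_apply, Finset.sum_add_distrib]
        congr 1
        rw [Finset.sum_eq_single_of_mem j hj]
        · simp
        · intro b _ hb
          simp [hb.symm]
      omega
    · exact absurd rfl hs

theorem le_order_of_mem_maximalIdeal_pow (i : ℕ) {f : CompletedRing k n}
    (hf : f ∈ IsLocalRing.maximalIdeal (CompletedRing k n) ^ i) : (i : ℕ∞) ≤ f.order := by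
  induction i generalizing f with
  | zero => simp
  | succ i ih =>
    rw [pow_succ'] at hf
    refine Submodule.mul_induction_on hf (fun a ha b hb => ?_) fun a b ha hb => ?_
    · have h1 : (1 : ℕ∞) ≤ a.order := by
        rw [one_le_order_iff_constCoeff_eq_zero]
        by_contra hc
        exact (IsLocalRing.mem_maximalIdeal _).1 ha
          (MvPowerSeries.isUnit_iff_constantCoeff.2 (isUnit_iff_ne_zero.2 hc))
      calc ((i + 1 : ℕ) : ℕ∞) = 1 + (i : ℕ∞) := by push_cast; ring
        _ ≤ a.order + b.order := add_le_add h1 (ih hb)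
        _ ≤ _ := le_order_mul
    · exact (le_min ha hb).trans min_order_le_add

/-- A product of `g` with a unit has the monomials of `g` of minimal degree. -/
theorem coeff_mul_of_degree_le {u g : CompletedRing k n} {s : Fin (n + 1) →₀ ℕ}
    (hg : ∀ t, coeff t g ≠ 0 → s.degree ≤ t.degree) :
    coeff s (u * g) = constantCoeff u * coeff s g := by
  rw [← coeff_zero_eq_constantCoeff_apply]
  refine coeff_mul_eq_of_unique (zero_add s) fun u' v' he hu hv => ?_
  have h1 := hg v' hv
  have h2 : u'.degree + v'.degree = s.degree := by rw [← map_add, he]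
  have h3 : u' = 0 := by rw [← Finsupp.degree_eq_zero_iff]; omega
  subst h3
  exact ⟨rfl, by simpa using he⟩

end PowerSeriesCoefficients

/-! ### Division by a Weierstrass polynomial in the first parameter -/

section WeierstrassDivision

variable {k : Type*} [Field k] {n : ℕ}

/-- `h = x_1 ^ q + …` where the other monomials have degree `< q` in `x_1` and involve one of the
other parameters. -/
structure IsWeier (q : ℕ) (h : CompletedRing k n) : Prop where
  coeff_lead : coeff (Finsupp.single 0 q) h = 1
  lt_of_ne : ∀ s, coeff s h ≠ 0 → s ≠ Finsupp.single 0 q → s 0 < q ∧ ∃ j, j ≠ 0 ∧ 0 < s j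

/-- The degree of a monomial in the parameters other than `x_1`. -/
def freeDegree (s : Fin (n + 1) →₀ ℕ) : ℕ := ∑ j ∈ Finset.univ.erase 0, s j

theorem freeDegree_add (s t : Fin (n + 1) →₀ ℕ) :
    freeDegree (s + t) = freeDegree s + freeDegree t := by
  simp [freeDegree, Finset.sum_add_distrib]

theorem freeDegree_single_zero (q : ℕ) :
    freeDegree (Finsupp.single (0 : Fin (n + 1)) q) = 0 := by
  refine Finset.sum_eq_zero fun j hj => ?_
  rw [Finsupp.single_apply, if_neg (Finset.ne_of_mem_erase hj).symm]

theorem freeDegree_pos {s : Fin (n + 1) →₀ ℕ} (hs : ∃ j, j ≠ 0 ∧ 0 < s j) : 0 < freeDegree s := by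
  obtain ⟨j, hj, hpos⟩ := hs
  exact lt_of_lt_of_le hpos (Finset.single_le_sum (f := fun j => s j) (fun _ _ => Nat.zero_le _)
    (Finset.mem_erase.2 ⟨hj, Finset.mem_univ j⟩))

theorem IsWeier.eq_of_le {q : ℕ} {h : CompletedRing k n} (hh : IsWeier q h)
    {s : Fin (n + 1) →₀ ℕ} (hs : coeff s h ≠ 0) (hq : q ≤ s 0) : s = Finsupp.single 0 q := by
  by_contra hc
  exact absurd (hh.lt_of_ne s hs hc).1 (not_lt.2 hq)

theorem IsWeier.eq_of_freeDegree {q : ℕ} {h : CompletedRing k n} (hh : IsWeier q h)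
    {s : Fin (n + 1) →₀ ℕ} (hs : coeff s h ≠ 0) (hw : freeDegree s = 0) :
    s = Finsupp.single 0 q := by
  by_contra hc
  exact absurd hw (freeDegree_pos (hh.lt_of_ne s hs hc).2).ne'

theorem IsWeier.le {q : ℕ} {h : CompletedRing k n} (hh : IsWeier q h)
    {s : Fin (n + 1) →₀ ℕ} (hs : coeff s h ≠ 0) : s 0 ≤ q := by
  by_contra! hc
  have := hh.eq_of_le hs hc.le
  rw [this] at hc
  simp at hc

/-- Uniqueness of the remainder. -/
theorem IsWeier.eq_zero_of_dvd {q : ℕ} {h c : CompletedRing k n} (hh : IsWeier q h)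
    (hc : DegX1LT q c) (hdvd : h ∣ c) : c = 0 := by
  obtain ⟨g, rfl⟩ := hdvd
  by_contra hne
  have hg : ∃ s, coeff s g ≠ 0 := by
    rw [← ne_zero_iff_exists_coeff_ne_zero]
    exact right_ne_zero_of_mul hne
  -- Take a monomial `s` of the cofactor of least degree in the parameters other than x_1. All terms
  -- of `h` but x_1^q have positive such degree, so x_1^q x^s survives in the product, although its
  -- degree in x_1 is at least q.
  let P : ℕ → Prop := fun m => ∃ s, coeff s g ≠ 0 ∧ freeDegree s = m
  classical
  have hP : ∃ m, P m := by
    obtain ⟨s, hs⟩ := hg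
    exact ⟨_, s, hs, rfl⟩
  obtain ⟨s, hs, hsm⟩ := Nat.find_spec hP
  have hmin : ∀ t, coeff t g ≠ 0 → freeDegree s ≤ freeDegree t := by
    intro t ht
    rw [hsm]
    exact Nat.find_min' hP ⟨t, ht, rfl⟩
  have := coeff_mul_eq_of_unique (f := h) (g := g) (u := Finsupp.single 0 q) (v := s) rfl (by
    intro u' v' he hu hv
    have h1 := hmin v' hv
    have h2 : freeDegree u' + freeDegree v' = freeDegree s := by
      rw [← freeDegree_add, he, freeDegree_add, freeDegree_single_zero, zero_add]
    have h3 := hh.eq_of_freeDegree hu (by omega)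
    subst h3
    exact ⟨rfl, add_left_cancel he⟩)
  rw [hh.coeff_lead, one_mul] at this
  refine hs (this ▸ hc _ ?_)
  simp

/-- Existence of the division. -/
theorem IsWeier.exists_division {q : ℕ} {h : CompletedRing k n} (hh : IsWeier q h)
    (f : CompletedRing k n) : ∃ c g, DegX1LT q c ∧ f = c + h * g := by
  classical
  let e := Finsupp.single (0 : Fin (n + 1)) q
  let r : CompletedRing k n := h - X 0 ^ q
  have hr : ∀ s, coeff s r ≠ 0 → 0 < freeDegree s := by
    intro s hs
    have hne : s ≠ e := by
      rintro rfl
      apply hs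
      rw [map_sub, hh.coeff_lead, coeff_X_pow, if_pos rfl, sub_self]
    have : coeff s h ≠ 0 := by
      rwa [map_sub, coeff_X_pow, if_neg hne, sub_zero] at hs
    exact freeDegree_pos (hh.lt_of_ne s this hne).2
  -- The quotient is the fixed point of g ↦ (the part of f - r g divisible by x_1^q) / x_1^q.
  -- Multiplication by r raises `freeDegree`, so the coefficients of `freeDegree` less than N are
  -- stable from the N-th iterate on.
  let G : ℕ → CompletedRing k n := fun N => Nat.rec (motive := fun _ => CompletedRing k n) 0
    (fun _ g => ofCoeff fun s => coeff (s + e) (f - r * g)) N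
  have hG : ∀ N s, coeff s (G (N + 1)) = coeff (s + e) f - coeff (s + e) (r * G N) :=
    fun N s => by rw [← map_sub]; rfl
  have hlow : ∀ (g g' : CompletedRing k n) (s : Fin (n + 1) →₀ ℕ),
      (∀ v, freeDegree v < freeDegree s → coeff v g = coeff v g') →
      coeff (s + e) (r * g) = coeff (s + e) (r * g') := by
    intro g g' s hv
    rw [coeff_mul, coeff_mul]
    refine Finset.sum_congr rfl fun x hx => ?_
    by_cases h0 : coeff x.1 r = 0
    · rw [h0, zero_mul, zero_mul]
    · rw [hv]
      have h1 : freeDegree x.1 + freeDegree x.2 = freeDegree s := by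
        rw [← freeDegree_add, Finset.HasAntidiagonal.mem_antidiagonal.1 hx, freeDegree_add,
          freeDegree_single_zero, add_zero]
      have := hr _ h0
      omega
  have hstab : ∀ N s, freeDegree s < N → coeff s (G (N + 1)) = coeff s (G N) := by
    intro N
    induction N with
    | zero => intro s hs; omega
    | succ N ih =>
      intro s hs
      rw [hG (N + 1), hG N, hlow (G (N + 1)) (G N) s]
      intro v hv
      exact ih v (by omega)
  let g : CompletedRing k n := ofCoeff fun s => coeff s (G (freeDegree s + 1))
  have hg : ∀ N s, freeDegree s < N → coeff s g = coeff s (G N) := by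
    intro N s hs
    obtain ⟨m, rfl⟩ := Nat.exists_eq_add_of_lt hs
    clear hs
    induction m with
    | zero => rfl
    | succ m ih =>
      rw [ih]
      exact (hstab (freeDegree s + m + 1) s (by omega)).symm
  refine ⟨f - h * g, g, ?_, by ring⟩
  intro s hs
  obtain ⟨t, rfl⟩ : ∃ t, s = t + e :=
    ⟨s - e, (tsub_add_cancel_of_le (by rw [Finsupp.single_le_iff]; exact hs)).symm⟩
  have hdec : f - h * g = f - r * g - X 0 ^ q * g := by simp only [r]; ring
  rw [hdec, map_sub, map_sub, X_pow_eq, add_comm t e, coeff_add_monomial_mul, one_mul,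
    hg (freeDegree t + 2) t (by omega), hG (freeDegree t + 1), add_comm e t,
    hlow g (G (freeDegree t + 1)) t fun v hv => hg (freeDegree t + 1) v (by omega)]
  ring

/-- Dividing the successive quotients extends one division to a full expansion. Hypothesis (i),
which concerns whole expansions, thus applies to the remainder of a single division. -/
theorem IsWeier.exists_isExpansion {q : ℕ} {h : CompletedRing k n} (hh : IsWeier q h)
    {f c g : CompletedRing k n} (hc : DegX1LT q c) (hf : f = c + h * g) :
    ∃ c' : ℕ → CompletedRing k n, IsExpansion q h f c' ∧ c' 0 = c := by
  choose R Q hR hQ using hh.exists_division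
  let g' : ℕ → CompletedRing k n := fun N => Nat.rec (motive := fun _ => CompletedRing k n) g
    (fun _ x => Q x) N
  let c' : ℕ → CompletedRing k n := fun N => Nat.casesOn N c fun m => R (g' m)
  refine ⟨c', ⟨fun b => ?_, fun N => ?_⟩, rfl⟩
  · cases b with
    | zero => exact hc
    | succ b => exact hR _
  · cases N with
    | zero => simp
    | succ N =>
      refine ⟨g' N, ?_⟩
      induction N with
      | zero => simp [c', g', hf]
      | succ N ih =>
        rw [Finset.sum_range_succ, ← sub_sub, ih]
        have h1 : g' N = c' (N + 1) + h * g' (N + 1) := hQ (g' N)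
        rw [h1]
        ring

/-- Membership in the ideal `(h, x_i ^ N)` is divisibility of the remainder by `x_i ^ N`. -/
theorem IsWeier.X_pow_dvd_of_mem_span {q : ℕ} {h : CompletedRing k n} (hh : IsWeier q h)
    {i : Fin (n + 1)} (hi : i ≠ 0) {N : ℕ} {f c g : CompletedRing k n} (hc : DegX1LT q c)
    (hf : f = c + h * g) (hmem : f ∈ Ideal.span {h, (X i : CompletedRing k n) ^ N}) :
    (X i : CompletedRing k n) ^ N ∣ c := by
  obtain ⟨a, b, hab⟩ := Ideal.mem_span_pair.1 hmem
  obtain ⟨w, z, hw, hb⟩ := hh.exists_division b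
  have hdeg : DegX1LT q (c - w * X i ^ N) := by
    intro s hs
    rw [map_sub, hc s hs, zero_sub, neg_eq_zero, X_pow_eq, coeff_mul_monomial]
    split_ifs with hle
    · rw [hw, zero_mul]
      simpa [Finsupp.single_apply, hi] using hs
    · rfl
  have := hh.eq_zero_of_dvd hdeg ⟨a + z * X i ^ N - g, by
    have : c = f - h * g := by rw [hf]; ring
    rw [this, ← hab, hb]; ring⟩
  exact ⟨w, by rw [sub_eq_zero.1 this, mul_comm]⟩

end WeierstrassDivision

/-! ### Hasse derivatives -/

section HasseDerivatives

variable {k : Type*} [Field k] {n : ℕ}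

theorem coeff_hasse (I s : Fin (n + 1) →₀ ℕ) (f : CompletedRing k n) :
    coeff s (hasse I f) = ((∏ i, (s i + I i).choose (I i) : ℕ) : k) * coeff (s + I) f := rfl

theorem coeff_hasse_single_zero (j : ℕ) (s : Fin (n + 1) →₀ ℕ) (f : CompletedRing k n) :
    coeff s (hasse (Finsupp.single 0 j) f) =
      ((s 0 + j).choose j : k) * coeff (s + Finsupp.single 0 j) f := by
  rw [coeff_hasse, Finset.prod_eq_single 0]
  · simp
  · intro b _ hb
    simp [hb.symm]
  · simp

/-- The operator x_1^j ∂^j is diagonal on monomials, which avoids the index shift of ∂^j. The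
Leibniz rule and the compatibility with the blow-up are both checked after multiplication by x_1^j.
-/
theorem coeff_X_pow_mul_hasse (j : ℕ) (s : Fin (n + 1) →₀ ℕ) (f : CompletedRing k n) :
    coeff s (X 0 ^ j * hasse (Finsupp.single 0 j) f) = ((s 0).choose j : k) * coeff s f := by
  rw [X_pow_eq, coeff_monomial_mul, one_mul]
  split_ifs with h
  · rw [coeff_hasse_single_zero, tsub_add_cancel_of_le h]
    have : j ≤ s 0 := by rwa [Finsupp.single_le_iff] at h
    rw [Finsupp.tsub_apply, Finsupp.single_eq_same, Nat.sub_add_cancel this]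
  · have : s 0 < j := by rwa [Finsupp.single_le_iff, not_le] at h
    rw [Nat.choose_eq_zero_of_lt this, Nat.cast_zero, zero_mul]

/-- After multiplication by x_1^j this is Vandermonde's identity for the binomial coefficients of
the exponents of x_1. -/
theorem hasse_single_zero_mul (j : ℕ) (f g : CompletedRing k n) :
    hasse (Finsupp.single 0 j) (f * g) = ∑ x ∈ Finset.HasAntidiagonal.antidiagonal j,
      hasse (Finsupp.single 0 x.1) f * hasse (Finsupp.single 0 x.2) g := by
  classical
  have hX : (X 0 : CompletedRing k n) ^ j ≠ 0 := by
    rw [X_pow_eq]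
    exact fun h => one_ne_zero (α := k) (by
      have := congrArg (coeff (Finsupp.single (0 : Fin (n + 1)) j)) h
      rwa [coeff_monomial_same, coeff_zero] at this)
  refine mul_left_cancel₀ hX ?_
  rw [Finset.mul_sum]
  have h1 : ∀ x ∈ Finset.HasAntidiagonal.antidiagonal j, (X 0 : CompletedRing k n) ^ j *
      (hasse (Finsupp.single 0 x.1) f * hasse (Finsupp.single 0 x.2) g) =
      (X 0 ^ x.1 * hasse (Finsupp.single 0 x.1) f) *
        (X 0 ^ x.2 * hasse (Finsupp.single 0 x.2) g) := by
    intro x hx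
    rw [← Finset.HasAntidiagonal.mem_antidiagonal.1 hx, pow_add]
    ring
  rw [Finset.sum_congr rfl h1]
  ext s
  rw [coeff_X_pow_mul_hasse, map_sum, coeff_mul, Finset.mul_sum]
  rw [Finset.sum_congr rfl fun (x : ℕ × ℕ) _ => coeff_mul s (X 0 ^ x.1 * hasse (Finsupp.single 0 x.1) f)
    (X 0 ^ x.2 * hasse (Finsupp.single 0 x.2) g), Finset.sum_comm]
  refine Finset.sum_congr rfl fun y hy => ?_
  simp only [coeff_X_pow_mul_hasse]
  rw [← Finset.HasAntidiagonal.mem_antidiagonal.1 hy, Finsupp.add_apply, Nat.add_choose_eq, Nat.cast_sum,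
    Finset.sum_mul]
  refine Finset.sum_congr rfl fun x _ => ?_
  push_cast
  ring

end HasseDerivatives

/-! ### Quotients of orders -/

section OrdQuot

theorem le_ordQuot_iff {o : ℕ∞} {q : ℕ} (hq : 0 < q) {c : ℚ} :
    (c : WithTop ℚ) ≤ ordQuot o q ↔ ∀ N : ℕ, o = N → c * q ≤ N := by
  have hq' : (0 : ℚ) < q := by exact_mod_cast hq
  induction o using ENat.recTopCoe with
  | top => exact ⟨fun _ N h => absurd h (ENat.top_ne_natCast N), fun _ => le_top⟩
  | coe m =>
    have : ordQuot (m : ℕ∞) q = ((m / q : ℚ) : WithTop ℚ) := rfl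
    rw [this, WithTop.coe_le_coe, le_div_iff₀ hq']
    constructor
    · intro h N hN
      rwa [← Nat.cast_inj.1 hN]
    · exact fun h => h m rfl

theorem ordQuot_natCast (m q : ℕ) : ordQuot (m : ℕ∞) q = ((m / q : ℚ) : WithTop ℚ) := rfl

/-- The default value in the definition of the slopes is never taken: a minimum with a rational
number is finite. -/
theorem coe_untopD_min (x : WithTop ℚ) (y : ℚ) :
    (((min x (y : WithTop ℚ)).untopD 0 : ℚ) : WithTop ℚ) = min x y := by
  induction x using WithTop.recTopCoe with
  | top => simp
  | coe x =>
    rw [← WithTop.coe_min]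
    rfl

variable {k : Type*} [Field k] {n : ℕ}

theorem exists_coeff_ne_zero_degree_eq {f : CompletedRing k n} {N : ℕ} (h : f.order = N) :
    ∃ s, coeff s f ≠ 0 ∧ s.degree = N := by
  have h1 := exists_coeff_ne_zero_and_order (f := f) (by rw [h]; rfl)
  obtain ⟨s, hs, hd⟩ := h1
  exact ⟨s, hs, by rw [h] at hd; exact_mod_cast hd⟩

theorem exists_coeff_ne_zero_apply_eq {f : CompletedRing k n} {i : Fin (n + 1)} {N : ℕ}
    (h : divOrder i f = N) : ∃ s, coeff s f ≠ 0 ∧ s i = N := by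
  by_contra! hc
  have h1 : ∀ s, coeff s f ≠ 0 → N + 1 ≤ s i := by
    intro s hs
    have := natCast_le_divOrder_iff.1 h.ge s hs
    have := hc s hs
    omega
  have := natCast_le_divOrder_iff.2 h1
  rw [h] at this
  exact absurd this (by exact_mod_cast Nat.not_succ_le_self N)

theorem le_ordQuot_order_iff {f : CompletedRing k n} {q : ℕ} (hq : 0 < q) {c : ℚ} :
    (c : WithTop ℚ) ≤ ordQuot f.order q ↔ ∀ s, coeff s f ≠ 0 → c * q ≤ s.degree := by
  rw [le_ordQuot_iff hq]
  constructor
  · intro h s hs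
    have hfin : f.order ≠ ⊤ := fun htop => hs (by rw [order_eq_top_iff.1 htop, coeff_zero])
    obtain ⟨N, hN⟩ := ENat.ne_top_iff_exists.1 hfin
    refine (h N hN.symm).trans ?_
    exact_mod_cast natCast_le_order_iff.1 hN.le s hs
  · intro h N hN
    obtain ⟨s, hs, hd⟩ := exists_coeff_ne_zero_degree_eq hN
    rw [← hd]
    exact h s hs

theorem le_ordQuot_divOrder_iff {f : CompletedRing k n} {i : Fin (n + 1)} {q : ℕ} (hq : 0 < q)
    {c : ℚ} :
    (c : WithTop ℚ) ≤ ordQuot (divOrder i f) q ↔ ∀ s, coeff s f ≠ 0 → c * q ≤ s i := by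
  rw [le_ordQuot_iff hq]
  constructor
  · intro h s hs
    have hfin : divOrder i f ≠ ⊤ := by
      intro htop
      have := (natCast_le_divOrder_iff (i := i) (N := s i + 1)).1 (by rw [htop]; exact le_top) s hs
      omega
    obtain ⟨N, hN⟩ := ENat.ne_top_iff_exists.1 hfin
    refine (h N hN.symm).trans ?_
    exact_mod_cast natCast_le_divOrder_iff.1 hN.le s hs
  · intro h N hN
    obtain ⟨s, hs, hd⟩ := exists_coeff_ne_zero_apply_eq hN
    rw [← hd]
    exact h s hs

end OrdQuot

namespace MonomialDatum

variable {k : Type*} [Field k] {n : ℕ} {Λ : Type*}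

/-! ### The coefficients of `h` -/

section WeierstrassForm

variable {p : ℕ} {F : MonomialDatum k n Λ}

/-- Since the a_i do not involve x_1, the terms a_i x_1^(q - i) have pairwise disjoint sets of
monomials. -/
theorem coeff_h_add_single (hfree : ∀ i ∈ Finset.Icc 1 (p ^ F.e), FreeOfX1 (F.coef i)) {i : ℕ}
    (hi : i ∈ Finset.Icc 1 (p ^ F.e)) {u : Fin (n + 1) →₀ ℕ} (hu : u 0 = 0) :
    coeff (u + Finsupp.single 0 (p ^ F.e - i)) (F.h p) = coeff u (F.coef i) := by
  classical
  have hi' := Finset.mem_Icc.1 hi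
  rw [h, map_add, map_sum, Finset.sum_eq_single_of_mem i hi]
  · rw [coeff_X_pow, if_neg, zero_add, X_pow_eq, coeff_add_mul_monomial, mul_one]
    intro h
    have := DFunLike.congr_fun h 0
    simp [hu] at this
    omega
  · intro j hj hne
    have hj' := Finset.mem_Icc.1 hj
    rw [X_pow_eq, coeff_mul_monomial]
    split_ifs with hle
    · rw [mul_one]
      refine hfree j hj _ ?_
      rw [Finsupp.single_le_iff] at hle
      simp only [Finsupp.tsub_apply, Finsupp.add_apply, hu, Finsupp.single_eq_same] at hle ⊢
      omega
    · rfl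

theorem coeff_h_single (hfree : ∀ i ∈ Finset.Icc 1 (p ^ F.e), FreeOfX1 (F.coef i)) :
    coeff (Finsupp.single 0 (p ^ F.e)) (F.h p) = 1 := by
  classical
  rw [h, map_add, map_sum, Finset.sum_eq_zero, coeff_X_pow, if_pos rfl, add_zero]
  intro j hj
  have hj' := Finset.mem_Icc.1 hj
  rw [X_pow_eq, coeff_mul_monomial]
  split_ifs with hle
  · rw [mul_one]
    refine hfree j hj _ ?_
    rw [Finsupp.single_le_iff] at hle
    simp only [Finsupp.tsub_apply, Finsupp.single_eq_same] at hle ⊢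
    omega
  · rfl

theorem exists_of_coeff_h_ne_zero (hfree : ∀ i ∈ Finset.Icc 1 (p ^ F.e), FreeOfX1 (F.coef i))
    {s : Fin (n + 1) →₀ ℕ} (hs : coeff s (F.h p) ≠ 0) :
    s = Finsupp.single 0 (p ^ F.e) ∨ ∃ i ∈ Finset.Icc 1 (p ^ F.e), ∃ u : Fin (n + 1) →₀ ℕ,
      u 0 = 0 ∧ s = u + Finsupp.single 0 (p ^ F.e - i) ∧ coeff u (F.coef i) ≠ 0 := by
  classical
  rw [h, map_add, map_sum] at hs
  by_cases h0 : s = Finsupp.single 0 (p ^ F.e)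
  · exact Or.inl h0
  · right
    rw [coeff_X_pow, if_neg h0, zero_add] at hs
    obtain ⟨i, hi, hne⟩ := Finset.exists_ne_zero_of_sum_ne_zero hs
    rw [X_pow_eq, coeff_mul_monomial] at hne
    split_ifs at hne with hle
    · rw [mul_one] at hne
      refine ⟨i, hi, _, ?_, (tsub_add_cancel_of_le hle).symm, hne⟩
      by_contra hc
      exact hne (hfree i hi _ hc)
    · exact absurd rfl hne

theorem isWeier_h (hfree : ∀ i ∈ Finset.Icc 1 (p ^ F.e), FreeOfX1 (F.coef i))
    (hpos : ∀ i ∈ Finset.Icc 1 (p ^ F.e), constantCoeff (F.coef i) = 0) :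
    IsWeier (p ^ F.e) (F.h p) := by
  refine ⟨coeff_h_single hfree, fun s hs hne => ?_⟩
  obtain h | ⟨i, hi, u, hu, rfl, hcu⟩ := exists_of_coeff_h_ne_zero hfree hs
  · exact absurd h hne
  · have hi' := Finset.mem_Icc.1 hi
    refine ⟨?_, ?_⟩
    · simp [hu]
      omega
    · have hu0 : u ≠ 0 := by
        rintro rfl
        rw [coeff_zero_eq_constantCoeff_apply] at hcu
        exact hcu (hpos i hi)
      obtain ⟨j, hj⟩ := Finsupp.ne_iff.1 hu0
      have hj0 : j ≠ 0 := by
        rintro rfl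
        exact hj hu
      refine ⟨j, hj0, ?_⟩
      have := Nat.pos_of_ne_zero hj
      simp only [Finsupp.add_apply]
      omega

end WeierstrassForm

/-! ### Slopes -/

section Slopes

variable {p : ℕ} {T : Triplet k n Λ} {F : MonomialDatum k n Λ}

theorem coe_slopeDiv (l : Λ) : (F.slopeDiv p T l : WithTop ℚ) =
    min (ordQuot (divOrder (T.pos l) (F.last p)) (p ^ F.e)) (F.muDiv l) :=
  coe_untopD_min _ _

theorem coe_slope : (F.slope p T : WithTop ℚ) =
    min (ordQuot (F.last p).order (p ^ F.e)) (F.mu T) :=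
  coe_untopD_min _ _

theorem slopeDiv_le_muDiv (l : Λ) : F.slopeDiv p T l ≤ F.muDiv l := by
  rw [← WithTop.coe_le_coe, coe_slopeDiv]
  exact min_le_right _ _

theorem muDiv_nonneg (l : Λ) : 0 ≤ F.muDiv l := by
  unfold muDiv
  positivity

theorem slopeDiv_nonneg (hq : 0 < p ^ F.e) (l : Λ) : 0 ≤ F.slopeDiv p T l := by
  rw [← WithTop.coe_le_coe, coe_slopeDiv]
  refine le_min ((le_ordQuot_iff hq).2 fun N _ => ?_) (WithTop.coe_le_coe.2 (muDiv_nonneg l))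
  rw [zero_mul]
  positivity

theorem slopeDiv_mul_le_of_coeff_last (hq : 0 < p ^ F.e) (l : Λ) {s : Fin (n + 1) →₀ ℕ}
    (hs : coeff s (F.last p) ≠ 0) : F.slopeDiv p T l * (p ^ F.e : ℕ) ≤ s (T.pos l) := by
  refine (le_ordQuot_divOrder_iff hq).1 ?_ s hs
  rw [coe_slopeDiv]
  exact min_le_left _ _

theorem slopeDiv_eq_of_forall (hq : 0 < p ^ F.e) {l : Λ} {c : ℚ} (hc : c ≤ F.muDiv l)
    (h : ∀ s, coeff s (F.last p) ≠ 0 → c * (p ^ F.e : ℕ) ≤ s (T.pos l))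
    (h' : c = F.muDiv l ∨ ∃ s, coeff s (F.last p) ≠ 0 ∧ (s (T.pos l) : ℚ) = c * (p ^ F.e : ℕ)) :
    F.slopeDiv p T l = c := by
  have hle : c ≤ F.slopeDiv p T l := by
    rw [← WithTop.coe_le_coe, coe_slopeDiv]
    exact le_min ((le_ordQuot_divOrder_iff hq).2 h) (WithTop.coe_le_coe.2 hc)
  refine le_antisymm ?_ hle
  obtain rfl | ⟨s, hs, he⟩ := h'
  · exact slopeDiv_le_muDiv l
  · have := slopeDiv_mul_le_of_coeff_last (T := T) hq l hs
    rw [he] at this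
    exact le_of_mul_le_mul_right this (by exact_mod_cast hq)

theorem ordTight_le_mu : F.ordTight p T ≤ F.mu T :=
  Finset.sum_le_sum fun l _ => slopeDiv_le_muDiv l

end Slopes

/-! ### Divisibility of remainders and of the coefficients of h -/

namespace IsMonomialCase

variable {p : ℕ} {T : Triplet k n Λ} {F : MonomialDatum k n Λ}

theorem isWeier (hF : F.IsMonomialCase p T) : IsWeier (p ^ F.e) (F.h p) := by
  refine isWeier_h hF.coef_free fun i hi => ?_
  rw [← order_ne_zero_iff_constCoeff_eq_zero]
  exact (pos_of_gt (hF.coef_order i hi)).ne'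

theorem muDiv_mul_le_of_remainder (hF : F.IsMonomialCase p T) {i : ℕ} {f c g : CompletedRing k n}
    (hf : f ∈ T.R.level i) (hc : DegX1LT (p ^ F.e) c) (hfc : f = c + F.h p * g) {l : Λ}
    (hl : l ∈ T.E) {s : Fin (n + 1) →₀ ℕ} (hs : coeff s c ≠ 0) :
    F.muDiv l * i ≤ s (T.pos l) := by
  obtain ⟨c', hc', rfl⟩ := hF.isWeier.exists_isExpansion hc hfc
  have := X_pow_dvd_iff_le.1 (hF.dvd_const i f hf c' hc' l hl) s hs
  have h2 : ((F.m l * i : ℕ) : ℚ) / F.a ≤ s (T.pos l) := (Nat.ceil_le.1 this)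
  rw [muDiv]
  calc (F.m l : ℚ) / F.a * i = ((F.m l * i : ℕ) : ℚ) / F.a := by push_cast; ring
    _ ≤ _ := h2

/-- The derivative ∂^(q - i) h lies at level i and has degree i < q in x_1, so it is its own
remainder modulo h. Its part free of x_1 is a_i, with binomial coefficient 1. -/
theorem muDiv_mul_le_of_coef (hF : F.IsMonomialCase p T) {i : ℕ} (hi : 1 ≤ i)
    (hi' : i < p ^ F.e) {l : Λ} (hl : l ∈ T.E) {u : Fin (n + 1) →₀ ℕ}
    (hu : coeff u (F.coef i) ≠ 0) : F.muDiv l * i ≤ u (T.pos l) := by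
  have hmem : i ∈ Finset.Icc 1 (p ^ F.e) := Finset.mem_Icc.2 ⟨hi, hi'.le⟩
  have hu0 : u 0 = 0 := by
    by_contra hc
    exact hu (hF.coef_free i hmem u hc)
  have h1 := hF.hasse_mem _ _ hF.h_mem (p ^ F.e - i)
  rw [Nat.sub_sub_self hi'.le] at h1
  refine hF.muDiv_mul_le_of_remainder (g := 0) h1 ?_ (by ring) hl (s := u) ?_
  · intro s hs
    rw [coeff_hasse_single_zero]
    by_contra hc
    have := hF.isWeier.le (right_ne_zero_of_mul hc)
    simp only [Finsupp.add_apply, Finsupp.single_eq_same] at this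
    omega
  · rw [coeff_hasse_single_zero, coeff_h_add_single hF.coef_free hmem hu0, hu0, zero_add,
      Nat.choose_self, Nat.cast_one, one_mul]
    exact hu

theorem slopeDiv_mul_le_of_coef (hF : F.IsMonomialCase p T) {i : ℕ}
    (hi : i ∈ Finset.Icc 1 (p ^ F.e)) {l : Λ} (hl : l ∈ T.E) {u : Fin (n + 1) →₀ ℕ}
    (hu : coeff u (F.coef i) ≠ 0) : F.slopeDiv p T l * i ≤ u (T.pos l) := by
  have hi' := Finset.mem_Icc.1 hi
  obtain h | h := hi'.2.lt_or_eq
  · refine le_trans ?_ (hF.muDiv_mul_le_of_coef hi'.1 h hl hu)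
    exact mul_le_mul_of_nonneg_right (slopeDiv_le_muDiv l) (Nat.cast_nonneg i)
  · subst h
    exact slopeDiv_mul_le_of_coeff_last (by omega) l hu

end IsMonomialCase

end MonomialDatum

/-- Among the monomials of minimal weight of a power series there is one of maximal degree in
`x_1`. -/
theorem exists_extremal_monomial {k : Type*} [Field k] {n : ℕ} {f : CompletedRing k n}
    (w : (Fin (n + 1) →₀ ℕ) → ℕ) (hw : ∀ t, t 0 ≤ w t) (hf : ∃ s, coeff s f ≠ 0) :
    ∃ t, coeff t f ≠ 0 ∧ (∀ t', coeff t' f ≠ 0 → w t ≤ w t') ∧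
      ∀ t', coeff t' f ≠ 0 → w t' = w t → t' 0 ≤ t 0 := by
  classical
  have hex : ∃ m, ∃ s, coeff s f ≠ 0 ∧ w s = m := by
    obtain ⟨s, hs⟩ := hf
    exact ⟨_, s, hs, rfl⟩
  have hex' : ∃ m, ∃ s, coeff s f ≠ 0 ∧ w s = Nat.find hex ∧ w s - s 0 = m := by
    obtain ⟨s, hs, h⟩ := Nat.find_spec hex
    exact ⟨_, s, hs, h, rfl⟩
  obtain ⟨t, ht, htw, htm⟩ := Nat.find_spec hex'
  refine ⟨t, ht, fun t' ht' => ?_, fun t' ht' he => ?_⟩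
  · rw [htw]
    exact Nat.find_min' hex ⟨t', ht', rfl⟩
  · have := Nat.find_min' hex' ⟨t', ht', he.trans htw, rfl⟩
    rw [← htm, he] at this
    have h1 := hw t'
    have h2 := hw t
    omega

/-! ### The Newton polyhedron of the elements of the filtration -/

namespace MonomialDatum.IsMonomialCase

variable {k : Type*} [Field k] {n : ℕ} {Λ : Type*}
variable {p : ℕ} {T : Triplet k n Λ} {F : MonomialDatum k n Λ}

/-- The Newton polyhedron of an element of the filtration. -/
theorem slopeDiv_mul_sub_le (hF : F.IsMonomialCase p T) (hq : 0 < p ^ F.e) {i : ℕ}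
    {f : CompletedRing k n} (hf : f ∈ T.R.level i) {l : Λ} (hl : l ∈ T.E)
    {s : Fin (n + 1) →₀ ℕ} (hs : coeff s f ≠ 0) :
    F.slopeDiv p T l * (i - s 0) ≤ s (T.pos l) := by
  by_contra! hlt
  set H := F.slopeDiv p T l with hH
  have hH0 : 0 ≤ H := slopeDiv_nonneg hq l
  have hHpos : 0 < H := by
    refine lt_of_le_of_ne hH0 fun h => ?_
    rw [← h, zero_mul] at hlt
    exact absurd hlt (not_lt.2 (Nat.cast_nonneg _))
  set q := p ^ F.e with hqe
  obtain ⟨N, hN⟩ : ∃ N : ℕ, (N : ℤ) = H.num := ⟨H.num.toNat, Int.toNat_of_nonneg (Rat.num_nonneg.2 hH0)⟩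
  set D := H.den with hD
  have hDpos : (0 : ℚ) < D := by exact_mod_cast H.den_pos
  have hDH : (D : ℚ) * H = N := by
    rw [mul_comm, Rat.mul_den_eq_num, ← hN]
    norm_cast
  have hNpos : 0 < N := by
    have : (0 : ℚ) < N := hDH ▸ mul_pos hDpos hHpos
    exact_mod_cast this
  -- With H = N / D, give x_1 the weight N and x_D the weight D. The assertion becomes that all
  -- monomials of an element at level i have weight at least N i. The weight N q of x_1^q is minimal
  -- among the terms of h.
  let w : (Fin (n + 1) →₀ ℕ) → ℕ := fun t => D * t (T.pos l) + N * t 0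
  have hwdef : ∀ t, w t = D * t (T.pos l) + N * t 0 := fun _ => rfl
  have hw0 : ∀ t, t 0 ≤ w t := fun t => by rw [hwdef]; nlinarith
  have hwadd : ∀ t t', w (t + t') = w t + w t' := fun t t' => by
    simp only [hwdef, Finsupp.add_apply]; ring
  have hl0 := hF.pos_ne l hl
  have hwsingle : ∀ j, w (Finsupp.single 0 j) = N * j := fun j => by
    simp [hwdef, hl0]
  have hconv : ∀ (t : Fin (n + 1) →₀ ℕ) (j : ℕ), H * j ≤ t (T.pos l) → N * j ≤ D * t (T.pos l) := by
    intro t j h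
    have : (N : ℚ) * j ≤ D * t (T.pos l) := by
      rw [← hDH, mul_assoc]
      exact mul_le_mul_of_nonneg_left h hDpos.le
    exact_mod_cast this
  obtain ⟨t₁, ht₁, hmin, hmax⟩ := exists_extremal_monomial w hw0 ⟨s, hs⟩
  have hlt₁ : w t₁ < N * i := by
    refine lt_of_le_of_lt (hmin s hs) ?_
    have h2 : (D : ℚ) * s (T.pos l) < N * i - N * s 0 := by
      rw [← hDH, ← mul_sub, mul_assoc]
      exact mul_lt_mul_of_pos_left hlt hDpos
    have h3 : (w s : ℚ) < N * i := by
      rw [hwdef]; push_cast; linarith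
    exact_mod_cast h3
  set m := t₁ 0 with hm
  have hmi : m < i := by
    have h1 : w t₁ = D * t₁ (T.pos l) + N * m := rfl
    have : N * m < N * i := by omega
    exact lt_of_mul_lt_mul_left this (Nat.zero_le _)
  -- Among the monomials of least weight, `t₁` has the largest degree m in x_1. The m-th derivative
  -- removes x_1 from it, and every monomial of least weight in the derivative is then free of x_1.
  have hf₁ := hF.hasse_mem i f hf m
  set f₁ := hasse (Finsupp.single 0 m) f with hf₁def
  obtain ⟨v₀, hv₀⟩ : ∃ v₀, t₁ = v₀ + Finsupp.single 0 m :=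
    ⟨t₁ - Finsupp.single 0 m, (tsub_add_cancel_of_le (by rw [Finsupp.single_le_iff])).symm⟩
  have hv₀0 : v₀ 0 = 0 := by
    have := DFunLike.congr_fun hv₀ 0
    simp only [Finsupp.add_apply, Finsupp.single_eq_same] at this
    omega
  have hwv₀ : w t₁ = w v₀ + N * m := by rw [hv₀, hwadd, hwsingle]
  have hcv₀ : coeff v₀ f₁ ≠ 0 := by
    rw [hf₁def, coeff_hasse_single_zero, hv₀0, zero_add, Nat.choose_self, Nat.cast_one, one_mul,
      ← hv₀]
    exact ht₁
  have hv : ∀ v, coeff v f₁ ≠ 0 → w v₀ ≤ w v ∧ (w v = w v₀ → v 0 = 0) := by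
    intro v hv
    rw [hf₁def, coeff_hasse_single_zero] at hv
    have hv' := right_ne_zero_of_mul hv
    have h1 := hmin _ hv'
    have h2 := hmax _ hv'
    rw [hwadd, hwsingle] at h1 h2
    refine ⟨by omega, fun h => ?_⟩
    have h3 := h2 (by omega)
    simp only [Finsupp.add_apply, Finsupp.single_eq_same] at h3
    omega
  have hlt₂ : w v₀ < N * (i - m) := by
    rw [Nat.mul_sub]
    omega
  obtain ⟨c, g, hc, hcg⟩ := hF.isWeier.exists_division f₁
  -- By hypothesis (i) and H ≤ μ, the monomials of the remainder are too heavy to include `v₀`,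
  -- which must therefore come from h g.
  have hcv : coeff v₀ c = 0 := by
    by_contra hne
    have h1 := hF.muDiv_mul_le_of_remainder hf₁ hc hcg hl hne
    have h2 := hconv v₀ (i - m) (le_trans
      (mul_le_mul_of_nonneg_right (slopeDiv_le_muDiv l) (Nat.cast_nonneg _)) h1)
    rw [hwdef] at hlt₂
    omega
  have hhg : coeff v₀ (F.h p * g) ≠ 0 := by
    rw [hcg, map_add, hcv, zero_add] at hcv₀
    exact hcv₀
  have hwh : ∀ u, coeff u (F.h p) ≠ 0 → N * q ≤ w u := by
    intro u hu
    obtain rfl | ⟨j, hj, u', hu', rfl, hcu⟩ := exists_of_coeff_h_ne_zero hF.coef_free hu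
    · rw [hwsingle]
    · have hj' := Finset.mem_Icc.1 hj
      rw [hwadd, hwsingle, ← hqe]
      have h1 := hconv u' j (hF.slopeDiv_mul_le_of_coef hj hl hcu)
      have h2 : D * u' (T.pos l) ≤ w u' := by rw [hwdef]; omega
      calc N * q = N * j + N * (q - j) := by rw [← Nat.mul_add, Nat.add_sub_cancel' hj'.2]
        _ ≤ _ := by omega
  obtain ⟨u, v, huv, hu, hvg⟩ := exists_coeff_ne_zero_of_mul hhg
  -- The extremal monomial of g yields x_1^q x^t in h g without cancellation, and the remainder
  -- cannot cancel it either. Its weight is at most that of `v₀`, hence least, although it involves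
  -- x_1: a contradiction.
  obtain ⟨t, ht, htmin, htmax⟩ := exists_extremal_monomial w hw0 ⟨v, hvg⟩
  have hlead : coeff (Finsupp.single 0 q + t) (F.h p * g) = coeff (Finsupp.single 0 q) (F.h p) *
      coeff t g := by
    refine coeff_mul_eq_of_unique rfl fun u' v' he hu' hv' => ?_
    have h1 := hwh u' hu'
    have h2 := htmin v' hv'
    have h3 := congrArg w he
    rw [hwadd, hwadd, hwsingle] at h3
    have h4 := htmax v' hv' (by omega)
    have h5 := hF.isWeier.le hu'
    have h6 := DFunLike.congr_fun he 0
    simp only [Finsupp.add_apply, Finsupp.single_eq_same] at h6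
    have h7 := hF.isWeier.eq_of_le hu' (by omega)
    subst h7
    exact ⟨rfl, add_left_cancel he⟩
  have hf₁t : coeff (Finsupp.single 0 q + t) f₁ ≠ 0 := by
    rw [hcg, map_add, hc _ (by simp [← hqe]), zero_add, hlead, hF.isWeier.coeff_lead, one_mul]
    exact ht
  obtain ⟨h1, h2⟩ := hv _ hf₁t
  rw [hwadd, hwsingle] at h1 h2
  have h3 := hwh u hu
  have h4 := htmin v hvg
  have h5 := congrArg w huv
  rw [hwadd] at h5
  have h6 := h2 (by omega)
  simp only [Finsupp.add_apply, Finsupp.single_eq_same] at h6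
  omega

end MonomialDatum.IsMonomialCase

namespace MonomialDatum

variable {k : Type*} [Field k] {n : ℕ} {Λ : Type*}
variable {p : ℕ} {T : Triplet k n Λ} {F : MonomialDatum k n Λ}

/-! ### Characterization of the tight monomial case -/

theorem isTight_iff_slope_eq : F.IsTight p T ↔ F.slope p T = F.ordTight p T := by
  rw [IsTight, invHeart, sub_eq_zero]

theorem M_eq_monomial :
    F.M T = monomial (∑ l ∈ T.E, Finsupp.single (T.pos l) (F.m l)) 1 :=
  prod_X_pow_eq_monomial _ _ _

theorem coeff_M_ne_zero {s : Fin (n + 1) →₀ ℕ} (hs : coeff s (F.M T) ≠ 0) :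
    s = ∑ l ∈ T.E, Finsupp.single (T.pos l) (F.m l) := by
  rw [M_eq_monomial] at hs
  exact eq_of_coeff_monomial_ne_zero hs

theorem muDiv_mul_a (ha : 0 < F.a) (l : Λ) : F.muDiv l * F.a = F.m l := by
  rw [muDiv, div_mul_cancel₀]
  exact_mod_cast ha.ne'

theorem mu_eq_sum_div : F.mu T = ((∑ l ∈ T.E, F.m l : ℕ) : ℚ) / F.a := by
  rw [mu, Nat.cast_sum, Finset.sum_div]
  rfl

theorem divOrder_eq_of_forall {i : Fin (n + 1)} {f : CompletedRing k n} {N : ℕ}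
    (h : ∀ s, coeff s f ≠ 0 → N ≤ s i) (h' : ∃ s, coeff s f ≠ 0 ∧ s i = N) :
    divOrder i f = N := by
  refine le_antisymm ?_ (natCast_le_divOrder_iff.2 h)
  obtain ⟨s, hs, he⟩ := h'
  by_contra! hc
  have h1 : ((N + 1 : ℕ) : ℕ∞) ≤ divOrder i f := by
    push_cast
    exact Order.add_one_le_of_lt hc
  have := natCast_le_divOrder_iff.1 h1 s hs
  omega

namespace IsMonomialCase

theorem ordTight_mul_le_degree (hF : F.IsMonomialCase p T) (hq : 0 < p ^ F.e)
    {s : Fin (n + 1) →₀ ℕ} (hs : coeff s (F.last p) ≠ 0) :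
    F.ordTight p T * (p ^ F.e : ℕ) ≤ s.degree := by
  rw [ordTight, Finset.sum_mul]
  calc ∑ l ∈ T.E, F.slopeDiv p T l * (p ^ F.e : ℕ) ≤ ∑ l ∈ T.E, (s (T.pos l) : ℚ) :=
        Finset.sum_le_sum fun l _ => slopeDiv_mul_le_of_coeff_last hq l hs
    _ ≤ s.degree := by exact_mod_cast sum_apply_le_degree hF.pos_injOn s

theorem ordTight_le_ordQuot (hF : F.IsMonomialCase p T) (hq : 0 < p ^ F.e) :
    (F.ordTight p T : WithTop ℚ) ≤ ordQuot (F.last p).order (p ^ F.e) :=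
  (le_ordQuot_order_iff hq).2 fun _ hs => hF.ordTight_mul_le_degree hq hs

/-- Both terms of the minimum defining the slope at P are at least ord_P(M_tight), so the minimum
equals it exactly if one of them does. -/
theorem isTight_iff (hF : F.IsMonomialCase p T) (hq : 0 < p ^ F.e) :
    F.IsTight p T ↔ F.TypeI p T ∨ F.TypeII p T := by
  rw [isTight_iff_slope_eq, ← WithTop.coe_inj, coe_slope, TypeI, TypeII]
  constructor
  · intro h
    obtain h' | h' := min_choice (ordQuot (F.last p).order (p ^ F.e)) (F.mu T : WithTop ℚ)
    · exact Or.inl (h' ▸ h)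
    · exact Or.inr (WithTop.coe_inj.1 (h' ▸ h))
  · rintro (h | h)
    · rw [h]
      exact min_eq_left (WithTop.coe_le_coe.2 ordTight_le_mu)
    · rw [h]
      exact min_eq_right (hF.ordTight_le_ordQuot hq)

/-- The exponents of every monomial of a_q are at least H_D q. A monomial whose degree is the sum of
these bounds attains all of them, so its exponents along the components are minimal and its
coefficient becomes the constant term of the cofactor. -/
theorem typeI_iff (hF : F.IsMonomialCase p T) (hq : 0 < p ^ F.e) :
    F.TypeI p T ↔ ∃ r : Λ → ℕ,
        (∀ l ∈ T.E, F.slopeDiv p T l * (p ^ F.e : ℕ) = r l ∧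
          divOrder (T.pos l) (F.last p) = r l) ∧
        ∃ u : CompletedRing k n, IsUnit u ∧
          F.last p = u * ∏ l ∈ T.E, MvPowerSeries.X (T.pos l) ^ r l := by
  have hq' : (0 : ℚ) < (p ^ F.e : ℕ) := by exact_mod_cast hq
  constructor
  · intro h
    have hfin : (F.last p).order ≠ ⊤ := by
      intro htop
      rw [TypeI, htop] at h
      exact WithTop.coe_ne_top h.symm
    obtain ⟨N, hN⟩ := ENat.ne_top_iff_exists.1 hfin
    obtain ⟨s, hs, hsN⟩ := exists_coeff_ne_zero_degree_eq hN.symm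
    have hN' : (N : ℚ) = ∑ l ∈ T.E, F.slopeDiv p T l * (p ^ F.e : ℕ) := by
      rw [TypeI, ← hN, ordQuot_natCast, WithTop.coe_inj, div_eq_iff hq'.ne', ordTight,
        Finset.sum_mul] at h
      exact h
    have hle : ∀ l ∈ T.E, F.slopeDiv p T l * (p ^ F.e : ℕ) ≤ (s (T.pos l) : ℚ) :=
      fun l _ => slopeDiv_mul_le_of_coeff_last hq l hs
    have hsum : ∑ l ∈ T.E, F.slopeDiv p T l * (p ^ F.e : ℕ) = ∑ l ∈ T.E, (s (T.pos l) : ℚ) := by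
      refine le_antisymm (Finset.sum_le_sum hle) ?_
      rw [← hN', ← hsN]
      exact_mod_cast sum_apply_le_degree hF.pos_injOn s
    have heq := (Finset.sum_eq_sum_iff_of_le hle).1 hsum
    have hall : ∀ t, coeff t (F.last p) ≠ 0 → ∀ l ∈ T.E, s (T.pos l) ≤ t (T.pos l) := by
      intro t ht l hl
      have := slopeDiv_mul_le_of_coeff_last (T := T) hq l ht
      rw [heq l hl] at this
      exact_mod_cast this
    refine ⟨fun l => s (T.pos l), fun l hl => ⟨heq l hl, ?_⟩, ?_⟩
    · exact divOrder_eq_of_forall (fun t ht => hall t ht l hl) ⟨s, hs, rfl⟩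
    · obtain ⟨u, hu⟩ := (prod_X_pow_dvd_iff hF.pos_injOn).2 hall
      refine ⟨u, ?_, by rw [hu, mul_comm]⟩
      rw [MvPowerSeries.isUnit_iff_constantCoeff, isUnit_iff_ne_zero]
      intro h0
      apply hs
      rw [hu, mul_comm, prod_X_pow_eq_monomial, coeff_mul_of_degree_le, h0, zero_mul]
      intro t ht
      rw [eq_of_coeff_monomial_ne_zero ht, degree_sum_single, hsN]
      have : (N : ℚ) = ∑ l ∈ T.E, (s (T.pos l) : ℚ) := by rw [hN', hsum]
      exact_mod_cast this.le
  · rintro ⟨r, hr, u, hu, he⟩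
    have hu0 : constantCoeff u ≠ 0 :=
      isUnit_iff_ne_zero.1 (MvPowerSeries.isUnit_iff_constantCoeff.1 hu)
    have hord : (F.last p).order = (∑ l ∈ T.E, r l : ℕ) := by
      have h1 : u.order = 0 := by
        by_contra hc
        exact hu0 (order_ne_zero_iff_constCoeff_eq_zero.1 hc)
      rw [he, order_mul, h1, zero_add, prod_X_pow_eq_monomial,
        order_monomial_of_ne_zero one_ne_zero, degree_sum_single]
    rw [TypeI, hord, ordQuot_natCast, WithTop.coe_inj, div_eq_iff hq'.ne', ordTight,
      Finset.sum_mul, Finset.sum_congr rfl fun l hl => (hr l hl).1]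
    push_cast
    rfl

theorem typeII_iff_forall : F.TypeII p T ↔ ∀ l ∈ T.E, F.slopeDiv p T l = F.muDiv l := by
  rw [TypeII, mu, ordTight, eq_comm, Finset.sum_eq_sum_iff_of_le fun l _ => slopeDiv_le_muDiv l]

theorem typeII_iff (hF : F.IsMonomialCase p T) :
    F.TypeII p T ↔ ∃ r : Λ → ℕ,
        (∀ l ∈ T.E, F.slopeDiv p T l * F.a = r l ∧ F.muDiv l * F.a = r l ∧
          divOrder (T.pos l) (F.M T) = r l) ∧
        ∏ l ∈ T.E, MvPowerSeries.X (T.pos l) ^ r l = F.M T := by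
  have ha : (0 : ℚ) < F.a := by exact_mod_cast hF.a_pos
  rw [typeII_iff_forall]
  constructor
  · intro h
    refine ⟨F.m, fun l hl => ?_, rfl⟩
    have h1 := muDiv_mul_a hF.a_pos l
    refine ⟨by rw [h l hl, h1], h1, ?_⟩
    refine divOrder_eq_of_forall (fun s hs => ?_)
      ⟨∑ l ∈ T.E, Finsupp.single (T.pos l) (F.m l), ?_,
        sum_single_apply_of_injOn hF.pos_injOn hl⟩
    · rw [coeff_M_ne_zero hs, sum_single_apply_of_injOn hF.pos_injOn hl]
    · rw [M_eq_monomial, coeff_monomial_same]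
      exact one_ne_zero
  · rintro ⟨r, hr, -⟩ l hl
    obtain ⟨h1, h2, -⟩ := hr l hl
    exact mul_right_cancel₀ ha.ne' (h1.trans h2.symm)

theorem one_lt_mu (hF : F.IsMonomialCase p T) : 1 < F.mu T := by
  have ha : (0 : ℚ) < F.a := by exact_mod_cast hF.a_pos
  rw [mu_eq_sum_div, one_lt_div ha]
  exact_mod_cast hF.lt_sum_m

/-- Both terms of the slope exceed 1: the order of a_q is an integer greater than q, and ∑ m_D > a.
The strict inequality is what controls the leading forms of the filtration. -/
theorem one_lt_ordTight (hF : F.IsMonomialCase p T) (hq : 0 < p ^ F.e) (ht : F.IsTight p T) :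
    1 < F.ordTight p T := by
  rw [← isTight_iff_slope_eq.1 ht, ← WithTop.coe_lt_coe, coe_slope]
  refine lt_min ?_ (WithTop.coe_lt_coe.2 hF.one_lt_mu)
  have hq' : (0 : ℚ) < (p ^ F.e : ℕ) := by exact_mod_cast hq
  refine lt_of_lt_of_le (b := (((p ^ F.e + 1 : ℕ) / (p ^ F.e : ℕ) : ℚ) : WithTop ℚ)) ?_ ?_
  · refine WithTop.coe_lt_coe.2 ?_
    rw [one_lt_div hq']
    push_cast
    linarith
  · rw [le_ordQuot_order_iff hq]
    intro s hs
    rw [div_mul_cancel₀ _ hq'.ne']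
    exact_mod_cast natCast_lt_order_iff.1
      (hF.coef_order _ (Finset.mem_Icc.2 ⟨hq, le_rfl⟩)) s hs

/-! ### Independence of the choice of `h` and `M` -/

variable {F' : MonomialDatum k n Λ}

/-- If q < q', then h is its own remainder modulo h'. Since x_1^q occurs in it at level q > 0, all
exponents of M' would vanish, against ∑ m'_D > a'. -/
theorem pow_e_le (hF : F.IsMonomialCase p T) (hF' : F'.IsMonomialCase p T) (hq : 0 < p ^ F.e) :
    p ^ F'.e ≤ p ^ F.e := by
  by_contra! hlt
  have hdeg : DegX1LT (p ^ F'.e) (F.h p) := by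
    intro s hs
    by_contra hc
    have := hF.isWeier.le hc
    omega
  have h0 : ∀ l ∈ T.E, F'.m l = 0 := by
    intro l hl
    have h1 := hF'.muDiv_mul_le_of_remainder (g := 0) hF.h_mem hdeg (by ring) hl
      (s := Finsupp.single 0 (p ^ F.e)) (by rw [hF.isWeier.coeff_lead]; exact one_ne_zero)
    have h2 : Finsupp.single (0 : Fin (n + 1)) (p ^ F.e) (T.pos l) = 0 := by
      rw [Finsupp.single_apply, if_neg (hF.pos_ne l hl).symm]
    rw [h2, Nat.cast_zero] at h1
    have hq' : (0 : ℚ) < (p ^ F.e : ℕ) := by exact_mod_cast hq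
    have h3 : F'.muDiv l = 0 := by
      refine le_antisymm ?_ (muDiv_nonneg l)
      by_contra! hc
      exact absurd h1 (not_le.2 (mul_pos hc hq'))
    have h4 := muDiv_mul_a hF'.a_pos l
    rw [h3, zero_mul] at h4
    exact_mod_cast h4.symm
  have := hF'.lt_sum_m
  rw [Finset.sum_eq_zero h0] at this
  omega

/-- M does not involve x_1, so it is its own remainder modulo h', and hypothesis (i) for the second
datum bounds its exponents. -/
theorem muDiv_le (hF : F.IsMonomialCase p T) (hF' : F'.IsMonomialCase p T) (hq : 0 < p ^ F'.e)
    {l : Λ} (hl : l ∈ T.E) : F'.muDiv l ≤ F.muDiv l := by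
  have ha : (0 : ℚ) < F.a := by exact_mod_cast hF.a_pos
  have hdeg : DegX1LT (p ^ F'.e) (F.M T) := by
    intro s hs
    by_contra hc
    rw [coeff_M_ne_zero hc, sum_single_apply_of_notMem hF.pos_ne] at hs
    omega
  have h1 := hF'.muDiv_mul_le_of_remainder (g := 0) hF.M_mem hdeg (by ring) hl
    (s := ∑ l ∈ T.E, Finsupp.single (T.pos l) (F.m l))
    (by rw [M_eq_monomial, coeff_monomial_same]; exact one_ne_zero)
  rw [sum_single_apply_of_injOn hF.pos_injOn hl, ← muDiv_mul_a hF.a_pos l] at h1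
  exact le_of_mul_le_mul_right h1 ha

theorem muDiv_eq (hF : F.IsMonomialCase p T) (hF' : F'.IsMonomialCase p T) (hp : 0 < p)
    {l : Λ} (hl : l ∈ T.E) : F'.muDiv l = F.muDiv l :=
  le_antisymm (hF.muDiv_le hF' (Nat.pow_pos hp) hl) (hF'.muDiv_le hF (Nat.pow_pos hp) hl)

/-- The difference h' - h is the remainder of h' modulo h, and its part free of x_1 is a'_q - a_q. A
change of h thus alters a_q only by terms beyond the bound μ, where the slopes are cut off. -/
theorem muDiv_mul_le_of_last_sub (hF : F.IsMonomialCase p T) (hF' : F'.IsMonomialCase p T)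
    (hp : 0 < p) {l : Λ} (hl : l ∈ T.E) {u : Fin (n + 1) →₀ ℕ}
    (hu : coeff u (F'.last p - F.last p) ≠ 0) :
    F.muDiv l * (p ^ F.e : ℕ) ≤ u (T.pos l) := by
  have hq : 0 < p ^ F.e := Nat.pow_pos hp
  have he : p ^ F'.e = p ^ F.e :=
    le_antisymm (hF.pow_e_le hF' hq) (hF'.pow_e_le hF (Nat.pow_pos hp))
  have hm : p ^ F.e ∈ Finset.Icc 1 (p ^ F.e) := Finset.mem_Icc.2 ⟨hq, le_rfl⟩
  have hm' : p ^ F'.e ∈ Finset.Icc 1 (p ^ F'.e) := Finset.mem_Icc.2 ⟨Nat.pow_pos hp, le_rfl⟩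
  have hu0 : u 0 = 0 := by
    by_contra hc
    apply hu
    rw [map_sub, last, last, hF.coef_free _ hm u hc, hF'.coef_free _ hm' u hc, sub_zero]
  have hh : ∀ {G : MonomialDatum k n Λ}, G.IsMonomialCase p T →
      coeff u (G.h p) = coeff u (G.last p) := by
    intro G hG
    have := coeff_h_add_single hG.coef_free
      (Finset.mem_Icc.2 ⟨Nat.one_le_iff_ne_zero.2 (Nat.pow_pos hp).ne', le_rfl⟩) hu0
    rwa [Nat.sub_self, Finsupp.single_zero, add_zero] at this
  have hmem : F'.h p ∈ T.R.level (p ^ F.e) := he ▸ hF'.h_mem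
  refine hF.muDiv_mul_le_of_remainder (c := F'.h p - F.h p) (g := 1) hmem ?_ (by ring) hl
    (s := u) ?_
  · intro s hs
    rw [map_sub, sub_eq_zero]
    have hW' := hF'.isWeier
    rw [he] at hW'
    by_cases hse : s = Finsupp.single 0 (p ^ F.e)
    · rw [hse, hF.isWeier.coeff_lead, hW'.coeff_lead]
    · have h1 : coeff s (F.h p) = 0 := by
        by_contra hc
        exact hse (hF.isWeier.eq_of_le hc hs)
      have h2 : coeff s (F'.h p) = 0 := by
        by_contra hc
        exact hse (hW'.eq_of_le hc hs)
      rw [h1, h2]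
  · rw [map_sub, hh hF', hh hF, ← map_sub]
    exact hu

theorem slopeDiv_le_slopeDiv (hF : F.IsMonomialCase p T) (hF' : F'.IsMonomialCase p T)
    (hp : 0 < p) {l : Λ} (hl : l ∈ T.E) : F'.slopeDiv p T l ≤ F.slopeDiv p T l := by
  have hq : 0 < p ^ F.e := Nat.pow_pos hp
  have he : p ^ F'.e = p ^ F.e :=
    le_antisymm (hF.pow_e_le hF' hq) (hF'.pow_e_le hF (Nat.pow_pos hp))
  have hle := slopeDiv_le_muDiv (p := p) (T := T) (F := F') l
  rw [hF.muDiv_eq hF' hp hl] at hle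
  rw [← WithTop.coe_le_coe, coe_slopeDiv (F := F)]
  refine le_min ((le_ordQuot_divOrder_iff hq).2 fun s hs => ?_) (WithTop.coe_le_coe.2 hle)
  by_cases hs' : coeff s (F'.last p) = 0
  · refine le_trans (mul_le_mul_of_nonneg_right hle (Nat.cast_nonneg _))
      (hF.muDiv_mul_le_of_last_sub hF' hp hl ?_)
    rw [map_sub, hs', zero_sub]
    exact neg_ne_zero.2 hs
  · rw [← he]
    exact slopeDiv_mul_le_of_coeff_last (Nat.pow_pos hp) l hs'

theorem slopeDiv_eq (hF : F.IsMonomialCase p T) (hF' : F'.IsMonomialCase p T)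
    (hp : 0 < p) {l : Λ} (hl : l ∈ T.E) : F'.slopeDiv p T l = F.slopeDiv p T l :=
  le_antisymm (hF.slopeDiv_le_slopeDiv hF' hp hl) (hF'.slopeDiv_le_slopeDiv hF hp hl)

theorem ordTight_eq (hF : F.IsMonomialCase p T) (hF' : F'.IsMonomialCase p T)
    (hp : 0 < p) : F'.ordTight p T = F.ordTight p T :=
  Finset.sum_congr rfl fun _ hl => hF.slopeDiv_eq hF' hp hl

theorem mu_eq (hF : F.IsMonomialCase p T) (hF' : F'.IsMonomialCase p T)
    (hp : 0 < p) : F'.mu T = F.mu T :=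
  Finset.sum_congr rfl fun _ hl => hF.muDiv_eq hF' hp hl

theorem slope_le_slope (hF : F.IsMonomialCase p T) (hF' : F'.IsMonomialCase p T)
    (hp : 0 < p) : F'.slope p T ≤ F.slope p T := by
  have hq : 0 < p ^ F.e := Nat.pow_pos hp
  have he : p ^ F'.e = p ^ F.e :=
    le_antisymm (hF.pow_e_le hF' hq) (hF'.pow_e_le hF (Nat.pow_pos hp))
  have h1 : (F'.slope p T : WithTop ℚ) ≤ ordQuot (F'.last p).order (p ^ F'.e) := by
    rw [coe_slope]
    exact min_le_left _ _
  have h2 : F'.slope p T ≤ F.mu T := by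
    rw [← hF.mu_eq hF' hp, ← WithTop.coe_le_coe, coe_slope]
    exact min_le_right _ _
  rw [← WithTop.coe_le_coe, coe_slope (F := F)]
  refine le_min ((le_ordQuot_order_iff hq).2 fun s hs => ?_) (WithTop.coe_le_coe.2 h2)
  by_cases hs' : coeff s (F'.last p) = 0
  · refine le_trans (mul_le_mul_of_nonneg_right h2 (Nat.cast_nonneg _)) ?_
    rw [mu, Finset.sum_mul]
    calc ∑ l ∈ T.E, F.muDiv l * (p ^ F.e : ℕ) ≤ ∑ l ∈ T.E, (s (T.pos l) : ℚ) := by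
          refine Finset.sum_le_sum fun l hl => hF.muDiv_mul_le_of_last_sub hF' hp hl ?_
          rw [map_sub, hs', zero_sub]
          exact neg_ne_zero.2 hs
      _ ≤ s.degree := by exact_mod_cast sum_apply_le_degree hF.pos_injOn s
  · rw [← he]
    exact (le_ordQuot_order_iff (Nat.pow_pos hp)).1 h1 s hs'

theorem isTight_of_isTight (hF : F.IsMonomialCase p T) (hF' : F'.IsMonomialCase p T)
    (hp : 0 < p) (ht : F.IsTight p T) : F'.IsTight p T := by
  rw [isTight_iff_slope_eq] at ht ⊢
  rw [hF.ordTight_eq hF' hp, ← ht]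
  exact le_antisymm (hF.slope_le_slope hF' hp) (hF'.slope_le_slope hF hp)

end IsMonomialCase

end MonomialDatum

/-! ### Binomial coefficients in characteristic exponent `p` -/

section Binomial

variable (k : Type*) [Field k] (p : ℕ) [ExpChar k p]

/-- Compare coefficients in (1 + X)^(p^v m) = (1 + X^(p^v))^m. -/
theorem cast_choose_pow_mul (v m t : ℕ) : ((p ^ v * m).choose t : k) =
    if p ^ v ∣ t then (m.choose (t / p ^ v) : k) else 0 := by
  have hpos : 0 < p ^ v := pow_pos (expChar_pos k p) v
  rw [← Polynomial.coeff_one_add_X_pow, pow_mul, add_pow_expChar_pow, one_pow,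
    ← Polynomial.coeff_one_add_X_pow, ← Polynomial.coeff_expand hpos]
  simp

theorem dvd_of_cast_choose_ne_zero {v m t : ℕ} (h : ((p ^ v * m).choose t : k) ≠ 0) :
    p ^ v ∣ t := by
  by_contra hc
  exact h (by rw [cast_choose_pow_mul, if_neg hc])

theorem cast_choose_pow (v m : ℕ) : ((p ^ v * m).choose (p ^ v) : k) = m := by
  have hpos : 0 < p ^ v := pow_pos (expChar_pos k p) v
  rw [cast_choose_pow_mul, if_pos dvd_rfl, Nat.div_self hpos, Nat.choose_one_right]

theorem exists_eq_pow_mul_cast_ne_zero {m : ℕ} (hm : 0 < m) :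
    ∃ v u, m = p ^ v * u ∧ (u : k) ≠ 0 := by
  cases ‹ExpChar k p› with
  | zero => exact ⟨0, m, by simp, by exact_mod_cast hm.ne'⟩
  | prime hp =>
    obtain ⟨v, u, hu, he⟩ := Nat.exists_eq_pow_mul_and_not_dvd hm.ne' p hp.ne_one
    exact ⟨v, u, he, fun h => hu ((CharP.cast_eq_zero_iff k p u).1 h)⟩

end Binomial

theorem pow_dvd_pow_of_pow_le {p a b : ℕ} (hp : 0 < p) (h : p ^ a ≤ p ^ b) : p ^ a ∣ p ^ b := by
  obtain rfl | hp' := Nat.eq_or_lt_of_le (Nat.succ_le_of_lt hp)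
  · simp
  · exact pow_dvd_pow p ((Nat.pow_le_pow_iff_right hp').1 h)

theorem exists_pow_eq_pow_mul_pow {p e j : ℕ} (hp : 0 < p) (h : p ^ e ∣ p ^ j) :
    ∃ a, p ^ j = p ^ e * p ^ a := by
  obtain rfl | hp' := Nat.eq_or_lt_of_le (Nat.succ_le_of_lt hp)
  · exact ⟨0, by simp⟩
  · have := (Nat.pow_le_pow_iff_right hp').1 (Nat.le_of_dvd (pow_pos hp j) h)
    exact ⟨j - e, by rw [← pow_add, Nat.add_sub_cancel' this]⟩

/-! ### Powers whose exponent is a power of the characteristic exponent -/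

section Powers

variable {k : Type*} [Field k] (p : ℕ) [ExpChar k p] {n : ℕ}

theorem coeff_smul_pow (f : CompletedRing k n) (a : ℕ) (d : Fin (n + 1) →₀ ℕ) :
    coeff (p ^ a • d) (f ^ p ^ a) = coeff d f ^ p ^ a := by
  rw [← map_iterateFrobenius_expand p (expChar_ne_zero k p), coeff_map, coeff_expand_smul,
    iterateFrobenius_def]

theorem exists_of_coeff_pow_ne_zero {f : CompletedRing k n} {a : ℕ} {s : Fin (n + 1) →₀ ℕ}
    (hs : coeff s (f ^ p ^ a) ≠ 0) : ∃ d, s = p ^ a • d ∧ coeff d f ≠ 0 := by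
  have hd : ∀ i, p ^ a ∣ s i := by
    intro i
    by_contra hc
    refine hs ?_
    rw [← map_iterateFrobenius_expand p (expChar_ne_zero k p), coeff_map,
      coeff_expand_of_not_dvd _ _ _ hc, map_zero]
  have he : s = p ^ a • s.mapRange (fun j => j / p ^ a) (Nat.zero_div _) := by
    ext i
    simp [Nat.mul_div_cancel' (hd i)]
  refine ⟨_, he, fun hc => hs ?_⟩
  rw [he, coeff_smul_pow, hc, zero_pow (pow_ne_zero _ (expChar_ne_zero k p))]

end Powers

/-! ### Filtrations defined by monomials, and the differential saturation -/

namespace IdealisticFiltration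

theorem pow_mem_level {A : Type*} [CommRing A] (R : IdealisticFiltration A) {i : ℕ} {f : A}
    (hf : f ∈ R.level i) (m : ℕ) : f ^ m ∈ R.level (i * m) := by
  induction m with
  | zero => rw [mul_zero, R.level_zero]; trivial
  | succ m ih =>
    rw [pow_succ, Nat.mul_succ]
    exact R.mul_le _ _ (Ideal.mul_mem_mul ih hf)

variable {k : Type*} [Field k] {n : ℕ}

/-- The filtration whose `i`-th ideal consists of the series with monomials satisfying `Q i`. -/
def ofMonomials (Q : ℕ → (Fin (n + 1) →₀ ℕ) → Prop) (h0 : ∀ s, Q 0 s)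
    (hanti : ∀ i s, Q (i + 1) s → Q i s)
    (hadd : ∀ i j s t, Q i s → Q j t → Q (i + j) (s + t)) :
    IdealisticFiltration (CompletedRing k n) where
  level i :=
    { carrier := {f | ∀ s, coeff s f ≠ 0 → Q i s}
      add_mem' := fun {f g} hf hg s hs => (exists_coeff_ne_zero_of_add hs).elim (hf s) (hg s)
      zero_mem' := fun s hs => absurd (coeff_zero s) hs
      smul_mem' := by
        intro r f hf s hs
        obtain ⟨u, v, rfl, -, hv⟩ := exists_coeff_ne_zero_of_mul hs
        have := hadd 0 i u v (h0 u) (hf v hv)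
        rwa [zero_add] at this }
  level_zero := by
    rw [Ideal.eq_top_iff_one]
    exact fun s _ => h0 s
  antitone := antitone_nat_of_succ_le fun i f hf s hs => hanti i s (hf s hs)
  mul_le i j := by
    rw [Ideal.mul_le]
    intro f hf g hg s hs
    obtain ⟨u, v, rfl, hu, hv⟩ := exists_coeff_ne_zero_of_mul hs
    exact hadd i j u v (hf u hu) (hg v hv)

variable {R : IdealisticFiltration (CompletedRing k n)}

theorem le_dSaturation (i : ℕ) : R.level i ≤ R.dSaturation.level i :=
  le_iInf fun R' => R'.2.2 i

theorem hasse_mem_dSaturation {i : ℕ} {f : CompletedRing k n} (hf : f ∈ R.dSaturation.level i)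
    (I : Fin (n + 1) →₀ ℕ) : hasse I f ∈ R.dSaturation.level (i - I.degree) := by
  refine (Submodule.mem_iInf _).2 fun R' => ?_
  exact R'.2.1 i f ((Submodule.mem_iInf _).1 hf R') I

/-- An induction principle for the saturation: a condition on monomials that is stable under
products and derivatives defines a differentially saturated filtration, so it passes from R to its
saturation. -/
theorem dSaturation_le_ofMonomials {Q : ℕ → (Fin (n + 1) →₀ ℕ) → Prop} (h0 : ∀ s, Q 0 s)
    (hanti : ∀ i s, Q (i + 1) s → Q i s)
    (hadd : ∀ i j s t, Q i s → Q j t → Q (i + j) (s + t))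
    (hD : ∀ i s I, Q i (s + I) → ((∏ j, (s j + I j).choose (I j) : ℕ) : k) ≠ 0 →
      Q (i - I.degree) s)
    (hR : ∀ i, ∀ f ∈ R.level i, ∀ s, coeff s f ≠ 0 → Q i s) {i : ℕ} {f : CompletedRing k n}
    (hf : f ∈ R.dSaturation.level i) {s : Fin (n + 1) →₀ ℕ} (hs : coeff s f ≠ 0) : Q i s := by
  refine (Submodule.mem_iInf _).1 hf
    ⟨ofMonomials Q h0 hanti hadd, fun i f hf I s hs => ?_, fun i f hf => hR i f hf⟩ s hs
  rw [coeff_hasse] at hs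
  exact hD i s I (hf _ (right_ne_zero_of_mul hs)) (left_ne_zero_of_mul hs)

theorem le_degree_of_mem_dSaturation
    (hR : ∀ i, ∀ f ∈ R.level i, ∀ s, coeff s f ≠ 0 → i ≤ s.degree) {i : ℕ}
    {f : CompletedRing k n} (hf : f ∈ R.dSaturation.level i) {s : Fin (n + 1) →₀ ℕ}
    (hs : coeff s f ≠ 0) : i ≤ s.degree := by
  refine dSaturation_le_ofMonomials (Q := fun i s => i ≤ s.degree) (fun _ => Nat.zero_le _)
    (fun i s h => by omega) (fun i j s t h h' => ?_) (fun i s I h _ => ?_) hR hf hs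
  · rw [map_add]; omega
  · rw [map_add] at h; omega

/-! ### Leading forms -/

theorem coeff_sum_smul_X_pow (c : Fin (n + 1) → k) {N : ℕ} (hN : 0 < N) (t : Fin (n + 1)) :
    coeff (Finsupp.single t N) (∑ i, c i • (X i : CompletedRing k n) ^ N) = c t := by
  classical
  rw [map_sum, Finset.sum_eq_single t]
  · rw [coeff_smul, coeff_X_pow, if_pos rfl, mul_one]
  · intro i _ hne
    rw [coeff_smul, coeff_X_pow, if_neg, mul_zero]
    intro h
    have := DFunLike.congr_fun h t
    simp [hne] at this
    omega
  · simp

theorem exists_of_mem_leadingPure {p j : ℕ} (hp : 0 < p) {c : Fin (n + 1) → k}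
    (hc : c ∈ R.leadingPure p j) :
    ∃ f ∈ R.level (p ^ j), ∀ t, c t = coeff (Finsupp.single t (p ^ j)) f := by
  obtain ⟨f, hf, h⟩ := hc
  refine ⟨f, hf, fun t => ?_⟩
  have h1 : coeff (Finsupp.single t (p ^ j))
      (f - ∑ i, c i • (X i : CompletedRing k n) ^ (p ^ j)) = 0 :=
    coeff_of_lt_order (by rw [Finsupp.degree_single]; exact h)
  rw [map_sub, coeff_sum_smul_X_pow c (pow_pos hp j), sub_eq_zero] at h1
  exact h1.symm

theorem mem_leadingPure {p j : ℕ} (hp : 0 < p) {f : CompletedRing k n} (hf : f ∈ R.level (p ^ j))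
    (hord : ∀ s, coeff s f ≠ 0 → p ^ j ≤ s.degree)
    (hpure : ∀ s, coeff s f ≠ 0 → s.degree = p ^ j → ∃ t, s = Finsupp.single t (p ^ j)) :
    (fun t => coeff (Finsupp.single t (p ^ j)) f) ∈ R.leadingPure p j := by
  classical
  refine ⟨f, hf, natCast_lt_order_iff.2 fun s hs => ?_⟩
  have hle : p ^ j ≤ s.degree := by
    by_contra hlt
    refine hs ?_
    rw [map_sub, map_sum, sub_eq_zero]
    have h1 : coeff s f = 0 := by
      by_contra hc
      exact hlt (hord s hc)
    rw [h1]
    symm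
    refine Finset.sum_eq_zero fun i _ => ?_
    rw [coeff_smul, coeff_X_pow, if_neg, mul_zero]
    rintro rfl
    rw [Finsupp.degree_single] at hlt
    exact hlt le_rfl
  refine lt_of_le_of_ne hle fun he => hs ?_
  by_cases h : ∃ t, s = Finsupp.single t (p ^ j)
  · obtain ⟨t, rfl⟩ := h
    rw [map_sub, coeff_sum_smul_X_pow _ (pow_pos hp j), sub_self]
  · have h1 : coeff s f = 0 := by
      by_contra hc
      exact h (hpure s hc he.symm)
    rw [map_sub, h1, map_sum, zero_sub, neg_eq_zero]
    refine Finset.sum_eq_zero fun i _ => ?_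
    rw [coeff_smul, coeff_X_pow, if_neg (fun hc => h ⟨i, hc⟩), mul_zero]

theorem eq_single_of_degree_eq {s : Fin (n + 1) →₀ ℕ} {t : Fin (n + 1)} (h : s.degree = s t) :
    s = Finsupp.single t (s t) := by
  classical
  have hsum : s.degree = s t + ∑ j ∈ Finset.univ.erase t, s j := by
    rw [Finsupp.degree_eq_sum, Finset.add_sum_erase _ _ (Finset.mem_univ t)]
  have h0 : ∑ j ∈ Finset.univ.erase t, s j = 0 := by omega
  ext j
  rw [Finsupp.single_apply]
  split_ifs with hj
  · rw [hj]
  · exact Finset.sum_eq_zero_iff.1 h0 j (Finset.mem_erase.2 ⟨fun h => hj h.symm, Finset.mem_univ j⟩)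

theorem prod_choose_sub_single {s : Fin (n + 1) →₀ ℕ} {t : Fin (n + 1)} {a : ℕ} (ha : a ≤ s t) :
    ∏ j, ((Finsupp.single t a : Fin (n + 1) →₀ ℕ) j + (s - Finsupp.single t a) j).choose
      ((s - Finsupp.single t a) j) = (s t).choose a := by
  classical
  rw [Finset.prod_eq_single t]
  · rw [Finsupp.tsub_apply, Finsupp.single_eq_same, Nat.add_sub_cancel' ha, Nat.choose_symm ha]
  · intro j _ hj
    simp [hj.symm]
  · simp

/-- The value of `σ` in the monomial case with `τ = 1`. -/
def sigmaRef (n p q : ℕ) : ℕ → ℕ := fun j => n + 1 - if q ∣ p ^ j then 1 else 0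

theorem sigma_lt_of_lex (p : ℕ) {σ₀ : ℕ → ℕ} {j : ℕ}
    (hle : ∀ i < j, ofLex (R.sigma p) i ≤ σ₀ i) (hlt : ofLex (R.sigma p) j < σ₀ j) :
    R.sigma p < toLex σ₀ := by
  classical
  have hex : ∃ j, ofLex (R.sigma p) j < σ₀ j := ⟨j, hlt⟩
  refine ⟨Nat.find hex, fun i hi => ?_, Nat.find_spec hex⟩
  have h1 := Nat.find_min hex hi
  have h2 := hle i (lt_of_lt_of_le hi (Nat.find_min' hex hlt))
  exact le_antisymm h2 (not_lt.1 h1)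

/-- As long as q does not divide p^j, the reference value is n + 1, the largest possible, here and
at all earlier indices. A nonzero pure part would be a lexicographic drop. -/
theorem leadingPure_eq_bot {p e : ℕ}
    (hnd : ¬ R.sigma p < toLex (sigmaRef n p (p ^ e))) {j : ℕ} (hj : ¬ p ^ e ∣ p ^ j) :
    R.dSaturation.leadingPure p j = ⊥ := by
  by_contra hne
  refine hnd (sigma_lt_of_lex p (j := j) (fun i hi => ?_) ?_)
  · have : ¬ p ^ e ∣ p ^ i := fun h => hj (h.trans (pow_dvd_pow p hi.le))
    simp only [sigmaRef, if_neg this, sigma, ofLex_toLex]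
    omega
  · have : 0 < Module.finrank k (R.dSaturation.leadingPure p j) := by
      rw [Nat.pos_iff_ne_zero, Ne, Submodule.finrank_eq_zero]
      exact hne
    simp only [sigmaRef, if_neg hj, sigma, ofLex_toLex]
    omega

/-! ### Leading forms when σ does not drop -/

section Sigma

variable (p : ℕ) [ExpChar k p]

/-- A form annihilated by all derivatives of positive order less than its degree is a sum of
pure powers of exponent a power of `p`. -/
theorem exists_single_of_minimal {i : ℕ} (hi : 0 < i) {f : CompletedRing k n}
    (hf : f ∈ R.dSaturation.level i)
    (hlow : ∀ i', 0 < i' → i' < i → ∀ g ∈ R.dSaturation.level i', ∀ s, s.degree = i' →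
      coeff s g = 0)
    {s : Fin (n + 1) →₀ ℕ} (hsi : s.degree = i) (hs : coeff s f ≠ 0) :
    ∃ t v, i = p ^ v ∧ s = Finsupp.single t i := by
  classical
  have hs0 : s ≠ 0 := by
    rintro rfl
    simp at hsi
    omega
  obtain ⟨t, ht⟩ := Finsupp.ne_iff.1 hs0
  -- With s_t = p^v u, the binomial coefficient (s_t choose p^v) equals u ≠ 0 in k. The derivative
  -- that reduces x^s to x_t^(p^v) therefore does not kill it, which the hypothesis forbids unless
  -- p^v = i.
  obtain ⟨v, u, hvu, hu⟩ := exists_eq_pow_mul_cast_ne_zero k p (Nat.pos_of_ne_zero ht)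
  have hle : p ^ v ≤ s t := by
    rw [hvu]
    refine Nat.le_mul_of_pos_right _ (Nat.pos_of_ne_zero ?_)
    rintro rfl
    simp at hu
  have hpos : 0 < p ^ v := pow_pos (expChar_pos k p) v
  have hti : s t ≤ i := hsi ▸ Finsupp.le_degree t s
  have hJ : s - Finsupp.single t (p ^ v) + Finsupp.single t (p ^ v) = s :=
    tsub_add_cancel_of_le (by rwa [Finsupp.single_le_iff])
  have hdeg : (s - Finsupp.single t (p ^ v)).degree + p ^ v = i := by
    have := congrArg Finsupp.degree hJ
    rwa [map_add, Finsupp.degree_single, hsi] at this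
  obtain h | h := (hle.trans hti).lt_or_eq
  · exfalso
    have h1 := hasse_mem_dSaturation hf (s - Finsupp.single t (p ^ v))
    have h2 : i - (s - Finsupp.single t (p ^ v)).degree = p ^ v := by omega
    rw [h2] at h1
    have h3 := hlow _ hpos h _ h1 _ (Finsupp.degree_single t (p ^ v))
    rw [coeff_hasse, prod_choose_sub_single hle, hvu, cast_choose_pow,
      add_comm (Finsupp.single t (p ^ v)), hJ] at h3
    exact mul_ne_zero hu hs h3
  · refine ⟨t, v, h.symm, ?_⟩
    have h1 : s t = i := by omega
    rw [← h1]
    exact eq_single_of_degree_eq (by omega)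

variable {p}

/-- The pure vector of coefficients of a power of `h`. -/
theorem coeff_pow_mem_leadingPure
    (hR : ∀ i, ∀ f ∈ R.level i, ∀ s, coeff s f ≠ 0 → i ≤ s.degree) {e j : ℕ}
    {h : CompletedRing k n} (hh : h ∈ R.level (p ^ e))
    (hpure : ∀ s, s.degree = p ^ e → coeff s h ≠ 0 → ∃ t, s = Finsupp.single t (p ^ e))
    (hlead : coeff (Finsupp.single 0 (p ^ e)) h = 1) (hj : p ^ e ∣ p ^ j) :
    ∃ c ∈ R.dSaturation.leadingPure p j, c 0 = 1 := by
  obtain ⟨a, ha⟩ := exists_pow_eq_pow_mul_pow (expChar_pos k p) hj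
  have hpos : 0 < p ^ a := pow_pos (expChar_pos k p) a
  have hmem : h ^ p ^ a ∈ R.dSaturation.level (p ^ j) :=
    ha ▸ le_dSaturation _ (R.pow_mem_level hh _)
  refine ⟨_, mem_leadingPure (expChar_pos k p) hmem
    (fun s hs => le_degree_of_mem_dSaturation hR hmem hs) (fun s hs hd => ?_), ?_⟩
  · obtain ⟨d, rfl, hd'⟩ := exists_of_coeff_pow_ne_zero p hs
    rw [map_nsmul, smul_eq_mul, ha, mul_comm] at hd
    obtain ⟨t, rfl⟩ := hpure d (Nat.eq_of_mul_eq_mul_right hpos hd) hd'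
    exact ⟨t, by rw [Finsupp.smul_single, smul_eq_mul, ha, mul_comm]⟩
  · have := coeff_smul_pow p h a (Finsupp.single 0 (p ^ e))
    rw [Finsupp.smul_single, smul_eq_mul, mul_comm, ← ha, hlead, one_pow] at this
    exact this

/-- At the smallest positive level below q with a leading form of that degree, the form would be a
sum of pure p^v-th powers with p^v < q. This is a nonzero pure part where σ does not allow one. -/
theorem coeff_eq_zero_of_lt
    (hR : ∀ i, ∀ f ∈ R.level i, ∀ s, coeff s f ≠ 0 → i ≤ s.degree) {e : ℕ}
    (hnd : ¬ R.sigma p < toLex (sigmaRef n p (p ^ e))) (i : ℕ) : 0 < i → i < p ^ e →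
    ∀ f ∈ R.dSaturation.level i, ∀ s, s.degree = i → coeff s f = 0 := by
  induction i using Nat.strong_induction_on with
  | _ i ih =>
    intro hi hie f hf s hsi
    by_contra hs
    have hmin := fun {s} hsi hs => exists_single_of_minimal p hi hf
      (fun i' h0 h1 => ih i' h1 h0 (h1.trans hie)) (s := s) hsi hs
    obtain ⟨t, v, hv, hst⟩ := hmin hsi hs
    have hbot := leadingPure_eq_bot (j := v) hnd
      (fun h => absurd (Nat.le_of_dvd (hv ▸ hi) h) (by omega))
    have hmem := mem_leadingPure (R := R.dSaturation) (j := v) (expChar_pos k p) (hv ▸ hf)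
      (fun s hs => hv ▸ le_degree_of_mem_dSaturation hR hf hs) (fun s hs hd => by
        obtain ⟨t, v', -, h⟩ := hmin (hd.trans hv.symm) hs
        exact ⟨t, hv ▸ h⟩)
    rw [hbot, Submodule.mem_bot] at hmem
    have := congrFun hmem t
    refine hs ?_
    rw [hst, hv]
    exact this

/-- No leading forms exist in positive levels below q, so a leading form at level q is annihilated
by all derivatives of positive order less than q. -/
theorem exists_single_of_not_sigma_lt
    (hR : ∀ i, ∀ f ∈ R.level i, ∀ s, coeff s f ≠ 0 → i ≤ s.degree) {e : ℕ}
    (hnd : ¬ R.sigma p < toLex (sigmaRef n p (p ^ e)))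
    {f : CompletedRing k n} (hf : f ∈ R.level (p ^ e))
    {s : Fin (n + 1) →₀ ℕ} (hsi : s.degree = p ^ e) (hs : coeff s f ≠ 0) :
    ∃ t, s = Finsupp.single t (p ^ e) := by
  obtain ⟨t, v, -, h⟩ := exists_single_of_minimal p (pow_pos (expChar_pos k p) e)
    (le_dSaturation _ hf) (coeff_eq_zero_of_lt hR hnd) hsi hs
  exact ⟨t, h⟩

/-- If `σ` does not drop, then no leading form is a monomial that does not involve `x_1`. -/
theorem false_of_monomial_leading_form
    (hR : ∀ i, ∀ f ∈ R.level i, ∀ s, coeff s f ≠ 0 → i ≤ s.degree) {e : ℕ}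
    (hnd : ¬ R.sigma p < toLex (sigmaRef n p (p ^ e)))
    {h : CompletedRing k n} (hh : h ∈ R.level (p ^ e))
    (hlead : coeff (Finsupp.single 0 (p ^ e)) h = 1) {N : ℕ} (hN : 0 < N)
    {f : CompletedRing k n} (hf : f ∈ R.level N) {s : Fin (n + 1) →₀ ℕ} (hs0 : s 0 = 0)
    (hsN : s.degree = N) (hs : coeff s f ≠ 0)
    (huniq : ∀ s', s'.degree = N → coeff s' f ≠ 0 → s' = s) : False := by
  have hp := expChar_pos k p
  have hsne : s ≠ 0 := by
    rintro rfl
    simp at hsN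
    omega
  obtain ⟨t, ht⟩ := Finsupp.ne_iff.1 hsne
  have ht0 : t ≠ 0 := by
    rintro rfl
    exact ht hs0
  obtain ⟨v, u, hvu, hu⟩ := exists_eq_pow_mul_cast_ne_zero k p (Nat.pos_of_ne_zero ht)
  have hle : p ^ v ≤ s t := by
    rw [hvu]
    refine Nat.le_mul_of_pos_right _ (Nat.pos_of_ne_zero ?_)
    rintro rfl
    simp at hu
  have hJ : Finsupp.single t (p ^ v) + (s - Finsupp.single t (p ^ v)) = s :=
    add_tsub_cancel_of_le (by rwa [Finsupp.single_le_iff])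
  have hdeg : p ^ v + (s - Finsupp.single t (p ^ v)).degree = N := by
    have := congrArg Finsupp.degree hJ
    rwa [map_add, Finsupp.degree_single, hsN] at this
  -- This derivative turns the leading monomial into a nonzero multiple of x_t^(p^v), with x_t
  -- different from x_1.
  have hmem := hasse_mem_dSaturation (le_dSaturation _ hf) (s - Finsupp.single t (p ^ v))
  have h2 : N - (s - Finsupp.single t (p ^ v)).degree = p ^ v := by omega
  rw [h2] at hmem
  have hother : ∀ s', coeff s' (hasse (s - Finsupp.single t (p ^ v)) f) ≠ 0 →
      s'.degree = p ^ v → s' = Finsupp.single t (p ^ v) := by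
    intro s' hs' hd
    rw [coeff_hasse] at hs'
    have := huniq _ (by rw [map_add]; omega) (right_ne_zero_of_mul hs')
    rw [← hJ] at this
    simpa using this
  have hw := mem_leadingPure hp hmem (fun s hs => le_degree_of_mem_dSaturation hR hmem hs)
    (fun s' hs' hd => ⟨t, hother s' hs' hd⟩)
  set w : Fin (n + 1) → k := fun t' => coeff (Finsupp.single t' (p ^ v))
    (hasse (s - Finsupp.single t (p ^ v)) f) with hwdef
  have hwt : w t ≠ 0 := by
    rw [hwdef]
    simp only
    rw [coeff_hasse, prod_choose_sub_single hle, hJ, hvu, cast_choose_pow]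
    exact mul_ne_zero hu hs
  have hw0 : w 0 = 0 := by
    by_contra hc
    have := DFunLike.congr_fun (hother _ hc (Finsupp.degree_single _ _)) t
    rw [Finsupp.single_eq_same, Finsupp.single_apply, if_neg ht0.symm] at this
    exact absurd this.symm (pow_pos hp v).ne'
  have hpure := fun s hsi hs => exists_single_of_not_sigma_lt hR hnd hh (s := s) hsi hs
  -- If q divides p^v, a power of h supplies a second, linearly independent form with
  -- x_1-coefficient 1, so l_v ≥ 2; powers of h also keep the earlier l_i at least at their
  -- reference values. If q does not divide p^v, the pure part had to vanish.
  by_cases hv : p ^ e ∣ p ^ v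
  · refine hnd (sigma_lt_of_lex p (j := v) (fun i _ => ?_) ?_)
    · by_cases hi : p ^ e ∣ p ^ i
      · obtain ⟨c, hc, hc0⟩ := coeff_pow_mem_leadingPure hR hh hpure hlead hi
        have : 0 < Module.finrank k (R.dSaturation.leadingPure p i) := by
          rw [Nat.pos_iff_ne_zero, Ne, Submodule.finrank_eq_zero]
          intro hbot
          rw [hbot, Submodule.mem_bot] at hc
          rw [hc] at hc0
          exact zero_ne_one hc0
        simp only [sigmaRef, if_pos hi, sigma, ofLex_toLex]
        omega
      · simp only [sigmaRef, if_neg hi, sigma, ofLex_toLex]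
        omega
    · obtain ⟨c, hc, hc0⟩ := coeff_pow_mem_leadingPure hR hh hpure hlead hv
      have h1 : 1 < Module.finrank k (R.dSaturation.leadingPure p v) := by
        by_contra hcon
        obtain ⟨x, hx⟩ := finrank_le_one_iff.1 (not_lt.1 hcon)
        obtain ⟨α, hα⟩ := hx ⟨c, hc⟩
        obtain ⟨β, hβ⟩ := hx ⟨w, hw⟩
        have h3 : α * x.1 0 = 1 := by
          rw [← hc0]
          exact congrFun (congrArg Subtype.val hα) 0
        have h4 : β * x.1 0 = 0 := by
          rw [← hw0]
          exact congrFun (congrArg Subtype.val hβ) 0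
        have h5 : β = 0 := by
          refine (mul_eq_zero.1 h4).resolve_right fun h => ?_
          rw [h, mul_zero] at h3
          exact zero_ne_one h3
        refine hwt ?_
        have := congrFun (congrArg Subtype.val hβ) t
        rw [h5] at this
        simpa using this.symm
      -- In truncated subtraction the passage from l_v = 1 to l_v ≥ 2 is a strict drop only for n >
      -- 0; the variable x_t different from x_1 provides this.
      have hn : 0 < n := by
        rw [Nat.pos_iff_ne_zero]
        rintro rfl
        exact ht0 (Fin.fin_one_eq_zero t)
      simp only [sigmaRef, if_pos hv, sigma, ofLex_toLex]
      omega
  · rw [leadingPure_eq_bot hnd hv, Submodule.mem_bot] at hw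
    exact hwt (congrFun hw t)

end Sigma

end IdealisticFiltration

/-! ### The invariant `σ` in the tight monomial case -/

namespace MonomialDatum.IsMonomialCase

variable {k : Type*} [Field k] {n : ℕ} {Λ : Type*} {p : ℕ}
variable {T : Triplet k n Λ} {F : MonomialDatum k n Λ}

theorem exists_m_pos (hF : F.IsMonomialCase p T) : ∃ l ∈ T.E, 0 < F.m l := by
  by_contra! hc
  have := hF.lt_sum_m
  rw [Finset.sum_eq_zero fun l hl => Nat.le_zero.1 (hc l hl)] at this
  omega

variable [ExpChar k p]

/-- Adding the Newton bounds over all components gives degree at least s_1 + ord_P(M_tight) (i -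
s_1), which exceeds i if s_1 < i. -/
theorem leading_monomial (hF : F.IsMonomialCase p T) (ht : 1 < F.ordTight p T) {i : ℕ}
    {f : CompletedRing k n} (hf : f ∈ T.R.level i) {s : Fin (n + 1) →₀ ℕ} (hs : coeff s f ≠ 0) :
    i ≤ s.degree ∧ (s.degree = i → s = Finsupp.single 0 i) := by
  have hq : 0 < p ^ F.e := pow_pos (expChar_pos k p) _
  have hle := Finsupp.le_degree 0 s
  obtain h | h := le_or_gt i (s 0)
  · refine ⟨h.trans hle, fun hd => ?_⟩
    have h1 : s 0 = i := by omega
    rw [← h1]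
    exact IdealisticFiltration.eq_single_of_degree_eq (by omega)
  · have hpos : (0 : ℚ) < i - s 0 := by
      rw [sub_pos]
      exact_mod_cast h
    have h1 : (i : ℚ) - s 0 < ∑ l ∈ T.E, (s (T.pos l) : ℚ) := by
      calc (i : ℚ) - s 0 < F.ordTight p T * (i - s 0) := by nlinarith
        _ = ∑ l ∈ T.E, F.slopeDiv p T l * (i - s 0) := by rw [ordTight, Finset.sum_mul]
        _ ≤ _ := Finset.sum_le_sum fun l hl => hF.slopeDiv_mul_sub_le hq hf hl hs
    have h2 := add_sum_apply_le_degree hF.pos_injOn hF.pos_ne s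
    have h3 : (s 0 : ℚ) + ∑ l ∈ T.E, (s (T.pos l) : ℚ) ≤ s.degree := by exact_mod_cast h2
    have h4 : (i : ℚ) < s.degree := by linarith
    have h5 : i < s.degree := by exact_mod_cast h4
    exact ⟨h5.le, fun hd => by omega⟩

/-- Otherwise a derivative brings x_1^(p^v) with p^v < q into an element at level p^v. It cannot
occur in the remainder modulo h, which is divisible by some x_D, nor in a multiple of h, which is
x_1^q modulo the other parameters. -/
theorem dvd_of_coeff_single (hF : F.IsMonomialCase p T) {i : ℕ} {f : CompletedRing k n}
    (hf : f ∈ T.R.level i) (hs : coeff (Finsupp.single 0 i) f ≠ 0) : p ^ F.e ∣ i := by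
  have hp := expChar_pos k p
  obtain rfl | hi := Nat.eq_zero_or_pos i
  · exact dvd_zero _
  obtain ⟨v, u, hvu, hu⟩ := exists_eq_pow_mul_cast_ne_zero k p hi
  have hle : p ^ v ≤ i := by
    rw [hvu]
    refine Nat.le_mul_of_pos_right _ (Nat.pos_of_ne_zero ?_)
    rintro rfl
    simp at hu
  by_cases hev : p ^ F.e ≤ p ^ v
  · exact hvu ▸ (pow_dvd_pow_of_pow_le hp hev).mul_right u
  exfalso
  have h1 := hF.hasse_mem i f hf (i - p ^ v)
  rw [Nat.sub_sub_self hle] at h1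
  have h2 : coeff (Finsupp.single 0 (p ^ v)) (hasse (Finsupp.single 0 (i - p ^ v)) f) ≠ 0 := by
    rw [coeff_hasse_single_zero, ← Finsupp.single_add, Finsupp.single_eq_same,
      Nat.add_sub_cancel' hle, Nat.choose_symm hle, hvu, cast_choose_pow, ← hvu]
    exact mul_ne_zero hu hs
  obtain ⟨c, g, hc, hcg⟩ := hF.isWeier.exists_division (hasse (Finsupp.single 0 (i - p ^ v)) f)
  rw [hcg] at h2
  obtain h3 | h3 := exists_coeff_ne_zero_of_add h2
  · obtain ⟨l, hl, hm⟩ := hF.exists_m_pos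
    have h4 := hF.muDiv_mul_le_of_remainder h1 hc hcg hl h3
    rw [Finsupp.single_apply, if_neg (hF.pos_ne l hl).symm, Nat.cast_zero] at h4
    have h5 : 0 < F.muDiv l := by
      have := hF.a_pos
      unfold muDiv
      positivity
    have h6 : (0 : ℚ) < (p ^ v : ℕ) := by exact_mod_cast pow_pos hp v
    exact absurd h4 (not_le.2 (mul_pos h5 h6))
  · obtain ⟨a, b, hab, ha, -⟩ := exists_coeff_ne_zero_of_mul h3
    have h4 := congrArg freeDegree hab
    rw [freeDegree_add, freeDegree_single_zero] at h4
    have h5 := hF.isWeier.eq_of_freeDegree ha (by omega)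
    have h6 := DFunLike.congr_fun hab 0
    rw [h5] at h6
    simp only [Finsupp.add_apply, Finsupp.single_eq_same] at h6
    omega

/-- The condition "order at least i, with only x_1^i in degree i, and then q ∣ i" is stable under
products and derivatives. The pure part in degree p^j is thus the line spanned by the form of a
power of h if q ∣ p^j, and zero otherwise. -/
theorem sigma_eq (hF : F.IsMonomialCase p T) (ht : 1 < F.ordTight p T) :
    T.R.sigma p = toLex (IdealisticFiltration.sigmaRef n p (p ^ F.e)) := by
  have hp := expChar_pos k p
  have hord : ∀ i, ∀ f ∈ T.R.level i, ∀ s, coeff s f ≠ 0 → i ≤ s.degree :=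
    fun i f hf s hs => (hF.leading_monomial ht hf hs).1
  have hstar : ∀ {i : ℕ} {f : CompletedRing k n}, f ∈ T.R.dSaturation.level i →
      ∀ {s}, coeff s f ≠ 0 → i ≤ s.degree ∧
        (s.degree = i → s = Finsupp.single 0 i ∧ p ^ F.e ∣ i) := by
    intro i f hf s hs
    refine IdealisticFiltration.dSaturation_le_ofMonomials (Q := fun i s => i ≤ s.degree ∧
        (s.degree = i → s = Finsupp.single 0 i ∧ p ^ F.e ∣ i)) (fun s => ⟨Nat.zero_le _, ?_⟩)
      (fun i s h => ⟨by omega, fun hd => by omega⟩) (fun i j s t h h' => ?_)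
      (fun i s I h hne => ?_) (fun i f hf s hs => ?_) hf hs
    · intro h
      rw [Finsupp.degree_eq_zero_iff] at h
      simp [h]
    · rw [map_add]
      refine ⟨by omega, fun hd => ?_⟩
      obtain ⟨h1, h2⟩ := h.2 (by omega)
      obtain ⟨h3, h4⟩ := h'.2 (by omega)
      exact ⟨by rw [h1, h3, Finsupp.single_add], h2.add h4⟩
    · rw [map_add] at h
      refine ⟨by omega, fun hd => ?_⟩
      obtain hi | hi := Nat.lt_or_ge i I.degree
      · rw [Nat.sub_eq_zero_of_le hi.le] at hd ⊢
        rw [Finsupp.degree_eq_zero_iff] at hd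
        simp [hd]
      · obtain ⟨h1, m, h2⟩ := h.2 (by omega)
        have hI : I = Finsupp.single 0 (I 0) := by
          ext j
          by_cases hj : j = 0
          · rw [hj, Finsupp.single_eq_same]
          · have := DFunLike.congr_fun h1 j
            rw [Finsupp.add_apply, Finsupp.single_apply, if_neg (Ne.symm hj)] at this
            rw [Finsupp.single_apply, if_neg (Ne.symm hj)]
            omega
        have hs' : s = Finsupp.single 0 (s 0) := by
          ext j
          by_cases hj : j = 0
          · rw [hj, Finsupp.single_eq_same]
          · have := DFunLike.congr_fun h1 j
            rw [Finsupp.add_apply, Finsupp.single_apply, if_neg (Ne.symm hj)] at this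
            rw [Finsupp.single_apply, if_neg (Ne.symm hj)]
            omega
        have hI0 : I.degree = I 0 := by
          rw [hI, Finsupp.degree_single, Finsupp.single_eq_same]
        have hs0 : s.degree = s 0 := by
          rw [hs', Finsupp.degree_single, Finsupp.single_eq_same]
        -- For q ∣ i a binomial coefficient (i choose I_1) is nonzero in k only if q ∣ I_1, so a
        -- derivative that preserves the pure monomial lowers the level by a multiple of q.
        have h3 : p ^ F.e ∣ I 0 := by
          refine dvd_of_cast_choose_ne_zero k p (m := m) (v := F.e) ?_
          rw [← h2]
          have h4 : s 0 + I 0 = i := by omega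
          rw [← h4]
          intro h0
          refine hne ?_
          rw [Nat.cast_prod]
          exact Finset.prod_eq_zero (Finset.mem_univ 0) h0
        rw [hI0]
        refine ⟨?_, Nat.dvd_sub (h2 ▸ dvd_mul_right _ _) h3⟩
        rw [hs']
        congr 1
        omega
    · obtain ⟨h1, h2⟩ := hF.leading_monomial ht hf hs
      refine ⟨h1, fun hd => ⟨h2 hd, ?_⟩⟩
      have h3 := h2 hd
      rw [h3] at hs
      exact hF.dvd_of_coeff_single hf hs
  have hsingle : ∀ {N : ℕ} {t : Fin (n + 1)}, 0 < N →
      Finsupp.single t N = Finsupp.single 0 N → t = 0 := by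
    intro N t hN h
    by_contra hc
    have := DFunLike.congr_fun h t
    rw [Finsupp.single_eq_same, Finsupp.single_apply, if_neg (Ne.symm hc)] at this
    omega
  refine congrArg toLex (funext fun j => ?_)
  have hpj := pow_pos hp j
  rw [IdealisticFiltration.sigmaRef]
  congr 1
  have hvan : ∀ c ∈ T.R.dSaturation.leadingPure p j, ∀ t, c t ≠ 0 → t = 0 ∧ p ^ F.e ∣ p ^ j := by
    intro c hc t hct
    obtain ⟨f, hf, hft⟩ := IdealisticFiltration.exists_of_mem_leadingPure hp hc
    rw [hft] at hct
    obtain ⟨h1, h2⟩ := (hstar hf hct).2 (Finsupp.degree_single _ _)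
    exact ⟨hsingle hpj h1, h2⟩
  split_ifs with hj
  · obtain ⟨c, hc, hc0⟩ := IdealisticFiltration.coeff_pow_mem_leadingPure hord hF.h_mem
      (fun s hsi hs => ⟨0, (hF.leading_monomial ht hF.h_mem hs).2 hsi⟩) hF.isWeier.coeff_lead hj
    refine finrank_eq_one (⟨c, hc⟩ : T.R.dSaturation.leadingPure p j) (fun h => ?_) fun w => ?_
    · exact one_ne_zero (hc0.symm.trans (congrFun (congrArg Subtype.val h) 0))
    · refine ⟨w.1 0, Subtype.ext (funext fun t => ?_)⟩
      by_cases ht0 : t = 0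
      · subst ht0
        simp [hc0]
      · have h1 : c t = 0 := by
          by_contra h
          exact ht0 (hvan c hc t h).1
        have h2 : w.1 t = 0 := by
          by_contra h
          exact ht0 (hvan w.1 w.2 t h).1
        simp [h1, h2]
  · rw [Submodule.finrank_eq_zero, Submodule.eq_bot_iff]
    intro c hc
    funext t
    by_contra h
    exact hj (hvan c hc t h).2

end MonomialDatum.IsMonomialCase

/-! ### The combinatorics of the invariant `Γ` -/

section GammaMax

variable {Λ : Type*} [LinearOrder Λ]

/-- The triple whose maximum is the invariant `Γ`. -/
def gammaKey (H : Λ → ℚ) (s : Finset Λ) : ℤ ×ₗ ℚ ×ₗ List Λ :=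
  toLex (-(s.card : ℤ), toLex (∑ l ∈ s, H l, s.sort))

/-- The sorted list of indices determines the set, so the maximum Γ is attained by one set only and
its maximum locus is a single intersection of components. -/
theorem gammaKey_injective (H : Λ → ℚ) : Function.Injective (gammaKey H) := by
  intro s t h
  have h1 := congrArg (fun x => (ofLex (ofLex x).2).2) h
  have h2 : s.sort = t.sort := h1
  rw [← Finset.sort_toFinset s (· ≤ ·), ← Finset.sort_toFinset t (· ≤ ·), h2]

theorem gammaKey_le_iff (H H' : Λ → ℚ) (s t : Finset Λ) : gammaKey H s ≤ gammaKey H' t ↔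
    t.card < s.card ∨ (s.card = t.card ∧ (∑ l ∈ s, H l < ∑ l ∈ t, H' l ∨
      (∑ l ∈ s, H l = ∑ l ∈ t, H' l ∧ s.sort ≤ t.sort))) := by
  rw [gammaKey, gammaKey, Prod.Lex.toLex_le_toLex, Prod.Lex.toLex_le_toLex]
  simp

theorem gammaKey_lt_of_lt {H H' : Λ → ℚ} {s t : Finset Λ}
    (h : t.card < s.card ∨ (s.card = t.card ∧ ∑ l ∈ s, H l < ∑ l ∈ t, H' l)) :
    gammaKey H s < gammaKey H' t := by
  rw [gammaKey, gammaKey, Prod.Lex.toLex_lt_toLex, Prod.Lex.toLex_lt_toLex]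
  obtain h | ⟨h, h'⟩ := h
  · left
    simpa using h
  · right
    exact ⟨by simpa using h, Or.inl h'⟩

/-- The set of components at which the maximum `Γ` is attained. -/
structure IsGammaMax (E : Finset Λ) (H : Λ → ℚ) (s : Finset Λ) : Prop where
  subset : s ⊆ E
  one_le : 1 ≤ ∑ l ∈ s, H l
  le : ∀ t ⊆ E, 1 ≤ ∑ l ∈ t, H l → gammaKey H t ≤ gammaKey H s

theorem exists_isGammaMax {E : Finset Λ} {H : Λ → ℚ} (h : 1 ≤ ∑ l ∈ E, H l) :
    ∃ s, IsGammaMax E H s := by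
  obtain ⟨s, hs, hmax⟩ := (E.powerset.filter fun s => 1 ≤ ∑ l ∈ s, H l).exists_max_image
    (gammaKey H) ⟨E, by simp [h]⟩
  rw [Finset.mem_filter, Finset.mem_powerset] at hs
  exact ⟨s, hs.1, hs.2, fun t ht h1 => hmax t (by simp [ht, h1])⟩

variable {E : Finset Λ} {H : Λ → ℚ} {s : Finset Λ}

theorem IsGammaMax.card_le (hs : IsGammaMax E H s) {t : Finset Λ} (ht : t ⊆ E)
    (h1 : 1 ≤ ∑ l ∈ t, H l) : s.card ≤ t.card := by
  have := (gammaKey_le_iff H H t s).1 (hs.le t ht h1)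
  omega

theorem IsGammaMax.sum_lt_one (hs : IsGammaMax E H s) {t : Finset Λ} (ht : t ⊆ E)
    (hc : t.card < s.card) : ∑ l ∈ t, H l < 1 := by
  by_contra! h
  have := hs.card_le ht h
  omega

/-- Omitting one component leaves a sum less than 1, by minimality of the cardinality. It follows
that the exponent of the exceptional divisor is smaller than every exponent in the centre. -/
theorem IsGammaMax.sum_sub_one_lt (hs : IsGammaMax E H s) {l : Λ} (hl : l ∈ s) :
    ∑ l ∈ s, H l - 1 < H l := by
  have h1 := hs.sum_lt_one ((s.erase_subset l).trans hs.subset) (Finset.card_erase_lt_of_mem hl)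
  have h2 := Finset.add_sum_erase s H hl
  linarith

theorem IsGammaMax.pos (hs : IsGammaMax E H s) {l : Λ} (hl : l ∈ s) : 0 < H l := by
  have := hs.sum_sub_one_lt hl
  have := hs.one_le
  linarith

theorem IsGammaMax.nonempty (hs : IsGammaMax E H s) : s.Nonempty := by
  rw [Finset.nonempty_iff_ne_empty]
  rintro rfl
  have := hs.one_le
  norm_num at this

variable {E' : Finset Λ} {H' : Λ → ℚ} {ε : Λ}

/-- If t has as many elements as s, then t without ε has sum less than 1, and adding ∑_s H - 1 stays
below ∑_s H. If t had fewer, replacing ε by a component of s outside t would increase the sum but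
still leave fewer components than s, hence a sum less than 1. -/
theorem IsGammaMax.lt_of_mem_exceptional (hs : IsGammaMax E H s) (hE' : E' ⊆ insert ε E)
    (hH' : ∀ l ∈ E', l ≠ ε → H' l = H l) (hε' : H' ε = ∑ l ∈ s, H l - 1) {t : Finset Λ}
    (ht : t ⊆ E') (hεt : ε ∈ t) (h1 : 1 ≤ ∑ l ∈ t, H' l) :
    s.card < t.card ∨ (t.card = s.card ∧ ∑ l ∈ t, H' l < ∑ l ∈ s, H l) := by
  have htE : t.erase ε ⊆ E := by
    intro l hl
    exact Finset.mem_of_mem_insert_of_ne (hE' (ht (Finset.mem_of_mem_erase hl)))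
      (Finset.ne_of_mem_erase hl)
  have hsum : ∑ l ∈ t, H' l = ∑ l ∈ t.erase ε, H l + (∑ l ∈ s, H l - 1) := by
    rw [← Finset.sum_erase_add _ _ hεt, hε']
    congr 1
    exact Finset.sum_congr rfl fun l hl =>
      hH' l (ht (Finset.mem_of_mem_erase hl)) (Finset.ne_of_mem_erase hl)
  have hcard := Finset.card_erase_add_one hεt
  obtain h | h | h := lt_trichotomy s.card t.card
  · exact Or.inl h
  · have := hs.sum_lt_one htE (by omega)
    exact Or.inr ⟨h.symm, by linarith⟩
  · exfalso
    obtain ⟨l, hl, hlt⟩ : ∃ l ∈ s, l ∉ t.erase ε := by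
      by_contra! hc
      have := Finset.card_le_card (show s ⊆ t.erase ε from hc)
      omega
    have h2 := hs.sum_lt_one (t := insert l (t.erase ε))
      (Finset.insert_subset (hs.subset hl) htE) (by rw [Finset.card_insert_of_notMem hlt]; omega)
    rw [Finset.sum_insert hlt] at h2
    have := hs.sum_sub_one_lt hl
    linarith

theorem sum_eq_of_notMem_exceptional (hE' : E' ⊆ insert ε E)
    (hH' : ∀ l ∈ E', l ≠ ε → H' l = H l) {t : Finset Λ} (ht : t ⊆ E') (hεt : ε ∉ t) :
    t ⊆ E ∧ ∑ l ∈ t, H' l = ∑ l ∈ t, H l := by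
  have hne : ∀ l ∈ t, l ≠ ε := fun l hl h => hεt (h ▸ hl)
  exact ⟨fun l hl => Finset.mem_of_mem_insert_of_ne (hE' (ht hl)) (hne l hl),
    Finset.sum_congr rfl fun l hl => hH' l (ht hl) (hne l hl)⟩

/-- Sets that contain ε are handled by the preceding comparison. The others are old sets with their
old values, and the only one attaining the old maximum, s itself, is no longer available. -/
theorem IsGammaMax.gammaKey_lt (hs : IsGammaMax E H s) (hE' : E' ⊆ insert ε E)
    (hsE' : ¬ s ⊆ E') (hH' : ∀ l ∈ E', l ≠ ε → H' l = H l) (hε' : H' ε = ∑ l ∈ s, H l - 1)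
    {t : Finset Λ} (ht : t ⊆ E') (h1 : 1 ≤ ∑ l ∈ t, H' l) : gammaKey H' t < gammaKey H s := by
  by_cases hεt : ε ∈ t
  · exact gammaKey_lt_of_lt (hs.lt_of_mem_exceptional hE' hH' hε' ht hεt h1)
  · obtain ⟨htE, hsum⟩ := sum_eq_of_notMem_exceptional hE' hH' ht hεt
    have heq : gammaKey H' t = gammaKey H t := by rw [gammaKey, gammaKey, hsum]
    rw [heq]
    refine lt_of_le_of_ne (hs.le t htE (hsum ▸ h1)) fun h => hsE' ?_
    rwa [← gammaKey_injective H h]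

/-- The sets of components with the same number of elements and the same sum as `s`. -/
def gammaPeers (E : Finset Λ) (H : Λ → ℚ) (s : Finset Λ) : Finset (Finset Λ) :=
  E.powerset.filter fun t => t.card = s.card ∧ ∑ l ∈ t, H l = ∑ l ∈ s, H l

/-- A measure with values in a well-ordered set. -/
def gammaMeasure (N D : ℕ) (E : Finset Λ) (H : Λ → ℚ) (s : Finset Λ) : ℕ ×ₗ ℕ ×ₗ ℕ :=
  toLex (N - s.card, toLex (⌈D * ∑ l ∈ s, H l⌉₊, (gammaPeers E H s).card))

theorem exists_nat_eq_mul_sum {D : ℕ} (hD : ∀ l ∈ E, ∃ z : ℤ, D * H l = z)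
    (hs : IsGammaMax E H s) : ∃ z : ℕ, D * ∑ l ∈ s, H l = (z : ℚ) := by
  choose! z hz using hD
  have h1 : (D : ℚ) * ∑ l ∈ s, H l = ((∑ l ∈ s, z l : ℤ) : ℚ) := by
    rw [Finset.mul_sum, Int.cast_sum]
    exact Finset.sum_congr rfl fun l hl => hz l (hs.subset hl)
  have h2 : (0 : ℤ) ≤ ∑ l ∈ s, z l := by
    have := hs.one_le
    have h3 : (0 : ℚ) ≤ ((∑ l ∈ s, z l : ℤ) : ℚ) := by rw [← h1]; positivity
    exact_mod_cast h3
  obtain ⟨m, hm⟩ := Int.eq_ofNat_of_zero_le h2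
  exact ⟨m, by rw [h1, hm]; norm_cast⟩

/-- If the cardinality and the sum stay the same, the number of sets sharing them decreases: such a
new set cannot contain ε, so it was there before, while s has disappeared. A fixed denominator D
makes the sums comparable as natural numbers, and the bound N keeps the truncated subtraction
strict. -/
theorem IsGammaMax.gammaMeasure_lt (hs : IsGammaMax E H s) (hE' : E' ⊆ insert ε E)
    (hsE' : ¬ s ⊆ E') (hH' : ∀ l ∈ E', l ≠ ε → H' l = H l) (hε' : H' ε = ∑ l ∈ s, H l - 1)
    {s' : Finset Λ} (hs' : IsGammaMax E' H' s') {N D : ℕ} (hD0 : 0 < D) (hN : E'.card ≤ N)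
    (hD : ∀ l ∈ E, ∃ z : ℤ, D * H l = z) (hD' : ∀ l ∈ E', ∃ z : ℤ, D * H' l = z) :
    gammaMeasure N D E' H' s' < gammaMeasure N D E H s := by
  have hcard := (Finset.card_le_card hs'.subset).trans hN
  rw [gammaMeasure, gammaMeasure, Prod.Lex.toLex_lt_toLex, Prod.Lex.toLex_lt_toLex]
  simp only
  have hcases : s.card < s'.card ∨ (s'.card = s.card ∧ (∑ l ∈ s', H' l < ∑ l ∈ s, H l ∨
      ∑ l ∈ s', H' l = ∑ l ∈ s, H l)) := by
    have := (hs.gammaKey_lt hE' hsE' hH' hε' hs'.subset hs'.one_le).le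
    rw [gammaKey_le_iff] at this
    tauto
  obtain h | ⟨h, h' | h'⟩ := hcases
  · left
    omega
  · right
    refine ⟨by rw [h], Or.inl ?_⟩
    obtain ⟨z, hz⟩ := exists_nat_eq_mul_sum hD hs
    obtain ⟨z', hz'⟩ := exists_nat_eq_mul_sum hD' hs'
    rw [hz, hz', Nat.ceil_natCast, Nat.ceil_natCast]
    have h1 : (D : ℚ) * ∑ l ∈ s', H' l < D * ∑ l ∈ s, H l :=
      mul_lt_mul_of_pos_left h' (by exact_mod_cast hD0)
    rw [hz, hz'] at h1
    exact_mod_cast h1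
  · right
    refine ⟨by rw [h], Or.inr ⟨by rw [h'], Finset.card_lt_card ?_⟩⟩
    rw [Finset.ssubset_iff_of_subset]
    · refine ⟨s, ?_, ?_⟩
      · simp [gammaPeers, hs.subset]
      · simp only [gammaPeers, Finset.mem_filter, Finset.mem_powerset]
        exact fun hc => hsE' hc.1
    · intro t ht
      simp only [gammaPeers, Finset.mem_filter, Finset.mem_powerset] at ht ⊢
      obtain ⟨htE, htc, hts⟩ := ht
      have h1 : 1 ≤ ∑ l ∈ t, H' l := hts ▸ hs'.one_le
      have hεt : ε ∉ t := by
        intro hεt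
        obtain h2 | ⟨-, h2⟩ := hs.lt_of_mem_exceptional hE' hH' hε' htE hεt h1
        · omega
        · rw [hts, h'] at h2
          exact lt_irrefl _ h2
      obtain ⟨h2, h3⟩ := sum_eq_of_notMem_exceptional hE' hH' htE hεt
      exact ⟨h2, by omega, by rw [← h3, hts, h']⟩

end GammaMax

/-! ### The maximum locus of `Γ` -/

namespace Triplet

variable {k : Type*} [Field k] {n : ℕ} {Λ : Type*} [LinearOrder Λ]
variable {T : Triplet k n Λ} {H : Λ → ℚ} {s : Finset Λ}

open Classical in
theorem gamma_eq_sup (T : Triplet k n Λ) (H : Λ → ℚ) (Q : PrimeSpectrum (CompletedRing k n)) :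
    T.gamma H Q = ((T.E.filter fun l => X (T.pos l) ∈ Q.asIdeal).powerset.filter
      fun s => 1 ≤ ∑ l ∈ s, H l).sup fun s => (gammaKey H s : WithBot (ℤ ×ₗ ℚ ×ₗ List Λ)) :=
  rfl

theorem gamma_le (hs : IsGammaMax T.E H s) (Q : PrimeSpectrum (CompletedRing k n)) :
    T.gamma H Q ≤ gammaKey H s := by
  classical
  rw [gamma_eq_sup]
  refine Finset.sup_le fun t ht => ?_
  rw [Finset.mem_filter, Finset.mem_powerset] at ht
  exact WithBot.coe_le_coe.2 (hs.le t (ht.1.trans (Finset.filter_subset _ _)) ht.2)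

theorem gamma_eq_iff (hs : IsGammaMax T.E H s) (Q : PrimeSpectrum (CompletedRing k n)) :
    T.gamma H Q = gammaKey H s ↔ ∀ l ∈ s, X (T.pos l) ∈ Q.asIdeal := by
  classical
  constructor
  · intro h l hl
    rw [gamma_eq_sup] at h
    have hne : ((T.E.filter fun l => X (T.pos l) ∈ Q.asIdeal).powerset.filter
        fun s => 1 ≤ ∑ l ∈ s, H l).Nonempty := by
      rw [Finset.nonempty_iff_ne_empty]
      intro he
      rw [he, Finset.sup_empty] at h
      exact WithBot.coe_ne_bot h.symm
    obtain ⟨t, ht, hts⟩ := Finset.exists_mem_eq_sup _ hne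
      fun s => (gammaKey H s : WithBot (ℤ ×ₗ ℚ ×ₗ List Λ))
    rw [hts, WithBot.coe_inj] at h
    rw [← gammaKey_injective H h] at hl
    rw [Finset.mem_filter, Finset.mem_powerset] at ht
    exact (Finset.mem_filter.1 (ht.1 hl)).2
  · intro h
    refine le_antisymm (gamma_le hs Q) ?_
    rw [gamma_eq_sup]
    refine Finset.le_sup (f := fun s => (gammaKey H s : WithBot (ℤ ×ₗ ℚ ×ₗ List Λ))) ?_
    rw [Finset.mem_filter, Finset.mem_powerset]
    exact ⟨fun l hl => Finset.mem_filter.2 ⟨hs.subset hl, h l hl⟩, hs.one_le⟩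

theorem X_mem_closedPoint (i : Fin (n + 1)) :
    (X i : CompletedRing k n) ∈ (IsLocalRing.closedPoint (CompletedRing k n)).asIdeal := by
  change X i ∈ IsLocalRing.maximalIdeal _
  rw [IsLocalRing.mem_maximalIdeal, mem_nonunits_iff, MvPowerSeries.isUnit_iff_constantCoeff]
  simp

theorem gamma_closedPoint (hs : IsGammaMax T.E H s) :
    T.gamma H (IsLocalRing.closedPoint (CompletedRing k n)) = gammaKey H s :=
  (gamma_eq_iff hs _).2 fun _ _ => X_mem_closedPoint _

/-- All components pass through the closed point, so the maximum over all points is attained there.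
-/
theorem mem_maxLocus_iff (hs : IsGammaMax T.E H s) (Q : PrimeSpectrum (CompletedRing k n)) :
    Q ∈ T.maxLocus H ↔ ∀ l ∈ s, X (T.pos l) ∈ Q.asIdeal := by
  rw [← gamma_eq_iff hs]
  constructor
  · intro h
    refine le_antisymm (gamma_le hs Q) ?_
    rw [← gamma_closedPoint hs]
    exact h _
  · intro h Q'
    rw [h]
    exact gamma_le hs Q'

theorem gamma_lt_of_forall {T' : Triplet k n Λ} {H' : Λ → ℚ} {x : ℤ ×ₗ ℚ ×ₗ List Λ}
    (h : ∀ t ⊆ T'.E, 1 ≤ ∑ l ∈ t, H' l → gammaKey H' t < x)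
    (Q : PrimeSpectrum (CompletedRing k n)) : T'.gamma H' Q < x := by
  classical
  rw [gamma_eq_sup, Finset.sup_lt_iff (WithBot.bot_lt_coe x)]
  intro t ht
  rw [Finset.mem_filter, Finset.mem_powerset] at ht
  exact WithBot.coe_lt_coe.2 (h t (ht.1.trans (Finset.filter_subset _ _)) ht.2)

end Triplet

/-! ### The centre -/

section Centre

variable {k : Type*} [Field k] {n : ℕ}

theorem mem_coordLocus_iff {S : Finset (Fin (n + 1))} {Q : PrimeSpectrum (CompletedRing k n)} :
    Q ∈ coordLocus k S ↔ ∀ j ∈ S, X j ∈ Q.asIdeal := by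
  rw [coordLocus, PrimeSpectrum.mem_zeroLocus, Set.image_subset_iff]
  rfl

/-- The ideal of the series in which every monomial involves a variable of `S`. -/
def coordIdeal (k : Type*) [Field k] {n : ℕ} (S : Finset (Fin (n + 1))) :
    Ideal (CompletedRing k n) where
  carrier := {f | ∀ s, coeff s f ≠ 0 → ∃ j ∈ S, s j ≠ 0}
  add_mem' := fun {f g} hf hg s hs => (exists_coeff_ne_zero_of_add hs).elim (hf s) (hg s)
  zero_mem' := fun s hs => absurd (coeff_zero s) hs
  smul_mem' := by
    intro r f hf s hs
    obtain ⟨u, v, rfl, -, hv⟩ := exists_coeff_ne_zero_of_mul hs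
    obtain ⟨j, hj, hvj⟩ := hf v hv
    refine ⟨j, hj, ?_⟩
    rw [Finsupp.add_apply]
    omega

theorem X_mem_coordIdeal_iff {S : Finset (Fin (n + 1))} {j : Fin (n + 1)} :
    (X j : CompletedRing k n) ∈ coordIdeal k S ↔ j ∈ S := by
  classical
  constructor
  · intro h
    obtain ⟨i, hi, hne⟩ := h (Finsupp.single j 1) (by
      rw [coeff_index_single_self_X]
      exact one_ne_zero)
    rw [Finsupp.single_apply] at hne
    split_ifs at hne with hij
    · rwa [hij]
    · exact absurd rfl hne
  · intro h s hs
    rw [coeff_X] at hs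
    split_ifs at hs with hsj
    · exact ⟨j, h, by simp [hsj]⟩
    · exact absurd rfl hs

/-- Giving weight 1 to the variables of S and 0 to the others, membership means positive weighted
order, and weighted orders add under multiplication. -/
theorem coordIdeal_isPrime (S : Finset (Fin (n + 1))) : (coordIdeal k S).IsPrime := by
  classical
  refine ⟨?_, fun {f g} hfg => ?_⟩
  · rw [Ideal.ne_top_iff_one]
    intro h
    obtain ⟨j, -, hj⟩ := h 0 (by rw [coeff_zero_one]; exact one_ne_zero)
    exact hj rfl
  · let w : Fin (n + 1) → ℕ := fun j => if j ∈ S then 1 else 0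
    have hw : ∀ s : Fin (n + 1) →₀ ℕ, Finsupp.weight w s = 0 ↔ ¬ ∃ j ∈ S, s j ≠ 0 := by
      intro s
      rw [Finsupp.weight_apply, Finsupp.sum_fintype _ _ (by simp), Finset.sum_eq_zero_iff]
      push Not
      refine forall_congr' fun j => ?_
      by_cases hj : j ∈ S <;> simp [w, hj]
    have hmem : ∀ f : CompletedRing k n, f ∈ coordIdeal k S ↔ f.weightedOrder w ≠ 0 := by
      intro f
      rw [← Order.one_le_iff_ne_zero]
      constructor
      · intro h
        refine le_weightedOrder w fun d hd => ?_
        by_contra hc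
        have h1 : Finsupp.weight w d = 0 := by
          have : ((Finsupp.weight w d : ℕ) : ℕ∞) < (1 : ℕ) := by exact_mod_cast hd
          have := Nat.cast_lt.1 this
          omega
        exact (hw d).1 h1 (h d hc)
      · intro h s hs
        by_contra hc
        have h1 := h.trans (weightedOrder_le w hs)
        rw [(hw s).2 hc] at h1
        simp at h1
    rw [hmem, weightedOrder_mul] at hfg
    rw [hmem, hmem]
    by_contra! hc
    rw [hc.1, hc.2] at hfg
    exact hfg (add_zero 0)

/-- The generic point of one coordinate subspace detects which variables vanish on it. This recovers
the equations of the centre from its set of points. -/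
theorem coordLocus_injective : Function.Injective (coordLocus k (n := n)) := by
  have key : ∀ S S' : Finset (Fin (n + 1)), coordLocus k S = coordLocus k S' → S' ⊆ S := by
    intro S S' h j hj
    have h1 : (⟨coordIdeal k S, coordIdeal_isPrime S⟩ : PrimeSpectrum (CompletedRing k n)) ∈
        coordLocus k S := mem_coordLocus_iff.2 fun i hi => X_mem_coordIdeal_iff.2 hi
    rw [h, mem_coordLocus_iff] at h1
    exact X_mem_coordIdeal_iff.1 (h1 j hj)
  exact fun S S' h => (key S' S h.symm).antisymm (key S S' h)

end Centre

/-! ### The equations of the centre -/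

namespace MonomialDatum.IsMonomialCase

variable {k : Type*} [Field k] {n : ℕ} {Λ : Type*} [LinearOrder Λ] {p : ℕ}
variable {T : Triplet k n Λ} {F : MonomialDatum k n Λ} {s : Finset Λ}

/-- The indices of the equations of the centre. -/
def centreIndices (T : Triplet k n Λ) (s : Finset Λ) : Finset (Fin (n + 1)) :=
  insert 0 (s.image T.pos)

/-- Summing the Newton bounds over s, where ∑ H ≥ 1, shows that every monomial of an element at
level i has degree at least i in the variables of the centre, so the element lies in the i-th power
of Q. -/
theorem mem_sing_of_mem (hF : F.IsMonomialCase p T) (hq : 0 < p ^ F.e)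
    (hs : IsGammaMax T.E (F.slopeDiv p T) s) {Q : PrimeSpectrum (CompletedRing k n)}
    (h0 : X 0 ∈ Q.asIdeal) (hQ : ∀ l ∈ s, X (T.pos l) ∈ Q.asIdeal) : Q ∈ T.R.sing := by
  classical
  intro i f hf
  have hle : Ideal.span ((fun j => (X j : CompletedRing k n)) ''
      (centreIndices T s : Set (Fin (n + 1)))) ≤ Q.asIdeal := by
    rw [Ideal.span_le]
    rintro _ ⟨j, hj, rfl⟩
    rw [centreIndices, Finset.mem_coe, Finset.mem_insert, Finset.mem_image] at hj
    obtain rfl | ⟨l, hl, rfl⟩ := hj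
    · exact h0
    · exact hQ l hl
  have hmem : f ∈ Q.asIdeal ^ i := by
    refine Ideal.pow_right_mono hle i (mem_span_X_pow_of_coeff _ i f fun t ht => ?_)
    have hnot : (0 : Fin (n + 1)) ∉ s.image T.pos := by
      intro h
      obtain ⟨l, hl, h⟩ := Finset.mem_image.1 h
      exact hF.pos_ne l (hs.subset hl) h
    rw [centreIndices, Finset.sum_insert hnot, Finset.sum_image
      (fun a ha b hb h => hF.pos_injOn (hs.subset ha) (hs.subset hb) h)]
    obtain h | h := le_or_gt i (t 0)
    · omega
    · have hpos : (0 : ℚ) < i - t 0 := by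
        rw [sub_pos]
        exact_mod_cast h
      have h1 : (i : ℚ) - t 0 ≤ ∑ l ∈ s, (t (T.pos l) : ℚ) := by
        calc (i : ℚ) - t 0 ≤ (∑ l ∈ s, F.slopeDiv p T l) * (i - t 0) := by
              have := hs.one_le
              nlinarith
          _ = ∑ l ∈ s, F.slopeDiv p T l * (i - t 0) := by rw [Finset.sum_mul]
          _ ≤ _ := Finset.sum_le_sum fun l hl => hF.slopeDiv_mul_sub_le hq hf (hs.subset hl) ht
      have h2 : (i : ℚ) ≤ (t 0 + ∑ l ∈ s, t (T.pos l) : ℕ) := by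
        push_cast
        linarith
      exact_mod_cast h2
  have h1 := Ideal.mem_map_of_mem (algebraMap (CompletedRing k n)
    (Localization.AtPrime Q.asIdeal)) hmem
  rw [Ideal.map_pow] at h1
  refine Ideal.pow_right_mono ?_ i h1
  rw [Localization.AtPrime.map_eq_maximalIdeal]

/-- A component of s has H > 0, so its equation divides all the a_i. Modulo Q only x_1^q remains of
h, and h lies in Q. -/
theorem X_zero_mem_of_mem_sing (hF : F.IsMonomialCase p T) (hq : 0 < p ^ F.e)
    (hs : IsGammaMax T.E (F.slopeDiv p T) s) {Q : PrimeSpectrum (CompletedRing k n)}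
    (hsing : Q ∈ T.R.sing) (hQ : ∀ l ∈ s, X (T.pos l) ∈ Q.asIdeal) : X 0 ∈ Q.asIdeal := by
  obtain ⟨l, hl⟩ := hs.nonempty
  have hh : F.h p ∈ Q.asIdeal := by
    have h1 := Ideal.pow_le_self hq.ne' (hsing _ _ hF.h_mem)
    exact (IsLocalization.AtPrime.to_map_mem_maximal_iff _ Q.asIdeal _).1 h1
  have hcoef : ∀ i ∈ Finset.Icc 1 (p ^ F.e), F.coef i ∈ Q.asIdeal := by
    intro i hi
    have hdvd : (X (T.pos l) : CompletedRing k n) ^ 1 ∣ F.coef i := by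
      refine X_pow_dvd_iff_le.2 fun u hu => ?_
      have h1 := hF.slopeDiv_mul_le_of_coef hi (hs.subset hl) hu
      have h2 : (0 : ℚ) < i := by exact_mod_cast (Finset.mem_Icc.1 hi).1
      have h3 : (0 : ℚ) < u (T.pos l) := lt_of_lt_of_le (mul_pos (hs.pos hl) h2) h1
      exact_mod_cast h3
    rw [pow_one] at hdvd
    exact Ideal.mem_of_dvd _ hdvd (hQ l hl)
  refine Q.isPrime.mem_of_pow_mem (p ^ F.e) ?_
  have : (X 0 : CompletedRing k n) ^ p ^ F.e = F.h p -
      ∑ i ∈ Finset.Icc 1 (p ^ F.e), F.coef i * X 0 ^ (p ^ F.e - i) := by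
    rw [h]
    ring
  rw [this]
  exact Ideal.sub_mem _ hh (Ideal.sum_mem _ fun i hi => Ideal.mul_mem_right _ _ (hcoef i hi))

theorem zeroLocus_inter_maxLocus (hF : F.IsMonomialCase p T) (hq : 0 < p ^ F.e)
    (hs : IsGammaMax T.E (F.slopeDiv p T) s) :
    PrimeSpectrum.zeroLocus {(X 0 : CompletedRing k n)} ∩ T.maxLocus (F.slopeDiv p T) =
      T.R.sing ∩ T.maxLocus (F.slopeDiv p T) := by
  ext Q
  rw [Set.mem_inter_iff, Set.mem_inter_iff, Triplet.mem_maxLocus_iff hs,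
    PrimeSpectrum.mem_zeroLocus, Set.singleton_subset_iff]
  exact ⟨fun h => ⟨hF.mem_sing_of_mem hq hs h.1 h.2, h.2⟩,
    fun h => ⟨hF.X_zero_mem_of_mem_sing hq hs h.1 h.2, h.2⟩⟩

theorem isCenter_centreIndices (hF : F.IsMonomialCase p T) (hq : 0 < p ^ F.e)
    (hs : IsGammaMax T.E (F.slopeDiv p T) s) :
    T.IsCenter (F.slopeDiv p T) (centreIndices T s) := by
  rw [Triplet.IsCenter, ← hF.zeroLocus_inter_maxLocus hq hs]
  ext Q
  rw [mem_coordLocus_iff, Set.mem_inter_iff, Triplet.mem_maxLocus_iff hs,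
    PrimeSpectrum.mem_zeroLocus, Set.singleton_subset_iff, centreIndices]
  simp

theorem eq_centreIndices (hF : F.IsMonomialCase p T) (hq : 0 < p ^ F.e)
    (hs : IsGammaMax T.E (F.slopeDiv p T) s) {S : Finset (Fin (n + 1))}
    (hS : T.IsCenter (F.slopeDiv p T) S) : S = centreIndices T s :=
  coordLocus_injective (k := k) (hS.trans (hF.isCenter_centreIndices hq hs).symm)

end MonomialDatum.IsMonomialCase

/-! ### The pull-back homomorphism of the blow-up -/

section BlowupHom

variable {k : Type*} [Field k] {n : ℕ}
variable {S : Finset (Fin (n + 1))} {G : Fin (n + 1)} {b : Fin (n + 1) → k}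

theorem blowupHom_X (j : Fin (n + 1)) : blowupHom S G b (X j) = blowupImage S G b j :=
  substAlgHom_X _ j

theorem coeff_blowupHom (f : CompletedRing k n) (s : Fin (n + 1) →₀ ℕ) :
    coeff s (blowupHom S G b f) =
      finsum fun d => coeff d f • coeff s (d.prod fun j e => blowupImage S G b j ^ e) := by
  rw [blowupHom, substAlgHom_apply, coeff_subst (hasSubst_blowupImage S G b)]

/-- Here x_1 pulls back to x_G x_1, and the other parameters to series free of x_1, so the pull-back
preserves the degree in x_1 of each monomial. -/
theorem apply_zero_eq_of_coeff_prod_blowupImage (h0 : (0 : Fin (n + 1)) ∈ S) (hG : G ≠ 0)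
    (hb : b 0 = 0) {d s : Fin (n + 1) →₀ ℕ}
    (hs : coeff s (d.prod fun j e => blowupImage S G b j ^ e) ≠ 0) : s 0 = d 0 := by
  classical
  have hmul : ∀ (f g : CompletedRing k n) (a c : ℕ), (∀ s, coeff s f ≠ 0 → s 0 = a) →
      (∀ s, coeff s g ≠ 0 → s 0 = c) → ∀ s, coeff s (f * g) ≠ 0 → s 0 = a + c := by
    intro f g a c hf hg s hs
    obtain ⟨u, v, rfl, hu, hv⟩ := exists_coeff_ne_zero_of_mul hs
    rw [Finsupp.add_apply, hf u hu, hg v hv]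
  have hone : ∀ s : Fin (n + 1) →₀ ℕ, coeff s (1 : CompletedRing k n) ≠ 0 → s 0 = 0 := by
    intro s hs
    rw [coeff_one] at hs
    split_ifs at hs with h
    · rw [h]; rfl
    · exact absurd rfl hs
  have hX : ∀ j (s : Fin (n + 1) →₀ ℕ), coeff s (X j : CompletedRing k n) ≠ 0 →
      s 0 = if j = 0 then 1 else 0 := by
    intro j s hs
    rw [coeff_X] at hs
    split_ifs at hs with h
    · rw [h, Finsupp.single_apply]
    · exact absurd rfl hs
  have himg : ∀ j (s : Fin (n + 1) →₀ ℕ), coeff s (blowupImage S G b j) ≠ 0 →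
      s 0 = if j = 0 then 1 else 0 := by
    intro j
    unfold blowupImage
    split_ifs with h1 h2 h3 h4
    · exact absurd (h1.symm.trans h2) hG
    · intro s hs
      rw [hX G s hs, if_neg hG]
    · subst h4
      rw [hb, map_zero, add_zero]
      intro s hs
      have := hmul _ _ _ _ (hX G) (hX 0) s hs
      simpa [hG] using this
    · intro s hs
      have hadd : ∀ s : Fin (n + 1) →₀ ℕ, coeff s (X j + C (b j) : CompletedRing k n) ≠ 0 →
          s 0 = 0 := by
        intro s hs
        obtain h | h := exists_coeff_ne_zero_of_add hs
        · rw [hX j s h, if_neg h4]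
        · rw [coeff_C] at h
          split_ifs at h with h'
          · rw [h']; rfl
          · exact absurd rfl h
      have := hmul _ _ _ _ (hX G) hadd s hs
      simpa [hG] using this
    · subst ‹j = 0›
      exact absurd h0 h3
    · intro s hs
      rw [hX j s hs]
      simp [*]
  have hpow : ∀ j e (s : Fin (n + 1) →₀ ℕ), coeff s (blowupImage S G b j ^ e) ≠ 0 →
      s 0 = if j = 0 then e else 0 := by
    intro j e
    induction e with
    | zero =>
      intro s hs
      rw [pow_zero] at hs
      simp [hone s hs]
    | succ e ih =>
      intro s hs
      rw [pow_succ] at hs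
      rw [hmul _ _ _ _ ih (himg j) s hs]
      split_ifs <;> rfl
  have hprod : ∀ (J : Finset (Fin (n + 1))) (s : Fin (n + 1) →₀ ℕ),
      coeff s (∏ j ∈ J, blowupImage S G b j ^ d j) ≠ 0 →
      s 0 = ∑ j ∈ J, if j = 0 then d j else 0 := by
    intro J
    induction J using Finset.induction_on with
    | empty =>
      intro s hs
      rw [Finset.prod_empty] at hs
      rw [hone s hs, Finset.sum_empty]
    | insert a J ha ih =>
      intro s hs
      rw [Finset.prod_insert ha] at hs
      rw [Finset.sum_insert ha]
      exact hmul _ _ _ _ (hpow a (d a)) ih s hs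
  have := hprod d.support s hs
  rw [this, Finset.sum_ite_eq']
  split_ifs with h
  · rfl
  · exact (Finsupp.notMem_support_iff.1 h).symm

theorem exists_of_coeff_blowupHom_ne_zero (h0 : (0 : Fin (n + 1)) ∈ S) (hG : G ≠ 0)
    (hb : b 0 = 0) {f : CompletedRing k n} {s : Fin (n + 1) →₀ ℕ}
    (hs : coeff s (blowupHom S G b f) ≠ 0) : ∃ d, coeff d f ≠ 0 ∧ d 0 = s 0 := by
  rw [coeff_blowupHom] at hs
  obtain ⟨d, hd⟩ := not_forall.1 (mt finsum_eq_zero_of_forall_eq_zero hs)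
  rw [smul_eq_mul] at hd
  exact ⟨d, left_ne_zero_of_mul hd,
    (apply_zero_eq_of_coeff_prod_blowupImage h0 hG hb (right_ne_zero_of_mul hd)).symm⟩

theorem X_pow_ne_zero (i : Fin (n + 1)) (j : ℕ) : (X i : CompletedRing k n) ^ j ≠ 0 := by
  rw [X_pow_eq]
  intro h
  have := congrArg (coeff (Finsupp.single i j)) h
  rw [coeff_monomial_same, coeff_zero] at this
  exact one_ne_zero this

/-- x_1^j ∂^j multiplies a monomial by a number that depends only on its degree in x_1, and this
degree is preserved by the pull-back. -/
theorem X_zero_pow_mul_hasse_blowupHom (h0 : (0 : Fin (n + 1)) ∈ S) (hG : G ≠ 0)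
    (hb : b 0 = 0) (j : ℕ) (f : CompletedRing k n) :
    X 0 ^ j * hasse (Finsupp.single 0 j) (blowupHom S G b f) =
      blowupHom S G b (X 0 ^ j * hasse (Finsupp.single 0 j) f) := by
  ext s
  rw [coeff_X_pow_mul_hasse, coeff_blowupHom, coeff_blowupHom, mul_finsum]
  refine finsum_congr fun d => ?_
  rw [coeff_X_pow_mul_hasse, smul_eq_mul, smul_eq_mul, ← mul_assoc]
  by_cases h : coeff s (d.prod fun j e => blowupImage S G b j ^ e) = 0
  · rw [h, mul_zero, mul_zero]
  · rw [apply_zero_eq_of_coeff_prod_blowupImage h0 hG hb h]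

theorem X_zero_pow_mul_hasse_X_pow_mul (hG : G ≠ 0) (i j : ℕ) (f : CompletedRing k n) :
    X 0 ^ j * hasse (Finsupp.single 0 j) (X G ^ i * f) =
      X G ^ i * (X 0 ^ j * hasse (Finsupp.single 0 j) f) := by
  ext s
  rw [coeff_X_pow_mul_hasse, X_pow_eq G, coeff_monomial_mul, coeff_monomial_mul]
  split_ifs with h
  · rw [one_mul, one_mul, coeff_X_pow_mul_hasse, Finsupp.tsub_apply, Finsupp.single_apply,
      if_neg hG, Nat.sub_zero]
  · rw [mul_zero]

/-- The derivative in the first parameter of the transform. -/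
theorem blowupHom_hasse_eq (h0 : (0 : Fin (n + 1)) ∈ S) (hG : G ≠ 0) (hb : b 0 = 0) {i j : ℕ}
    (hij : j ≤ i) {f g : CompletedRing k n} (hfg : blowupHom S G b f = X G ^ i * g) :
    blowupHom S G b (hasse (Finsupp.single 0 j) f) =
      X G ^ (i - j) * hasse (Finsupp.single 0 j) g := by
  have h1 := X_zero_pow_mul_hasse_blowupHom h0 hG hb j f
  rw [hfg, X_zero_pow_mul_hasse_X_pow_mul hG, map_mul, map_pow, blowupHom_X, blowupImage,
    if_neg hG.symm, if_pos h0, hb, map_zero, add_zero, mul_pow] at h1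
  refine mul_left_cancel₀ (mul_ne_zero (X_pow_ne_zero (k := k) G j) (X_pow_ne_zero 0 j)) ?_
  rw [← h1]
  have : (X G : CompletedRing k n) ^ i = X G ^ j * X G ^ (i - j) := by
    rw [← pow_add, Nat.add_sub_cancel' hij]
  rw [this]
  ring

end BlowupHom

/-! ### Blow-up of monomials -/

namespace Triplet

variable {k : Type*} [Field k] {n : ℕ} {Λ : Type*}
variable {T : Triplet k n Λ} {S : Finset (Fin (n + 1))} {G : Fin (n + 1)}
  {b : Fin (n + 1) → k} {ε : Λ}

open Classical in
/-- The components whose strict transforms contain the point considered. -/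
def strictE (T : Triplet k n Λ) (S : Finset (Fin (n + 1))) (G : Fin (n + 1))
    (b : Fin (n + 1) → k) : Finset Λ :=
  T.E.filter fun l => T.pos l ∈ S → T.pos l ≠ G ∧ b (T.pos l) = 0

theorem mem_strictE {l : Λ} :
    l ∈ T.strictE S G b ↔ l ∈ T.E ∧ (T.pos l ∈ S → T.pos l ≠ G ∧ b (T.pos l) = 0) := by
  classical
  rw [strictE, Finset.mem_filter]

theorem degree_ge_of_isSingular (h : T.IsSingular) {i : ℕ} {f : CompletedRing k n}
    (hf : f ∈ T.R.level i) {s : Fin (n + 1) →₀ ℕ} (hs : coeff s f ≠ 0) : i ≤ s.degree := by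
  set P := IsLocalRing.closedPoint (CompletedRing k n)
  have h1 := h i f hf
  rw [← Localization.AtPrime.map_eq_maximalIdeal, ← Ideal.map_pow,
    IsLocalization.algebraMap_mem_map_algebraMap_iff P.asIdeal.primeCompl] at h1
  obtain ⟨m, hm, hmf⟩ := h1
  have hu : IsUnit m := by
    by_contra hc
    exact hm ((IsLocalRing.mem_maximalIdeal m).2 hc)
  have h2 : f ∈ IsLocalRing.maximalIdeal (CompletedRing k n) ^ i :=
    (Ideal.unit_mul_mem_iff_mem _ hu).1 hmf
  exact natCast_le_order_iff.1 (le_order_of_mem_maximalIdeal_pow i h2) s hs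

theorem ne_of_mem_strictE (hε : ε ∉ T.E) {l : Λ} (hl : l ∈ T.strictE S G b) : l ≠ ε := by
  rintro rfl
  exact hε (mem_strictE.1 hl).1

theorem notMem_strictE (hε : ε ∉ T.E) : ε ∉ T.strictE S G b :=
  fun h => hε (mem_strictE.1 h).1

variable [LinearOrder Λ]

theorem blowup_E : (T.blowup S G b ε).E = insert ε (T.strictE S G b) := by
  rw [blowup, strictE]

theorem blowup_pos_self : (T.blowup S G b ε).pos ε = G :=
  Function.update_self _ _ _

theorem blowup_pos_of_ne {l : Λ} (hl : l ≠ ε) : (T.blowup S G b ε).pos l = T.pos l :=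
  Function.update_of_ne hl _ _

theorem injOn_blowup_pos (hinj : Set.InjOn T.pos T.E) (hG : G ∈ S) (hε : ε ∉ T.E) :
    Set.InjOn (T.blowup S G b ε).pos (T.blowup S G b ε).E := by
  have hne : ∀ l ∈ T.strictE S G b, T.pos l ≠ G := by
    intro l hl h
    have := (mem_strictE.1 hl).2
    exact (this (h ▸ hG)).1 h
  intro l hl l' hl' h
  rw [Finset.mem_coe, blowup_E, Finset.mem_insert] at hl hl'
  obtain rfl | hl := hl <;> obtain rfl | hl' := hl'
  · rfl
  · rw [blowup_pos_self, blowup_pos_of_ne (ne_of_mem_strictE hε hl')] at h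
    exact absurd h.symm (hne l' hl')
  · rw [blowup_pos_self, blowup_pos_of_ne (ne_of_mem_strictE hε hl)] at h
    exact absurd h (hne l hl)
  · rw [blowup_pos_of_ne (ne_of_mem_strictE hε hl),
      blowup_pos_of_ne (ne_of_mem_strictE hε hl')] at h
    exact hinj (mem_strictE.1 hl).1 (mem_strictE.1 hl').1 h

theorem blowup_pos_ne_zero (h0 : ∀ l ∈ T.E, T.pos l ≠ 0) (hG : G ≠ 0) (hε : ε ∉ T.E) :
    ∀ l ∈ (T.blowup S G b ε).E, (T.blowup S G b ε).pos l ≠ 0 := by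
  intro l hl
  rw [blowup_E, Finset.mem_insert] at hl
  obtain rfl | hl := hl
  · rwa [blowup_pos_self]
  · rw [blowup_pos_of_ne (ne_of_mem_strictE hε hl)]
    exact h0 l (mem_strictE.1 hl).1

/-- The exponents of the transform of a monomial with integral exponents at level `c`. -/
def transformNat (T : Triplet k n Λ) (S : Finset (Fin (n + 1))) (ε : Λ) (r : Λ → ℕ) (c : ℕ) :
    Λ → ℕ :=
  Function.update r ε (∑ l ∈ T.E.filter (fun l => T.pos l ∈ S), r l - c)

/-- Each x_D pulls back to x_G (if D contains the centre) times an equation of its strict transform.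
The equations of the strict transforms that miss the point are collected in the unit. -/
theorem blowupHom_prod (hε : ε ∉ T.E) {r : Λ → ℕ} {c : ℕ}
    (hc : c ≤ ∑ l ∈ T.E.filter (fun l => T.pos l ∈ S), r l) :
    ∃ u : CompletedRing k n, IsUnit u ∧ blowupHom S G b (∏ l ∈ T.E, X (T.pos l) ^ r l) =
      X G ^ c * (u * ∏ l ∈ (T.blowup S G b ε).E,
        X ((T.blowup S G b ε).pos l) ^ T.transformNat S ε r c l) := by
  classical
  let y : Λ → CompletedRing k n := fun l => if T.pos l = G then 1 else X (T.pos l) + C (b (T.pos l))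
  let cond : Λ → Prop := fun l => T.pos l ∈ S → T.pos l ≠ G ∧ b (T.pos l) = 0
  refine ⟨∏ l ∈ T.E, (if cond l then 1 else y l) ^ r l, ?_, ?_⟩
  · rw [MvPowerSeries.isUnit_iff_constantCoeff, map_prod, isUnit_iff_ne_zero,
      Finset.prod_ne_zero_iff]
    intro l _
    rw [map_pow]
    refine pow_ne_zero _ ?_
    split_ifs with h
    · simp
    · simp only [y]
      split_ifs with hG
      · simp
      · simp only [cond] at h
        push Not at h
        simpa using h.2 hG
  · rw [map_prod, blowup_E, Finset.prod_insert (notMem_strictE hε), blowup_pos_self]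
    have h1 : ∏ l ∈ T.strictE S G b, (X ((T.blowup S G b ε).pos l) : CompletedRing k n) ^
        T.transformNat S ε r c l = ∏ l ∈ T.E, (if cond l then X (T.pos l) else 1) ^ r l := by
      have : T.strictE S G b = T.E.filter cond := rfl
      rw [Finset.prod_congr this fun l hl => rfl, Finset.prod_filter]
      refine Finset.prod_congr rfl fun l hl => ?_
      have hne : l ≠ ε := fun h => hε (h ▸ hl)
      rw [blowup_pos_of_ne hne, transformNat, Function.update_of_ne hne]
      split_ifs <;> simp
    have h2 : (X G : CompletedRing k n) ^ c * X G ^ T.transformNat S ε r c ε =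
        ∏ l ∈ T.E, (if T.pos l ∈ S then X G else 1) ^ r l := by
      rw [transformNat, Function.update_self, ← pow_add, Nat.add_sub_cancel' hc,
        ← Finset.prod_pow_eq_pow_sum, Finset.prod_filter]
      refine Finset.prod_congr rfl fun l _ => ?_
      split_ifs <;> simp
    rw [h1]
    calc ∏ l ∈ T.E, blowupHom S G b (X (T.pos l) ^ r l) =
        ∏ l ∈ T.E, ((if T.pos l ∈ S then X G else 1) ^ r l *
          ((if cond l then 1 else y l) ^ r l * (if cond l then X (T.pos l) else 1) ^ r l)) := by
          refine Finset.prod_congr rfl fun l _ => ?_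
          rw [map_pow, blowupHom_X, ← mul_pow, ← mul_pow]
          congr 1
          simp only [blowupImage, cond, y]
          by_cases hS : T.pos l ∈ S
          · by_cases hG : T.pos l = G
            · have hGS : G ∈ S := hG ▸ hS
              simp [hG, hGS]
            · by_cases hb : b (T.pos l) = 0 <;> simp [hS, hG, hb]
          · by_cases hG : T.pos l = G
            · have hGS : G ∉ S := hG ▸ hS
              simp [hG, hGS]
            · simp [hS, hG]
      _ = _ := by
          rw [Finset.prod_mul_distrib, Finset.prod_mul_distrib, ← h2]
          ring

/-- The transform of a power series bounded below by a monomial with rational exponents. -/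
theorem exists_transform (hinj : Set.InjOn T.pos T.E) (hG : G ∈ S) (hε : ε ∉ T.E) {κ : Λ → ℚ}
    (hκ1 : 1 ≤ ∑ l ∈ T.E.filter (fun l => T.pos l ∈ S), κ l) {j : ℕ} {f : CompletedRing k n}
    (hf : ∀ s, coeff s f ≠ 0 → ∀ l ∈ T.E, κ l * j ≤ s (T.pos l)) :
    ∃ g, blowupHom S G b f = X G ^ j * g ∧ ∀ s, coeff s g ≠ 0 →
      ∀ l ∈ (T.blowup S G b ε).E, T.transformExponents S ε κ l * j ≤
        s ((T.blowup S G b ε).pos l) := by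
  classical
  -- Rounding the rational exponents up gives a genuine monomial dividing `f`, whose transform is
  -- explicit. The bounds survive, since the rounded sum minus j is at least (∑ κ - 1) j.
  let r : Λ → ℕ := fun l => ⌈κ l * j⌉₊
  have hr : ∀ l, κ l * j ≤ r l := fun l => Nat.le_ceil _
  have hsum : (∑ l ∈ T.E.filter (fun l => T.pos l ∈ S), κ l) * j ≤
      (∑ l ∈ T.E.filter (fun l => T.pos l ∈ S), r l : ℕ) := by
    rw [Finset.sum_mul, Nat.cast_sum]
    exact Finset.sum_le_sum fun l _ => hr l
  have hj : (j : ℚ) ≤ (∑ l ∈ T.E.filter (fun l => T.pos l ∈ S), κ l) * j := by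
    have : (0 : ℚ) ≤ j := Nat.cast_nonneg j
    nlinarith
  have hc : j ≤ ∑ l ∈ T.E.filter (fun l => T.pos l ∈ S), r l := by
    exact_mod_cast hj.trans hsum
  obtain ⟨w, hw⟩ := (prod_X_pow_dvd_iff (r := r) hinj).2 fun s hs l hl => by
    exact Nat.ceil_le.2 (hf s hs l hl)
  obtain ⟨u, -, hu⟩ := blowupHom_prod (G := G) (b := b) hε hc
  refine ⟨_, by rw [hw, map_mul, hu, mul_assoc], fun s hs l hl => ?_⟩
  have hdvd : ∏ l ∈ (T.blowup S G b ε).E, X ((T.blowup S G b ε).pos l) ^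
      T.transformNat S ε r j l ∣ (u * ∏ l ∈ (T.blowup S G b ε).E,
      X ((T.blowup S G b ε).pos l) ^ T.transformNat S ε r j l) * blowupHom S G b w :=
    (dvd_mul_left _ _).mul_right _
  have h1 := (prod_X_pow_dvd_iff (injOn_blowup_pos hinj hG hε)).1 hdvd s hs l hl
  have h2 : T.transformExponents S ε κ l * j ≤ T.transformNat S ε r j l := by
    by_cases hlε : l = ε
    · subst hlε
      rw [transformExponents, transformNat, Function.update_self, Function.update_self,
        Nat.cast_sub hc]
      linarith
    · rw [transformExponents, transformNat, Function.update_of_ne hlε, Function.update_of_ne hlε]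
      exact hr l
  exact h2.trans (by exact_mod_cast h1)

theorem transformExponents_self (κ : Λ → ℚ) : T.transformExponents S ε κ ε =
    ∑ l ∈ T.E.filter (fun l => T.pos l ∈ S), κ l - 1 :=
  Function.update_self _ _ _

theorem transformExponents_of_ne {κ : Λ → ℚ} {l : Λ} (hl : l ≠ ε) :
    T.transformExponents S ε κ l = κ l :=
  Function.update_of_ne hl _ _

end Triplet

theorem MonomialDatum.IsMonomialCase.filter_mem_centreIndices {k : Type*} [Field k] {n : ℕ}
    {Λ : Type*} {p : ℕ} {T : Triplet k n Λ} {F : MonomialDatum k n Λ} {s : Finset Λ}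
    {S : Finset (Fin (n + 1))} (hF : F.IsMonomialCase p T) (hs : s ⊆ T.E)
    (hS : S = centreIndices T s) : T.E.filter (fun l => T.pos l ∈ S) = s := by
  classical
  ext l
  rw [Finset.mem_filter, hS, centreIndices, Finset.mem_insert, Finset.mem_image]
  constructor
  · rintro ⟨hl, h | ⟨l', hl', h⟩⟩
    · exact absurd h (hF.pos_ne l hl)
    · rwa [← hF.pos_injOn (hs hl') hl h]
  · exact fun hl => ⟨hs hl, Or.inr ⟨l, hl, rfl⟩⟩

namespace MonomialDatum

variable {k : Type*} [Field k] {n : ℕ} {Λ : Type*} [LinearOrder Λ]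

/-! ### The transform of the monomial datum -/

/-- The transform of a monomial datum with given transforms of the coefficients of `h`. -/
def transformDatum (F : MonomialDatum k n Λ) (T : Triplet k n Λ) (S : Finset (Fin (n + 1)))
    (ε : Λ) (coef' : ℕ → CompletedRing k n) : MonomialDatum k n Λ where
  e := F.e
  coef := coef'
  m := T.transformNat S ε F.m F.a
  a := F.a

/-- A closed point of the blow-up along the centre, outside of the chart of `x_1` and on the strict
transform of `{x_1 = 0}`, with the transforms of the coefficients of `h`. -/
structure IsBlowupData (p : ℕ) (T : Triplet k n Λ) (F : MonomialDatum k n Λ) (s : Finset Λ)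
    (S : Finset (Fin (n + 1))) (G : Fin (n + 1)) (b : Fin (n + 1) → k) (ε : Λ)
    (coef' : ℕ → CompletedRing k n) : Prop where
  isMonomialCase : F.IsMonomialCase p T
  pow_pos : 0 < p ^ F.e
  isGammaMax : IsGammaMax T.E (F.slopeDiv p T) s
  S_eq : S = IsMonomialCase.centreIndices T s
  G_mem : G ∈ S
  G_ne : G ≠ 0
  b_zero : b 0 = 0
  notMem : ε ∉ T.E
  coef_eq : ∀ i ∈ Finset.Icc 1 (p ^ F.e), blowupHom S G b (F.coef i) = X G ^ i * coef' i
  coef_zero : ∀ i ∈ Finset.Icc 1 (p ^ F.e), constantCoeff (coef' i) = 0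
  coef_le : ∀ i ∈ Finset.Icc 1 (p ^ F.e), ∀ u, coeff u (coef' i) ≠ 0 →
    ∀ l ∈ (T.blowup S G b ε).E, T.transformExponents S ε (F.slopeDiv p T) l * i ≤
      u ((T.blowup S G b ε).pos l)

/-! ### The position of a singular point in the fibre -/

section Centre

variable {p : ℕ} {T : Triplet k n Λ} {F : MonomialDatum k n Λ} {s : Finset Λ}
  {S : Finset (Fin (n + 1))} {G : Fin (n + 1)} {b : Fin (n + 1) → k} {ε : Λ}

/-- In the chart of x_1, or off the strict transform of {x_1 = 0}, the cofactor y of x_1 is a unit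
while the transformed a_i vanish at the point. The transform of h would then be a unit at level q,
against singularity. -/
theorem IsMonomialCase.exists_isBlowupData (hF : F.IsMonomialCase p T) (hq : 0 < p ^ F.e)
    (ht : 1 < F.ordTight p T) (hs : IsGammaMax T.E (F.slopeDiv p T) s)
    (hS : S = centreIndices T s) (hG : G ∈ S) (hε : ε ∉ T.E)
    (hsing : (T.blowup S G b ε).IsSingular) :
    ∃ coef', IsBlowupData p T F s S G b ε coef' := by
  classical
  have hfil := hF.filter_mem_centreIndices hs.subset hS
  have h1 : 1 ≤ ∑ l ∈ T.E.filter (fun l => T.pos l ∈ S), F.slopeDiv p T l := by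
    rw [hfil]
    exact hs.one_le
  have hex : ∀ i, ∃ g, i ∈ Finset.Icc 1 (p ^ F.e) → blowupHom S G b (F.coef i) = X G ^ i * g ∧
      ∀ u, coeff u g ≠ 0 → ∀ l ∈ (T.blowup S G b ε).E,
        T.transformExponents S ε (F.slopeDiv p T) l * i ≤ u ((T.blowup S G b ε).pos l) := by
    intro i
    by_cases hi : i ∈ Finset.Icc 1 (p ^ F.e)
    · obtain ⟨g, hg⟩ := Triplet.exists_transform (b := b) hF.pos_injOn hG hε h1
        (fun u hu l hl => hF.slopeDiv_mul_le_of_coef hi hl hu)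
      exact ⟨g, fun _ => hg⟩
    · exact ⟨0, fun h => absurd h hi⟩
  choose coef' hcoef using hex
  -- A nonzero constant term would force all the new exponents to be at most 0. Components outside s
  -- keep their exponents and ε gets ∑_s H - 1, so the old tight monomial would have order at most
  -- 1.
  have hzero : ∀ i ∈ Finset.Icc 1 (p ^ F.e), constantCoeff (coef' i) = 0 := by
    intro i hi
    by_contra hne
    rw [← coeff_zero_eq_constantCoeff_apply] at hne
    have hipos : (0 : ℚ) < i := by exact_mod_cast (Finset.mem_Icc.1 hi).1
    have hle : ∀ l ∈ (T.blowup S G b ε).E,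
        T.transformExponents S ε (F.slopeDiv p T) l ≤ 0 := by
      intro l hl
      have h2 := (hcoef i hi).2 0 hne l hl
      simp only [Finsupp.coe_zero, Pi.zero_apply, Nat.cast_zero] at h2
      by_contra! hc
      exact absurd h2 (not_le.2 (mul_pos hc hipos))
    have h2 := hle ε (by rw [Triplet.blowup_E]; exact Finset.mem_insert_self _ _)
    rw [Triplet.transformExponents_self, hfil] at h2
    have h3 : ∑ l ∈ T.E \ s, F.slopeDiv p T l ≤ 0 := by
      refine Finset.sum_nonpos fun l hl => ?_
      rw [Finset.mem_sdiff] at hl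
      have hlε : l ≠ ε := fun h => hε (h ▸ hl.1)
      have h4 := hle l (by
        rw [Triplet.blowup_E, Finset.mem_insert, Triplet.mem_strictE]
        refine Or.inr ⟨hl.1, fun h => absurd ?_ hl.2⟩
        rw [← hfil]
        exact Finset.mem_filter.2 ⟨hl.1, h⟩)
      rwa [Triplet.transformExponents_of_ne hlε] at h4
    have h5 := Finset.sum_sdiff (f := F.slopeDiv p T) hs.subset
    have h6 : F.ordTight p T = ∑ l ∈ T.E, F.slopeDiv p T l := rfl
    linarith
  have h0S : (0 : Fin (n + 1)) ∈ S := by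
    rw [hS, centreIndices]
    exact Finset.mem_insert_self _ _
  let y : CompletedRing k n := if (0 : Fin (n + 1)) = G then 1 else X 0 + C (b 0)
  have hy : blowupHom S G b (X 0) = X G * y := by
    rw [blowupHom_X, blowupImage, if_pos h0S]
    simp only [y]
    split_ifs with h
    · rw [mul_one]
    · rfl
  have hh : blowupHom S G b (F.h p) = X G ^ p ^ F.e *
      (y ^ p ^ F.e + ∑ i ∈ Finset.Icc 1 (p ^ F.e), coef' i * y ^ (p ^ F.e - i)) := by
    rw [h, map_add, map_pow, hy, map_sum, mul_add, mul_pow, Finset.mul_sum]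
    congr 1
    refine Finset.sum_congr rfl fun i hi => ?_
    rw [map_mul, map_pow, hy, (hcoef i hi).1, mul_pow]
    have : (X G : CompletedRing k n) ^ p ^ F.e = X G ^ i * X G ^ (p ^ F.e - i) := by
      rw [← pow_add, Nat.add_sub_cancel' (Finset.mem_Icc.1 hi).2]
    rw [this]
    ring
  have hmem : y ^ p ^ F.e + ∑ i ∈ Finset.Icc 1 (p ^ F.e), coef' i * y ^ (p ^ F.e - i) ∈
      (T.blowup S G b ε).R.level (p ^ F.e) :=
    Ideal.subset_span ⟨p ^ F.e, le_rfl, F.h p, hF.h_mem, hh⟩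
  have hy0 : constantCoeff y = 0 := by
    have h2 : constantCoeff (y ^ p ^ F.e +
        ∑ i ∈ Finset.Icc 1 (p ^ F.e), coef' i * y ^ (p ^ F.e - i)) = 0 := by
      by_contra hc
      rw [← coeff_zero_eq_constantCoeff_apply] at hc
      have := Triplet.degree_ge_of_isSingular hsing hmem hc
      rw [map_zero] at this
      omega
    rw [map_add, map_pow, map_sum, Finset.sum_eq_zero, add_zero] at h2
    · exact pow_eq_zero_iff hq.ne' |>.1 h2
    · intro i hi
      rw [map_mul, hzero i hi, zero_mul]
  have hG0 : G ≠ 0 := by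
    rintro rfl
    simp [y] at hy0
  have hb0 : b 0 = 0 := by
    simpa [y, hG0.symm] using hy0
  exact ⟨coef', hF, hq, hs, hS, hG, hG0, hb0, hε, fun i hi => (hcoef i hi).1, hzero,
    fun i hi => (hcoef i hi).2⟩

end Centre

/-! ### The monomial case at the new point -/

namespace IsBlowupData

variable {p : ℕ} {T : Triplet k n Λ} {F : MonomialDatum k n Λ} {s : Finset Λ}
  {S : Finset (Fin (n + 1))} {G : Fin (n + 1)} {b : Fin (n + 1) → k} {ε : Λ}
  {coef' : ℕ → CompletedRing k n}

theorem filter_eq (hB : IsBlowupData p T F s S G b ε coef') :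
    T.E.filter (fun l => T.pos l ∈ S) = s :=
  hB.isMonomialCase.filter_mem_centreIndices hB.isGammaMax.subset hB.S_eq

theorem zero_mem (hB : IsBlowupData p T F s S G b ε coef') : (0 : Fin (n + 1)) ∈ S := by
  rw [hB.S_eq, IsMonomialCase.centreIndices]
  exact Finset.mem_insert_self _ _

theorem exists_chart (hB : IsBlowupData p T F s S G b ε coef') : ∃ l ∈ s, T.pos l = G := by
  have h := hB.G_mem
  rw [hB.S_eq, IsMonomialCase.centreIndices, Finset.mem_insert, Finset.mem_image] at h
  exact h.resolve_left hB.G_ne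

theorem not_subset (hB : IsBlowupData p T F s S G b ε coef') :
    ¬ s ⊆ (T.blowup S G b ε).E := by
  intro hsub
  obtain ⟨l, hl, hlG⟩ := hB.exists_chart
  have h := hsub hl
  rw [Triplet.blowup_E, Finset.mem_insert, Triplet.mem_strictE] at h
  obtain rfl | h := h
  · exact hB.notMem (hB.isGammaMax.subset hl)
  · exact (h.2 (hlG ▸ hB.G_mem)).1 hlG

theorem mem_strictE_of_notMem (hB : IsBlowupData p T F s S G b ε coef') {l : Λ} (hl : l ∈ T.E)
    (hls : l ∉ s) : l ∈ T.strictE S G b := by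
  rw [Triplet.mem_strictE]
  refine ⟨hl, fun h => absurd ?_ hls⟩
  rw [← hB.filter_eq]
  exact Finset.mem_filter.2 ⟨hl, h⟩

theorem one_le_sum_muDiv (hB : IsBlowupData p T F s S G b ε coef') :
    1 ≤ ∑ l ∈ s, F.muDiv l :=
  hB.isGammaMax.one_le.trans (Finset.sum_le_sum fun l _ => slopeDiv_le_muDiv l)

theorem a_le_sum_m (hB : IsBlowupData p T F s S G b ε coef') : F.a ≤ ∑ l ∈ s, F.m l := by
  have ha : (0 : ℚ) < F.a := by exact_mod_cast hB.isMonomialCase.a_pos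
  have h := hB.one_le_sum_muDiv
  simp only [muDiv] at h
  rw [← Finset.sum_div, one_le_div ha] at h
  exact_mod_cast h

theorem muDiv_transformDatum (hB : IsBlowupData p T F s S G b ε coef') (l : Λ) :
    (F.transformDatum T S ε coef').muDiv l = T.transformExponents S ε F.muDiv l := by
  have ha : (F.a : ℚ) ≠ 0 := by exact_mod_cast hB.isMonomialCase.a_pos.ne'
  have hdef : (F.transformDatum T S ε coef').muDiv l =
      (T.transformNat S ε F.m F.a l : ℚ) / F.a := rfl
  rw [hdef]
  by_cases hl : l = ε
  · subst hl
    rw [Triplet.transformExponents_self, Triplet.transformNat, Function.update_self, hB.filter_eq,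
      Nat.cast_sub hB.a_le_sum_m, sub_div, div_self ha, Nat.cast_sum, Finset.sum_div]
    rfl
  · rw [Triplet.transformExponents_of_ne hl, Triplet.transformNat, Function.update_of_ne hl]
    rfl

theorem transformExponents_le (hB : IsBlowupData p T F s S G b ε coef') (l : Λ) :
    T.transformExponents S ε (F.slopeDiv p T) l ≤ (F.transformDatum T S ε coef').muDiv l := by
  rw [hB.muDiv_transformDatum]
  by_cases hl : l = ε
  · subst hl
    rw [Triplet.transformExponents_self, Triplet.transformExponents_self]
    exact sub_le_sub_right (Finset.sum_le_sum fun l _ => slopeDiv_le_muDiv l) 1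
  · rw [Triplet.transformExponents_of_ne hl, Triplet.transformExponents_of_ne hl]
    exact slopeDiv_le_muDiv l

theorem injOn_pos (hB : IsBlowupData p T F s S G b ε coef') :
    Set.InjOn (T.blowup S G b ε).pos (T.blowup S G b ε).E :=
  Triplet.injOn_blowup_pos hB.isMonomialCase.pos_injOn hB.G_mem hB.notMem

theorem pos_ne (hB : IsBlowupData p T F s S G b ε coef') :
    ∀ l ∈ (T.blowup S G b ε).E, (T.blowup S G b ε).pos l ≠ 0 :=
  Triplet.blowup_pos_ne_zero hB.isMonomialCase.pos_ne hB.G_ne hB.notMem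

theorem coef_free (hB : IsBlowupData p T F s S G b ε coef') :
    ∀ i ∈ Finset.Icc 1 (p ^ F.e), FreeOfX1 (coef' i) := by
  intro i hi u hu
  by_contra hc
  have h1 : coeff (Finsupp.single G i + u) (blowupHom S G b (F.coef i)) ≠ 0 := by
    rw [hB.coef_eq i hi, X_pow_eq, coeff_add_monomial_mul, one_mul]
    exact hc
  obtain ⟨d, hd, hd0⟩ := exists_of_coeff_blowupHom_ne_zero hB.zero_mem hB.G_ne hB.b_zero h1
  refine hd (hB.isMonomialCase.coef_free i hi d ?_)
  rw [hd0, Finsupp.add_apply]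
  omega

theorem X_pow_mul_h (hB : IsBlowupData p T F s S G b ε coef') :
    X G ^ p ^ F.e * (F.transformDatum T S ε coef').h p = blowupHom S G b (F.h p) := by
  have hy : blowupHom S G b (X 0) = X G * X 0 := by
    rw [blowupHom_X, blowupImage, if_neg hB.G_ne.symm, if_pos hB.zero_mem, hB.b_zero, map_zero,
      add_zero]
  have hdef : (F.transformDatum T S ε coef').h p = X 0 ^ p ^ F.e +
    ∑ i ∈ Finset.Icc 1 (p ^ F.e), coef' i * X 0 ^ (p ^ F.e - i) := rfl
  rw [hdef, h, map_add, map_pow, hy, map_sum, mul_add, mul_pow, Finset.mul_sum]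
  congr 1
  refine Finset.sum_congr rfl fun i hi => ?_
  rw [map_mul, map_pow, hy, hB.coef_eq i hi, mul_pow]
  have : (X G : CompletedRing k n) ^ p ^ F.e = X G ^ i * X G ^ (p ^ F.e - i) := by
    rw [← pow_add, Nat.add_sub_cancel' (Finset.mem_Icc.1 hi).2]
  rw [this]
  ring

theorem h_mem (hB : IsBlowupData p T F s S G b ε coef') :
    (F.transformDatum T S ε coef').h p ∈ (T.blowup S G b ε).R.level (p ^ F.e) :=
  Ideal.subset_span ⟨p ^ F.e, le_rfl, F.h p, hB.isMonomialCase.h_mem, hB.X_pow_mul_h.symm⟩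

theorem isWeier (hB : IsBlowupData p T F s S G b ε coef') :
    IsWeier (p ^ F.e) ((F.transformDatum T S ε coef').h p) :=
  isWeier_h (F := F.transformDatum T S ε coef') hB.coef_free hB.coef_zero

theorem exists_unit_M (hB : IsBlowupData p T F s S G b ε coef') :
    ∃ u : CompletedRing k n, IsUnit u ∧ blowupHom S G b (F.M T) =
      X G ^ F.a * (u * (F.transformDatum T S ε coef').M (T.blowup S G b ε)) :=
  Triplet.blowupHom_prod hB.notMem (by
    rw [hB.filter_eq]
    exact hB.a_le_sum_m)

theorem M_mem (hB : IsBlowupData p T F s S G b ε coef') :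
    (F.transformDatum T S ε coef').M (T.blowup S G b ε) ∈ (T.blowup S G b ε).R.level F.a := by
  obtain ⟨u, hu, he⟩ := hB.exists_unit_M
  refine (Ideal.unit_mul_mem_iff_mem _ hu).1 ?_
  exact Ideal.subset_span ⟨F.a, le_rfl, F.M T, hB.isMonomialCase.M_mem, he⟩

/-- Hypothesis (i) for the transform is phrased with the ideal (h', x_D^N), because remainders are
not compatible with multiplication by arbitrary series. It is thus enough to treat the generators of
the transformed filtration. -/
theorem level_le_span (hB : IsBlowupData p T F s S G b ε coef') (i : ℕ) {l : Λ}
    (hl : l ∈ (T.blowup S G b ε).E) :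
    (T.blowup S G b ε).R.level i ≤ Ideal.span {(F.transformDatum T S ε coef').h p,
      (X ((T.blowup S G b ε).pos l) : CompletedRing k n) ^
        ⌈(F.transformDatum T S ε coef').muDiv l * i⌉₊} := by
  refine Ideal.span_le.2 ?_
  rintro g ⟨j, hij, f, hf, hfg⟩
  have hfg' : blowupHom S G b f = X G ^ j * g := hfg
  obtain ⟨c, w, hc, hcw⟩ := hB.isMonomialCase.isWeier.exists_division f
  obtain ⟨c', hc', hle⟩ := Triplet.exists_transform (b := b) (κ := F.muDiv) (j := j) (f := c)
    hB.isMonomialCase.pos_injOn hB.G_mem hB.notMem (by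
      rw [hB.filter_eq]
      exact hB.one_le_sum_muDiv)
    (fun u hu l hl => hB.isMonomialCase.muDiv_mul_le_of_remainder hf hc hcw hl hu)
  obtain ⟨r, z, hr, hgz⟩ := hB.isWeier.exists_division g
  have hdeg : DegX1LT (p ^ F.e) (X G ^ j * r - blowupHom S G b c) := by
    intro t ht
    by_contra hne
    rw [map_sub] at hne
    have h1 : coeff t (X G ^ j * r) = 0 := by
      rw [X_pow_eq, coeff_monomial_mul]
      split_ifs with h
      · rw [hr, mul_zero]
        rwa [Finsupp.tsub_apply, Finsupp.single_apply, if_neg hB.G_ne, Nat.sub_zero]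
      · rfl
    rw [h1, zero_sub, neg_eq_zero] at hne
    obtain ⟨d, hd, hd0⟩ := exists_of_coeff_blowupHom_ne_zero hB.zero_mem hB.G_ne hB.b_zero hne
    exact hd (hc d (hd0 ▸ ht))
  -- x_G^j times the remainder of `g` and the pull-back of the remainder of `f` both have degree
  -- less than q in x_1 and agree modulo h', so they coincide.
  have h1 := hB.isWeier.eq_zero_of_dvd hdeg
    ⟨X G ^ p ^ F.e * blowupHom S G b w - X G ^ j * z, by
      have h2 : X G ^ j * r + (F.transformDatum T S ε coef').h p * (X G ^ j * z) =
          blowupHom S G b c + X G ^ p ^ F.e * (F.transformDatum T S ε coef').h p *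
            blowupHom S G b w := by
        rw [hB.X_pow_mul_h, ← map_mul, ← map_add, ← hcw, hfg', hgz]
        ring
      linear_combination h2⟩
  rw [hc', ← mul_sub] at h1
  have h2 : r = c' := sub_eq_zero.1 ((mul_eq_zero.1 h1).resolve_left (X_pow_ne_zero G j))
  have hμ0 : 0 ≤ (F.transformDatum T S ε coef').muDiv l := muDiv_nonneg l
  have hdvd : (X ((T.blowup S G b ε).pos l) : CompletedRing k n) ^
      ⌈(F.transformDatum T S ε coef').muDiv l * i⌉₊ ∣ r := by
    rw [X_pow_dvd_iff_le]
    intro t ht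
    rw [Nat.ceil_le]
    refine le_trans ?_ (hle t (h2 ▸ ht) l hl)
    rw [← hB.muDiv_transformDatum]
    exact mul_le_mul_of_nonneg_left (by exact_mod_cast hij) hμ0
  rw [SetLike.mem_coe, hgz]
  refine Ideal.add_mem _ (Ideal.mem_of_dvd _ hdvd (Ideal.subset_span (by simp))) ?_
  exact Ideal.mul_mem_right _ _ (Ideal.subset_span (by simp))

theorem hasse_add (I : Fin (n + 1) →₀ ℕ) (f g : CompletedRing k n) :
    hasse I (f + g) = hasse I f + hasse I g := by
  ext t
  rw [map_add, coeff_hasse, coeff_hasse, coeff_hasse, map_add, mul_add]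

/-- The generators are stable under derivatives in x_1 because derivative and transform commute. In
the Leibniz rule, derivatives falling on the coefficient only relax the level required of the other
factor. -/
theorem hasse_mem (hB : IsBlowupData p T F s S G b ε coef') (i : ℕ) {f : CompletedRing k n}
    (hf : f ∈ (T.blowup S G b ε).R.level i) :
    ∀ j, hasse (Finsupp.single 0 j) f ∈ (T.blowup S G b ε).R.level (i - j) := by
  refine Submodule.span_induction (p := fun f _ => ∀ j,
    hasse (Finsupp.single 0 j) f ∈ (T.blowup S G b ε).R.level (i - j)) ?_ ?_ ?_ ?_ hf
  · rintro g ⟨i', hi', f, hf, hfg⟩ j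
    obtain hj | hj := le_or_gt i j
    · rw [Nat.sub_eq_zero_of_le hj, (T.blowup S G b ε).R.level_zero]
      trivial
    · refine Ideal.subset_span ⟨i' - j, by omega, hasse (Finsupp.single 0 j) f,
        hB.isMonomialCase.hasse_mem i' f hf j, ?_⟩
      exact blowupHom_hasse_eq hB.zero_mem hB.G_ne hB.b_zero (by omega) hfg
  · intro j
    have : hasse (Finsupp.single 0 j) (0 : CompletedRing k n) = 0 := by
      ext t
      rw [coeff_hasse, coeff_zero, mul_zero, coeff_zero]
    rw [this]
    exact Ideal.zero_mem _
  · intro f g _ _ hf hg j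
    rw [hasse_add]
    exact Ideal.add_mem _ (hf j) (hg j)
  · intro r f _ hf j
    rw [smul_eq_mul, hasse_single_zero_mul]
    refine Ideal.sum_mem _ fun x hx => Ideal.mul_mem_left _ _ ?_
    have := Finset.HasAntidiagonal.mem_antidiagonal.1 hx
    exact (T.blowup S G b ε).R.antitone (by omega) (hf x.2)

/-- The transform is again in the monomial case. -/
theorem isMonomialCase_blowup (hB : IsBlowupData p T F s S G b ε coef')
    (h1 : 1 < ∑ l ∈ (T.blowup S G b ε).E, T.transformExponents S ε (F.slopeDiv p T) l) :
    (F.transformDatum T S ε coef').IsMonomialCase p (T.blowup S G b ε) where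
  pos_injOn := hB.injOn_pos
  pos_ne := hB.pos_ne
  coef_free := hB.coef_free
  coef_order := by
    intro i hi
    refine natCast_lt_order_iff.2 fun u hu => ?_
    have hipos : (0 : ℚ) < i := by exact_mod_cast (Finset.mem_Icc.1 hi).1
    have h2 : (i : ℚ) < u.degree := by
      calc (i : ℚ) < (∑ l ∈ (T.blowup S G b ε).E,
            T.transformExponents S ε (F.slopeDiv p T) l) * i := by nlinarith
        _ = ∑ l ∈ (T.blowup S G b ε).E,
            T.transformExponents S ε (F.slopeDiv p T) l * i := by rw [Finset.sum_mul]
        _ ≤ ∑ l ∈ (T.blowup S G b ε).E, (u ((T.blowup S G b ε).pos l) : ℚ) :=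
            Finset.sum_le_sum fun l hl => hB.coef_le i hi u hu l hl
        _ ≤ u.degree := by exact_mod_cast sum_apply_le_degree hB.injOn_pos u
    exact_mod_cast h2
  h_mem := hB.h_mem
  a_pos := hB.isMonomialCase.a_pos
  M_mem := hB.M_mem
  lt_sum_m := by
    have ha : (0 : ℚ) < F.a := by exact_mod_cast hB.isMonomialCase.a_pos
    have h2 := h1.trans_le (Finset.sum_le_sum fun l _ => hB.transformExponents_le l)
    have h3 := mu_eq_sum_div (F := F.transformDatum T S ε coef') (T := T.blowup S G b ε)
    rw [mu] at h3
    rw [h3] at h2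
    have h4 : (F.transformDatum T S ε coef').a = F.a := rfl
    rw [h4, one_lt_div ha] at h2
    exact_mod_cast h2
  dvd_const := by
    intro i f hf c hc l hl
    obtain ⟨g, hg⟩ := hc.2 1
    rw [Finset.sum_range_one, pow_zero, mul_one, pow_one] at hg
    have h2 := hB.isWeier.X_pow_dvd_of_mem_span (hB.pos_ne l hl) (hc.1 0)
      (eq_add_of_sub_eq' hg) (hB.level_le_span i hl hf)
    have h3 : (((F.transformDatum T S ε coef').m l * i : ℕ) : ℚ) /
        (F.transformDatum T S ε coef').a = (F.transformDatum T S ε coef').muDiv l * i := by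
      rw [muDiv]
      push_cast
      ring
    rw [h3]
    exact h2
  hasse_mem := fun i f hf => hB.hasse_mem i hf

end IsBlowupData

end MonomialDatum

/-! ### Powers and initial forms -/

section InitialForm

variable {k : Type*} [Field k] {n : ℕ}

theorem not_exists_eq_pow (p : ℕ) [ExpChar k p] {f : CompletedRing k n} {e : ℕ}
    {s : Fin (n + 1) →₀ ℕ} (hs : coeff s f ≠ 0) {j : Fin (n + 1)} (hj : ¬ p ^ e ∣ s j) :
    ¬ ∃ g : CompletedRing k n, f = g ^ p ^ e := by
  rintro ⟨g, rfl⟩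
  obtain ⟨d, rfl, -⟩ := exists_of_coeff_pow_ne_zero p hs
  exact hj ⟨d j, rfl⟩

variable {f : CompletedRing k n} {d : Fin (n + 1) →₀ ℕ}

theorem order_eq_degree_of_le (hd : coeff d f ≠ 0) (hle : ∀ s, coeff s f ≠ 0 → d ≤ s) :
    f.order = d.degree :=
  le_antisymm (order_le hd) (natCast_le_order_iff.2 fun s hs => Finsupp.degree_mono (hle s hs))

theorem initialForm_eq_monomial (hd : coeff d f ≠ 0) (hle : ∀ s, coeff s f ≠ 0 → d ≤ s) :
    initialForm f = monomial d (coeff d f) := by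
  classical
  ext s
  rw [initialForm, order_eq_degree_of_le hd hle, ENat.toNat_natCast, coeff_homogeneousComponent,
    coeff_monomial]
  by_cases hsd : s = d
  · rw [hsd, if_pos rfl, if_pos rfl]
  rw [if_neg hsd]
  split_ifs with h
  · by_contra hs
    obtain ⟨t, rfl⟩ := exists_add_of_le (hle s hs)
    rw [map_add, Nat.add_eq_left, Finsupp.degree_eq_zero_iff] at h
    exact hsd (by rw [h, add_zero])
  · rfl

theorem exists_initialForm_eq_pow [IsAlgClosed k] {q : ℕ} (hq : 0 < q) (hd : coeff d f ≠ 0)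
    (hle : ∀ s, coeff s f ≠ 0 → d ≤ s) (hdvd : ∀ j, q ∣ d j) :
    ∃ g : CompletedRing k n, initialForm f = g ^ q := by
  obtain ⟨c, hc⟩ := IsAlgClosed.exists_pow_nat_eq (coeff d f) hq
  refine ⟨monomial (d.mapRange (· / q) (Nat.zero_div q)) c, ?_⟩
  have h : q • d.mapRange (· / q) (Nat.zero_div q) = d := by
    ext j
    rw [Finsupp.smul_apply, Finsupp.mapRange_apply, smul_eq_mul, Nat.mul_div_cancel' (hdvd j)]
  rw [initialForm_eq_monomial hd hle, monomial_pow, hc, h]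

theorem divOrder_eq_of_le (hd : coeff d f ≠ 0) (hle : ∀ s, coeff s f ≠ 0 → d ≤ s)
    (i : Fin (n + 1)) : divOrder i f = d i :=
  MonomialDatum.divOrder_eq_of_forall (fun s hs => hle s hs i) ⟨d, hd, rfl⟩

theorem coeff_divInitialForm_ne_zero (hd : coeff d f ≠ 0) (hle : ∀ s, coeff s f ≠ 0 → d ≤ s)
    (i : Fin (n + 1)) : coeff d (divInitialForm i f) ≠ 0 := by
  have h : coeff d (divInitialForm i f) = coeff d f := if_pos (divOrder_eq_of_le hd hle i).symm
  rwa [h]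

theorem coeff_unit_mul_monomial {u : CompletedRing k n} (hu : IsUnit u) (d : Fin (n + 1) →₀ ℕ) :
    coeff d (u * monomial d 1) ≠ 0 ∧ ∀ s, coeff s (u * monomial d 1) ≠ 0 → d ≤ s := by
  classical
  constructor
  · have h := coeff_add_mul_monomial 0 d u (1 : k)
    rw [zero_add, mul_one] at h
    rw [h, coeff_zero_eq_constantCoeff_apply]
    exact (MvPowerSeries.isUnit_iff_constantCoeff.1 hu).ne_zero
  · intro s hs
    rw [coeff_mul_monomial] at hs
    by_contra h
    exact hs (if_neg h)

end InitialForm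

namespace MonomialDatum

/-! ### Exponents not divisible by q -/

section Divisibility

variable {k : Type*} [Field k] [IsAlgClosed k] {n : ℕ} {Λ : Type*} {p : ℕ}
variable {T : Triplet k n Λ} {F : MonomialDatum k n Λ}

/-- Outside Type II the slope at P is not μ(P), so the initial form of a_q is not a q-th power. It
is a constant times a monomial, and constants have q-th roots, so some exponent must be responsible.
-/
theorem WellAdaptedAtPoint.exists_not_dvd (hwa : F.WellAdaptedAtPoint p T) (hq : 0 < p ^ F.e)
    (ht : F.IsTight p T) (hII : ¬ F.TypeII p T) {r : Λ → ℕ}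
    {u : CompletedRing k n} (hu : IsUnit u)
    (hlast : F.last p = u * ∏ l ∈ T.E, X (T.pos l) ^ r l) : ∃ l ∈ T.E, ¬ p ^ F.e ∣ r l := by
  by_contra! hdvd
  obtain h | ⟨-, h⟩ := hwa
  · rw [isTight_iff_slope_eq.1 ht] at h
    exact hII h.symm
  · rw [prod_X_pow_eq_monomial] at hlast
    obtain ⟨h1, h2⟩ := coeff_unit_mul_monomial hu (∑ l ∈ T.E, Finsupp.single (T.pos l) (r l))
    rw [← hlast] at h1 h2
    refine h (exists_initialForm_eq_pow hq h1 h2 fun j => ?_)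
    rw [Finsupp.finsetSum_apply]
    refine Finset.dvd_sum fun l hl => ?_
    rw [Finsupp.single_apply]
    split_ifs
    · exact hdvd l hl
    · exact dvd_zero _

end Divisibility

/-! ### The exponents of the transformed tight monomial -/

namespace IsBlowupData

variable {k : Type*} [Field k] {n : ℕ} {Λ : Type*} [LinearOrder Λ]
variable {p : ℕ} {T : Triplet k n Λ} {F : MonomialDatum k n Λ} {s : Finset Λ}
  {S : Finset (Fin (n + 1))} {G : Fin (n + 1)} {b : Fin (n + 1) → k} {ε : Λ}
  {coef' : ℕ → CompletedRing k n}

theorem mem_blowup_E (_hB : IsBlowupData p T F s S G b ε coef') : ε ∈ (T.blowup S G b ε).E := by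
  rw [Triplet.blowup_E]
  exact Finset.mem_insert_self _ _

theorem mem_of_mem_blowup_E (_hB : IsBlowupData p T F s S G b ε coef') {l : Λ}
    (hl : l ∈ (T.blowup S G b ε).E) (hlε : l ≠ ε) : l ∈ T.E := by
  rw [Triplet.blowup_E] at hl
  exact (Triplet.mem_strictE.1 (Finset.mem_of_mem_insert_of_ne hl hlε)).1

theorem mem_blowup_E_of_notMem (hB : IsBlowupData p T F s S G b ε coef') {l : Λ} (hl : l ∈ T.E)
    (hls : l ∉ s) : l ∈ (T.blowup S G b ε).E := by
  rw [Triplet.blowup_E]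
  exact Finset.mem_insert_of_mem (hB.mem_strictE_of_notMem hl hls)

theorem transformExponents_exceptional (hB : IsBlowupData p T F s S G b ε coef') (κ : Λ → ℚ) :
    T.transformExponents S ε κ ε = ∑ l ∈ s, κ l - 1 := by
  rw [Triplet.transformExponents_self, hB.filter_eq]

theorem transformExponents_congr (hB : IsBlowupData p T F s S G b ε coef') {κ κ' : Λ → ℚ}
    (h : ∀ l ∈ T.E, κ l = κ' l) {l : Λ} (hl : l ∈ (T.blowup S G b ε).E) :
    T.transformExponents S ε κ l = T.transformExponents S ε κ' l := by
  by_cases hlε : l = ε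
  · subst hlε
    rw [hB.transformExponents_exceptional, hB.transformExponents_exceptional,
      Finset.sum_congr rfl fun l hl => h l (hB.isGammaMax.subset hl)]
  · rw [Triplet.transformExponents_of_ne hlε, Triplet.transformExponents_of_ne hlε,
      h l (hB.mem_of_mem_blowup_E hl hlε)]

theorem transformExponents_eq_muDiv (hB : IsBlowupData p T F s S G b ε coef')
    (hII : F.TypeII p T) {l : Λ} (hl : l ∈ (T.blowup S G b ε).E) :
    T.transformExponents S ε (F.slopeDiv p T) l = (F.transformDatum T S ε coef').muDiv l := by
  rw [hB.muDiv_transformDatum]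
  exact hB.transformExponents_congr (IsMonomialCase.typeII_iff_forall.1 hII) hl

section TypeI

variable {r : Λ → ℕ}

theorem pow_le_sum (hB : IsBlowupData p T F s S G b ε coef')
    (hr : ∀ l ∈ T.E, F.slopeDiv p T l * (p ^ F.e : ℕ) = r l) : p ^ F.e ≤ ∑ l ∈ s, r l := by
  have h1 : ((∑ l ∈ s, r l : ℕ) : ℚ) = (∑ l ∈ s, F.slopeDiv p T l) * (p ^ F.e : ℕ) := by
    rw [Finset.sum_mul, Nat.cast_sum]
    exact Finset.sum_congr rfl fun l hl => (hr l (hB.isGammaMax.subset hl)).symm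
  have h2 : ((p ^ F.e : ℕ) : ℚ) ≤ (∑ l ∈ s, F.slopeDiv p T l) * (p ^ F.e : ℕ) :=
    le_mul_of_one_le_left (Nat.cast_nonneg _) hB.isGammaMax.one_le
  rw [← h1] at h2
  exact_mod_cast h2

theorem transformNat_exceptional (hB : IsBlowupData p T F s S G b ε coef') (c : ℕ) :
    T.transformNat S ε r c ε = ∑ l ∈ s, r l - c := by
  rw [Triplet.transformNat, Function.update_self, hB.filter_eq]

theorem transformNat_of_ne (_hB : IsBlowupData p T F s S G b ε coef') {c : ℕ} {l : Λ}
    (hl : l ≠ ε) : T.transformNat S ε r c l = r l :=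
  Function.update_of_ne hl _ _

theorem transformExponents_mul_eq (hB : IsBlowupData p T F s S G b ε coef')
    (hr : ∀ l ∈ T.E, F.slopeDiv p T l * (p ^ F.e : ℕ) = r l) {l : Λ}
    (hl : l ∈ (T.blowup S G b ε).E) :
    T.transformExponents S ε (F.slopeDiv p T) l * (p ^ F.e : ℕ) =
      T.transformNat S ε r (p ^ F.e) l := by
  by_cases hlε : l = ε
  · subst hlε
    rw [hB.transformExponents_exceptional, hB.transformNat_exceptional,
      Nat.cast_sub (hB.pow_le_sum hr), sub_mul, one_mul, Finset.sum_mul, Nat.cast_sum]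
    congr 1
    exact Finset.sum_congr rfl fun l hl => hr l (hB.isGammaMax.subset hl)
  · rw [Triplet.transformExponents_of_ne hlε, hB.transformNat_of_ne hlε]
    exact hr l (hB.mem_of_mem_blowup_E hl hlε)

theorem exists_unit_coef (hB : IsBlowupData p T F s S G b ε coef')
    (hr : ∀ l ∈ T.E, F.slopeDiv p T l * (p ^ F.e : ℕ) = r l) {u : CompletedRing k n}
    (hu : IsUnit u) (hlast : F.last p = u * ∏ l ∈ T.E, X (T.pos l) ^ r l) :
    ∃ v : CompletedRing k n, IsUnit v ∧ coef' (p ^ F.e) =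
      v * ∏ l ∈ (T.blowup S G b ε).E,
        X ((T.blowup S G b ε).pos l) ^ T.transformNat S ε r (p ^ F.e) l := by
  obtain ⟨w, hw, he⟩ := Triplet.blowupHom_prod (S := S) (G := G) (b := b) hB.notMem (r := r)
    (c := p ^ F.e) (by
      rw [hB.filter_eq]
      exact hB.pow_le_sum hr)
  refine ⟨blowupHom S G b u * w, (hu.map (blowupHom S G b)).mul hw, ?_⟩
  refine mul_left_cancel₀ (X_pow_ne_zero (k := k) G (p ^ F.e)) ?_
  rw [← hB.coef_eq _ (Finset.mem_Icc.2 ⟨hB.pow_pos, le_rfl⟩)]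
  change blowupHom S G b (F.last p) = _
  rw [hlast, map_mul, he]
  ring

/-- If the centre lies in several components of s, minimality makes every old H, and hence every new
exponent of a_q divided by q, less than 1; divisibility by q would make all of them 0, against total
degree at least q. If s has one element, its exponent just decreases by q. -/
theorem exists_not_dvd_transformNat (hB : IsBlowupData p T F s S G b ε coef')
    (hr : ∀ l ∈ T.E, F.slopeDiv p T l * (p ^ F.e : ℕ) = r l)
    (hdvd : ∃ l ∈ T.E, ¬ p ^ F.e ∣ r l)
    (hle : p ^ F.e ≤ ∑ l ∈ (T.blowup S G b ε).E, T.transformNat S ε r (p ^ F.e) l) :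
    ∃ l ∈ (T.blowup S G b ε).E, ¬ p ^ F.e ∣ T.transformNat S ε r (p ^ F.e) l := by
  have hqpos := hB.pow_pos
  have hq : (0 : ℚ) < (p ^ F.e : ℕ) := by exact_mod_cast hqpos
  obtain ⟨l₁, hl₁⟩ := hB.isGammaMax.nonempty
  obtain hcard | hcard := Nat.lt_or_ge 1 s.card
  · by_contra! hall
    have hlt : ∀ l ∈ T.E, F.slopeDiv p T l < 1 := by
      intro l hl
      have := hB.isGammaMax.sum_lt_one (t := {l}) (Finset.singleton_subset_iff.2 hl) (by
        rwa [Finset.card_singleton])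
      rwa [Finset.sum_singleton] at this
    have hzero : ∀ l ∈ (T.blowup S G b ε).E, T.transformNat S ε r (p ^ F.e) l = 0 := by
      intro l hl
      refine Nat.eq_zero_of_dvd_of_lt (hall l hl) ?_
      have h1 : T.transformExponents S ε (F.slopeDiv p T) l < 1 := by
        by_cases hlε : l = ε
        · subst hlε
          rw [hB.transformExponents_exceptional]
          exact (hB.isGammaMax.sum_sub_one_lt hl₁).trans (hlt l₁ (hB.isGammaMax.subset hl₁))
        · rw [Triplet.transformExponents_of_ne hlε]
          exact hlt l (hB.mem_of_mem_blowup_E hl hlε)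
      have h2 := mul_lt_mul_of_pos_right h1 hq
      rw [hB.transformExponents_mul_eq hr hl, one_mul] at h2
      exact_mod_cast h2
    rw [Finset.sum_eq_zero hzero] at hle
    omega
  · have hs : s = {l₁} :=
      (Finset.eq_of_subset_of_card_le (Finset.singleton_subset_iff.2 hl₁) (by
        rwa [Finset.card_singleton])).symm
    obtain ⟨l, hl, hld⟩ := hdvd
    by_cases hls : l ∈ s
    · refine ⟨ε, hB.mem_blowup_E, ?_⟩
      have h1 := hB.pow_le_sum hr
      rw [hs, Finset.mem_singleton] at hls
      rw [hB.transformNat_exceptional]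
      rw [hs, Finset.sum_singleton] at h1 ⊢
      rw [← hls] at h1 ⊢
      exact fun h => hld ((Nat.dvd_sub_iff_left h1 dvd_rfl).1 h)
    · refine ⟨l, hB.mem_blowup_E_of_notMem hl hls, ?_⟩
      rwa [hB.transformNat_of_ne fun h => hB.notMem (h ▸ hl)]

end TypeI

/-! ### The order of the transformed tight monomial when σ does not drop -/

section Singular

theorem coeff_h_single_zero (hB : IsBlowupData p T F s S G b ε coef') :
    coeff (Finsupp.single 0 (p ^ F.e)) ((F.transformDatum T S ε coef').h p) = 1 :=
  coeff_h_single (F := F.transformDatum T S ε coef') hB.coef_free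

variable [ExpChar k p]

/-- The sum is the order of the new M divided by a, and is at least 1 by singularity. If it were 1,
M would be a leading monomial free of x_1 at level a. -/
theorem one_lt_sum_of_typeII (hB : IsBlowupData p T F s S G b ε coef')
    (hsing : (T.blowup S G b ε).IsSingular)
    (hnd : ¬ (T.blowup S G b ε).R.sigma p <
      toLex (IdealisticFiltration.sigmaRef n p (p ^ F.e))) (hII : F.TypeII p T) :
    1 < ∑ l ∈ (T.blowup S G b ε).E, T.transformExponents S ε (F.slopeDiv p T) l := by
  set F' := F.transformDatum T S ε coef'
  set D : Fin (n + 1) →₀ ℕ := ∑ l ∈ (T.blowup S G b ε).E,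
    Finsupp.single ((T.blowup S G b ε).pos l) (F'.m l)
  have hDdeg : D.degree = ∑ l ∈ (T.blowup S G b ε).E, F'.m l := degree_sum_single _ _ _
  have hD : coeff D (F'.M (T.blowup S G b ε)) ≠ 0 := by
    rw [M_eq_monomial, coeff_monomial_same]
    exact one_ne_zero
  have hR : ∀ i, ∀ f ∈ (T.blowup S G b ε).R.level i, ∀ s, coeff s f ≠ 0 → i ≤ s.degree :=
    fun i f hf s hs => Triplet.degree_ge_of_isSingular hsing hf hs
  have hle := hR _ _ hB.M_mem _ hD
  have ha : (0 : ℚ) < F.a := by exact_mod_cast hB.isMonomialCase.a_pos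
  have hsum : ∑ l ∈ (T.blowup S G b ε).E, T.transformExponents S ε (F.slopeDiv p T) l =
      (D.degree : ℚ) / F.a := by
    rw [Finset.sum_congr rfl fun l hl => hB.transformExponents_eq_muDiv hII hl, hDdeg]
    exact mu_eq_sum_div (F := F') (T := T.blowup S G b ε)
  rw [hsum, one_lt_div ha, Nat.cast_lt]
  refine lt_of_le_of_ne hle fun heq => ?_
  refine IdealisticFiltration.false_of_monomial_leading_form hR hnd hB.h_mem
    hB.coeff_h_single_zero hB.isMonomialCase.a_pos hB.M_mem ?_ heq.symm hD
    fun s' _ hs' => coeff_M_ne_zero hs'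
  exact sum_single_apply_of_notMem hB.pos_ne

/-- The leading monomial of the new a_q occurs in the new h, so singularity gives degree at least q.
In degree exactly q it would be a pure q-th power, since σ does not drop, but one of its exponents
is not divisible by q. -/
theorem typeI_transform (hB : IsBlowupData p T F s S G b ε coef')
    (hsing : (T.blowup S G b ε).IsSingular)
    (hnd : ¬ (T.blowup S G b ε).R.sigma p <
      toLex (IdealisticFiltration.sigmaRef n p (p ^ F.e))) {r : Λ → ℕ}
    (hr : ∀ l ∈ T.E, F.slopeDiv p T l * (p ^ F.e : ℕ) = r l) {u : CompletedRing k n}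
    (hu : IsUnit u) (hlast : F.last p = u * ∏ l ∈ T.E, X (T.pos l) ^ r l)
    (hdvd : ∃ l ∈ T.E, ¬ p ^ F.e ∣ r l) :
    (∃ l ∈ (T.blowup S G b ε).E, ¬ p ^ F.e ∣ T.transformNat S ε r (p ^ F.e) l) ∧
    1 < ∑ l ∈ (T.blowup S G b ε).E, T.transformExponents S ε (F.slopeDiv p T) l := by
  set F' := F.transformDatum T S ε coef'
  set D : Fin (n + 1) →₀ ℕ := ∑ l ∈ (T.blowup S G b ε).E,
    Finsupp.single ((T.blowup S G b ε).pos l) (T.transformNat S ε r (p ^ F.e) l) with hDdef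
  have hDdeg : D.degree = ∑ l ∈ (T.blowup S G b ε).E, T.transformNat S ε r (p ^ F.e) l :=
    degree_sum_single _ _ _
  have hq : (0 : ℚ) < (p ^ F.e : ℕ) := by exact_mod_cast hB.pow_pos
  have hmem : p ^ F.e ∈ Finset.Icc 1 (p ^ F.e) := Finset.mem_Icc.2 ⟨hB.pow_pos, le_rfl⟩
  obtain ⟨v, hv, hcoef⟩ := hB.exists_unit_coef hr hu hlast
  rw [prod_X_pow_eq_monomial] at hcoef
  have hD : coeff D (F'.h p) ≠ 0 := by
    have h1 := coeff_h_add_single (F := F') hB.coef_free hmem (u := D)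
      (sum_single_apply_of_notMem hB.pos_ne)
    have h2 : p ^ F'.e - p ^ F.e = 0 := Nat.sub_self _
    rw [h2, Finsupp.single_zero, add_zero] at h1
    rw [h1]
    change coeff D (coef' (p ^ F.e)) ≠ 0
    rw [hcoef]
    exact (coeff_unit_mul_monomial hv D).1
  have hR : ∀ i, ∀ f ∈ (T.blowup S G b ε).R.level i, ∀ s, coeff s f ≠ 0 → i ≤ s.degree :=
    fun i f hf s hs => Triplet.degree_ge_of_isSingular hsing hf hs
  have hle := hR _ _ hB.h_mem _ hD
  have hnot := hB.exists_not_dvd_transformNat hr hdvd (hDdeg ▸ hle)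
  refine ⟨hnot, ?_⟩
  have hlt : p ^ F.e < D.degree := by
    refine lt_of_le_of_ne hle fun heq => ?_
    obtain ⟨t, ht⟩ := IdealisticFiltration.exists_single_of_not_sigma_lt hR hnd hB.h_mem
      heq.symm hD
    obtain ⟨l, hl, hld⟩ := hnot
    refine hld ?_
    have h1 : D ((T.blowup S G b ε).pos l) = T.transformNat S ε r (p ^ F.e) l :=
      sum_single_apply_of_injOn hB.injOn_pos hl
    rw [← h1, ht, Finsupp.single_apply]
    split_ifs
    · exact dvd_rfl
    · exact dvd_zero _
  rw [← mul_lt_mul_iff_of_pos_right hq, one_mul, Finset.sum_mul,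
    Finset.sum_congr rfl fun l hl => hB.transformExponents_mul_eq hr hl, ← Nat.cast_sum, ← hDdeg]
  exact_mod_cast hlt

end Singular

end IsBlowupData

end MonomialDatum

namespace MonomialDatum

/-! ### Criteria for well-adaptedness -/

section WellAdapted

variable {k : Type*} [Field k] {n : ℕ} {Λ : Type*} {p : ℕ}
variable {T : Triplet k n Λ} {F : MonomialDatum k n Λ}

theorem wellAdapted_of_typeII (ht : F.IsTight p T) (hII : F.TypeII p T) : F.WellAdapted p T :=
  ⟨Or.inl ((isTight_iff_slope_eq.1 ht).trans hII.symm),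
    fun l hl => Or.inl (IsMonomialCase.typeII_iff_forall.1 hII l hl)⟩

theorem slope_eq_mu_or_lt : F.slope p T = F.mu T ∨
    ordQuot (F.last p).order (p ^ F.e) < (F.mu T : WithTop ℚ) := by
  refine (le_or_gt (F.mu T : WithTop ℚ) _).imp_left fun h => ?_
  rw [← WithTop.coe_inj, coe_slope, min_eq_right h]

theorem slopeDiv_eq_muDiv_or_lt (l : Λ) : F.slopeDiv p T l = F.muDiv l ∨
    ordQuot (divOrder (T.pos l) (F.last p)) (p ^ F.e) < (F.muDiv l : WithTop ℚ) := by
  refine (le_or_gt (F.muDiv l : WithTop ℚ) _).imp_left fun h => ?_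
  rw [← WithTop.coe_inj, coe_slopeDiv, min_eq_right h]

/-- The least monomial of a_q occurs in the initial forms at P and along every component, so a
single exponent not divisible by q serves at all these points. -/
theorem wellAdapted_of_not_dvd [ExpChar k p] {d : Fin (n + 1) →₀ ℕ}
    (hd : coeff d (F.last p) ≠ 0) (hle : ∀ s, coeff s (F.last p) ≠ 0 → d ≤ s) {j : Fin (n + 1)}
    (hj : ¬ p ^ F.e ∣ d j) : F.WellAdapted p T := by
  refine ⟨slope_eq_mu_or_lt.imp_right fun h => ⟨h, not_exists_eq_pow p (s := d) ?_ hj⟩,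
    fun l _ => (slopeDiv_eq_muDiv_or_lt l).imp_right fun h =>
      ⟨h, not_exists_eq_pow p (coeff_divInitialForm_ne_zero hd hle _) hj⟩⟩
  rwa [initialForm_eq_monomial hd hle, coeff_monomial_same]

end WellAdapted

section Step

variable {k : Type*} [Field k] {n : ℕ} {Λ : Type*} [LinearOrder Λ]
variable {p : ℕ} {T : Triplet k n Λ} {F : MonomialDatum k n Λ} {s : Finset Λ}
  {S : Finset (Fin (n + 1))} {G : Fin (n + 1)} {b : Fin (n + 1) → k} {ε : Λ}
  {coef' : ℕ → CompletedRing k n}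

namespace IsBlowupData

theorem slopeDiv_eq (hB : IsBlowupData p T F s S G b ε coef') {l : Λ}
    (hl : l ∈ (T.blowup S G b ε).E)
    (h : T.transformExponents S ε (F.slopeDiv p T) l = (F.transformDatum T S ε coef').muDiv l ∨
      ∃ u, coeff u (coef' (p ^ F.e)) ≠ 0 ∧ (u ((T.blowup S G b ε).pos l) : ℚ) =
        T.transformExponents S ε (F.slopeDiv p T) l * (p ^ F.e : ℕ)) :
    (F.transformDatum T S ε coef').slopeDiv p (T.blowup S G b ε) l =
      T.transformExponents S ε (F.slopeDiv p T) l :=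
  slopeDiv_eq_of_forall (F := F.transformDatum T S ε coef') hB.pow_pos
    (hB.transformExponents_le l)
    (fun u hu => hB.coef_le _ (Finset.mem_Icc.2 ⟨hB.pow_pos, le_rfl⟩) u hu l hl) h

variable [IsAlgClosed k] [ExpChar k p]

/-- The transform is again well-adapted and tight, of the same type, if `σ` does not drop. -/
theorem transform_tight (hB : IsBlowupData p T F s S G b ε coef')
    (hwa : F.WellAdaptedAtPoint p T) (ht : F.IsTight p T)
    (hsing : (T.blowup S G b ε).IsSingular)
    (hnd : ¬ (T.blowup S G b ε).R.sigma p <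
      toLex (IdealisticFiltration.sigmaRef n p (p ^ F.e))) :
    (F.transformDatum T S ε coef').IsMonomialCase p (T.blowup S G b ε) ∧
    (F.transformDatum T S ε coef').WellAdapted p (T.blowup S G b ε) ∧
    (F.transformDatum T S ε coef').IsTight p (T.blowup S G b ε) ∧
    (F.TypeI p T → (F.transformDatum T S ε coef').TypeI p (T.blowup S G b ε)) ∧
    (F.TypeII p T → (F.transformDatum T S ε coef').TypeII p (T.blowup S G b ε)) ∧
    (∀ l ∈ (T.blowup S G b ε).E,
      (F.transformDatum T S ε coef').slopeDiv p (T.blowup S G b ε) l =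
        T.transformExponents S ε (F.slopeDiv p T) l) ∧
    1 < (F.transformDatum T S ε coef').ordTight p (T.blowup S G b ε) := by
  have hF := hB.isMonomialCase
  have hq : 0 < p ^ (F.transformDatum T S ε coef').e := hB.pow_pos
  have hII' : F.TypeII p T →
      (∀ l ∈ (T.blowup S G b ε).E,
        (F.transformDatum T S ε coef').slopeDiv p (T.blowup S G b ε) l =
          T.transformExponents S ε (F.slopeDiv p T) l) ∧
      (F.transformDatum T S ε coef').TypeII p (T.blowup S G b ε) := by
    intro hII
    have h : ∀ l ∈ (T.blowup S G b ε).E,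
        (F.transformDatum T S ε coef').slopeDiv p (T.blowup S G b ε) l =
          T.transformExponents S ε (F.slopeDiv p T) l := fun l hl =>
      hB.slopeDiv_eq hl (Or.inl (hB.transformExponents_eq_muDiv hII hl))
    exact ⟨h, IsMonomialCase.typeII_iff_forall.2 fun l hl =>
      (h l hl).trans (hB.transformExponents_eq_muDiv hII hl)⟩
  have hI' : ∀ {r : Λ → ℕ} {u : CompletedRing k n},
      (∀ l ∈ T.E, F.slopeDiv p T l * (p ^ F.e : ℕ) = r l) → IsUnit u →
      F.last p = u * ∏ l ∈ T.E, X (T.pos l) ^ r l →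
      ∃ D : Fin (n + 1) →₀ ℕ, coeff D ((F.transformDatum T S ε coef').last p) ≠ 0 ∧
        (∀ t, coeff t ((F.transformDatum T S ε coef').last p) ≠ 0 → D ≤ t) ∧
        (∀ l ∈ (T.blowup S G b ε).E,
          D ((T.blowup S G b ε).pos l) = T.transformNat S ε r (p ^ F.e) l) ∧
        (∀ l ∈ (T.blowup S G b ε).E,
          (F.transformDatum T S ε coef').slopeDiv p (T.blowup S G b ε) l =
            T.transformExponents S ε (F.slopeDiv p T) l) ∧
        (1 < ∑ l ∈ (T.blowup S G b ε).E, T.transformExponents S ε (F.slopeDiv p T) l →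
          (F.transformDatum T S ε coef').TypeI p (T.blowup S G b ε)) := by
    intro r u hr hu hlast
    obtain ⟨v, hv, hcoef⟩ := hB.exists_unit_coef hr hu hlast
    have hcoef' := hcoef
    rw [prod_X_pow_eq_monomial] at hcoef'
    set D : Fin (n + 1) →₀ ℕ := ∑ l ∈ (T.blowup S G b ε).E,
      Finsupp.single ((T.blowup S G b ε).pos l) (T.transformNat S ε r (p ^ F.e) l)
    obtain ⟨hD, hle⟩ := coeff_unit_mul_monomial hv D
    rw [← hcoef'] at hD hle
    have hDl : ∀ l ∈ (T.blowup S G b ε).E,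
        D ((T.blowup S G b ε).pos l) = T.transformNat S ε r (p ^ F.e) l :=
      fun l hl => sum_single_apply_of_injOn hB.injOn_pos hl
    have hslope : ∀ l ∈ (T.blowup S G b ε).E,
        (F.transformDatum T S ε coef').slopeDiv p (T.blowup S G b ε) l =
          T.transformExponents S ε (F.slopeDiv p T) l := fun l hl =>
      hB.slopeDiv_eq hl (Or.inr ⟨D, hD, by rw [hDl l hl, hB.transformExponents_mul_eq hr hl]⟩)
    refine ⟨D, hD, hle, hDl, hslope, fun h1 => ?_⟩
    refine ((hB.isMonomialCase_blowup h1).typeI_iff hq).2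
      ⟨T.transformNat S ε r (p ^ F.e), fun l hl => ⟨?_, ?_⟩, v, hv, hcoef⟩
    · rw [hslope l hl]
      exact hB.transformExponents_mul_eq hr hl
    · rw [← hDl l hl]
      exact divOrder_eq_of_le hD hle _
  -- Type II is separated off even if Type I holds as well: all exponents of a_q may then be
  -- divisible by q, and well-adaptedness rests on the slopes being equal to μ.
  by_cases hII : F.TypeII p T
  · obtain ⟨hslope, hII''⟩ := hII' hII
    have h1 := hB.one_lt_sum_of_typeII hsing hnd hII
    have hF' := hB.isMonomialCase_blowup h1
    have ht' := (hF'.isTight_iff hq).2 (Or.inr hII'')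
    refine ⟨hF', wellAdapted_of_typeII ht' hII'', ht', fun hI => ?_, fun _ => hII'', hslope,
      h1.trans_eq (Finset.sum_congr rfl hslope).symm⟩
    obtain ⟨r, hr, u, hu, hlast⟩ := (hF.typeI_iff hB.pow_pos).1 hI
    obtain ⟨-, -, -, -, -, h⟩ := hI' (fun l hl => (hr l hl).1) hu hlast
    exact h h1
  · have hI := ((hF.isTight_iff hB.pow_pos).1 ht).resolve_right hII
    obtain ⟨r, hr, u, hu, hlast⟩ := (hF.typeI_iff hB.pow_pos).1 hI
    obtain ⟨⟨l, hl, hld⟩, h1⟩ := hB.typeI_transform hsing hnd (fun l hl => (hr l hl).1) hu hlast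
      (hwa.exists_not_dvd hB.pow_pos ht hII hu hlast)
    obtain ⟨D, hD, hle, hDl, hslope, hI''⟩ := hI' (fun l hl => (hr l hl).1) hu hlast
    have hF' := hB.isMonomialCase_blowup h1
    refine ⟨hF', wellAdapted_of_not_dvd (j := (T.blowup S G b ε).pos l) hD hle (by
        rw [hDl l hl]
        exact hld), (hF'.isTight_iff hq).2 (Or.inl (hI'' h1)), fun _ => hI'' h1,
      fun h => absurd h hII, hslope, h1.trans_eq (Finset.sum_congr rfl hslope).symm⟩

end IsBlowupData

variable [IsAlgClosed k] [ExpChar k p]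

/-- The behaviour of a well-adapted tight monomial case under the blow-up along the centre. -/
theorem IsMonomialCase.exists_transform (hF : F.IsMonomialCase p T)
    (hwa : F.WellAdaptedAtPoint p T) (ht : F.IsTight p T)
    (hS : T.IsCenter (F.slopeDiv p T) S) (hG : G ∈ S) (hε : ε ∉ T.E)
    (hsing : (T.blowup S G b ε).IsSingular)
    (hnd : ¬ (T.blowup S G b ε).R.sigma p < T.R.sigma p) :
    (T.blowup S G b ε).R.sigma p = T.R.sigma p ∧
    ∃ F' : MonomialDatum k n Λ,
      F'.IsMonomialCase p (T.blowup S G b ε) ∧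
      F'.WellAdapted p (T.blowup S G b ε) ∧
      F'.e = F.e ∧ MvPowerSeries.X G ^ p ^ F.e * F'.h p = blowupHom S G b (F.h p) ∧
      F'.a = F.a ∧ Associated (MvPowerSeries.X G ^ F.a * F'.M (T.blowup S G b ε))
        (blowupHom S G b (F.M T)) ∧
      F'.IsTight p (T.blowup S G b ε) ∧
      (F.TypeI p T → F'.TypeI p (T.blowup S G b ε)) ∧
      (F.TypeII p T → F'.TypeII p (T.blowup S G b ε)) ∧
      (∀ l ∈ (T.blowup S G b ε).E, F'.slopeDiv p (T.blowup S G b ε) l =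
        T.transformExponents S ε (F.slopeDiv p T) l) ∧
      (T.blowup S G b ε).gamma (F'.slopeDiv p (T.blowup S G b ε))
          (IsLocalRing.closedPoint (CompletedRing k n)) <
        T.gamma (F.slopeDiv p T) (IsLocalRing.closedPoint (CompletedRing k n)) := by
  have hq : 0 < p ^ F.e := pow_pos (expChar_pos k p) _
  have h1 := hF.one_lt_ordTight hq ht
  obtain ⟨s, hs⟩ := exists_isGammaMax h1.le
  obtain ⟨coef', hB⟩ := hF.exists_isBlowupData hq h1 hs (hF.eq_centreIndices hq hs hS) hG hε hsing
  have hσ := hF.sigma_eq h1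
  -- Since σ at P is the reference value, the absence of a drop is measured against it, and the
  -- transform, being again tight, takes the same value.
  rw [hσ] at hnd
  obtain ⟨hF', hwa', ht', hI, hII, hslope, h1'⟩ := hB.transform_tight hwa ht hsing hnd
  obtain ⟨u, hu, hM⟩ := hB.exists_unit_M
  refine ⟨(hF'.sigma_eq h1').trans hσ.symm, F.transformDatum T S ε coef', hF', hwa', rfl,
    hB.X_pow_mul_h, rfl, ⟨hu.unit, ?_⟩, ht', hI, hII, hslope, ?_⟩
  · rw [hM, IsUnit.unit_spec]
    ring
  · rw [Triplet.gamma_closedPoint hs]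
    refine Triplet.gamma_lt_of_forall (fun t htE h => ?_) _
    refine hs.gammaKey_lt (ε := ε) ?_ hB.not_subset (fun l hl hlε => ?_) ?_ htE h
    · intro l hl
      by_cases hlε : l = ε
      · exact Finset.mem_insert.2 (Or.inl hlε)
      · exact Finset.mem_insert_of_mem (hB.mem_of_mem_blowup_E hl hlε)
    · rw [hslope l hl, Triplet.transformExponents_of_ne hlε]
    · rw [hslope ε hB.mem_blowup_E, hB.transformExponents_exceptional]

end Step

end MonomialDatum

/-! ### Termination -/

namespace MonomialDatum.IsMonomialCase

variable {k : Type*} [Field k] {n : ℕ} {Λ : Type*} {p : ℕ}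
variable {T : Triplet k n Λ} {F : MonomialDatum k n Λ}

theorem card_le (hF : F.IsMonomialCase p T) : T.E.card ≤ n + 1 := by
  have h := Finset.card_le_card_of_injOn T.pos (fun l _ => Finset.mem_univ _) hF.pos_injOn
  rwa [Finset.card_univ, Fintype.card_fin] at h

theorem exists_common_denominator (E : Finset Λ) (H : Λ → ℚ) :
    ∃ D : ℕ, 0 < D ∧ ∀ l ∈ E, ∃ z : ℤ, D * H l = z := by
  refine ⟨∏ l ∈ E, (H l).den, Finset.prod_pos fun l _ => (H l).den_pos, fun l hl => ?_⟩
  obtain ⟨c, hc⟩ := Finset.dvd_prod_of_mem (fun l => (H l).den) hl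
  refine ⟨c * (H l).num, ?_⟩
  rw [hc]
  push_cast
  rw [mul_comm ((H l).den : ℚ), mul_assoc, Rat.den_mul_eq_num]

variable [LinearOrder Λ] [IsAlgClosed k] [ExpChar k p]
variable {T' : Triplet k n Λ} {F' : MonomialDatum k n Λ}

/-- The datum F' at the new point is arbitrary. Its slopes and its tightness agree with those of the
constructed transform by independence of the choice of h and M. The new exponents are integral
combinations of the old ones and 1, so the denominator D persists. -/
theorem step_tight (hF : F.IsMonomialCase p T) (hwa : F.WellAdaptedAtPoint p T)
    (ht : F.IsTight p T) (hF' : F'.IsMonomialCase p T') (hstep : T.Step (F.slopeDiv p T) T')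
    (hnd : ¬ T'.R.sigma p < T.R.sigma p) {D : ℕ} (hD0 : 0 < D)
    (hD : ∀ l ∈ T.E, ∃ z : ℤ, D * F.slopeDiv p T l = z) :
    F'.IsTight p T' ∧ (∀ l ∈ T'.E, ∃ z : ℤ, D * F'.slopeDiv p T' l = z) ∧
    ∀ s s', IsGammaMax T.E (F.slopeDiv p T) s → IsGammaMax T'.E (F'.slopeDiv p T') s' →
      gammaMeasure (n + 1) D T'.E (F'.slopeDiv p T') s' <
        gammaMeasure (n + 1) D T.E (F.slopeDiv p T) s := by
  obtain ⟨S, G, b, ε, hS, hG, hε, rfl, hsing⟩ := hstep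
  have hp := expChar_pos k p
  have hq : 0 < p ^ F.e := pow_pos hp _
  obtain ⟨-, F₁, hF₁, -, -, -, -, -, ht₁, -, -, hslope₁, -⟩ :=
    hF.exists_transform hwa ht hS hG hε hsing hnd
  have h1 := hF.one_lt_ordTight hq ht
  have hslope : ∀ l ∈ (T.blowup S G b ε).E, F'.slopeDiv p (T.blowup S G b ε) l =
      T.transformExponents S ε (F.slopeDiv p T) l :=
    fun l hl => (hF₁.slopeDiv_eq hF' hp hl).trans (hslope₁ l hl)
  have hE : (T.blowup S G b ε).E ⊆ insert ε T.E := by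
    rw [Triplet.blowup_E]
    exact Finset.insert_subset_insert _ fun l hl => (Triplet.mem_strictE.1 hl).1
  have hD' : ∀ l ∈ (T.blowup S G b ε).E, ∃ z : ℤ,
      D * F'.slopeDiv p (T.blowup S G b ε) l = z := by
    intro l hl
    rw [hslope l hl]
    by_cases hlε : l = ε
    · subst hlε
      choose! z hz using hD
      refine ⟨∑ l ∈ T.E.filter (fun l => T.pos l ∈ S), z l - D, ?_⟩
      rw [Triplet.transformExponents_self, mul_sub, mul_one, Finset.mul_sum]
      push_cast
      congr 1
      exact Finset.sum_congr rfl fun l hl => hz l (Finset.mem_filter.1 hl).1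
    · rw [Triplet.transformExponents_of_ne hlε]
      exact hD l (Finset.mem_of_mem_insert_of_ne (hE hl) hlε)
  refine ⟨hF₁.isTight_of_isTight hF' hp ht₁, hD', fun s s' hs hs' => ?_⟩
  obtain ⟨coef', hB⟩ := hF.exists_isBlowupData hq h1 hs (hF.eq_centreIndices hq hs hS) hG hε hsing
  refine hs.gammaMeasure_lt hE hB.not_subset (fun l hl hlε => ?_) ?_ hs' hD0 hF'.card_le hD hD'
  · rw [hslope l hl, Triplet.transformExponents_of_ne hlε]
  · rw [hslope ε hB.mem_blowup_E, hB.transformExponents_exceptional]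

/-- There is no infinite sequence of blow-ups in which `σ` never drops. -/
theorem not_exists_infinite_sequence {Ts : ℕ → Triplet k n Λ} {Fs : ℕ → MonomialDatum k n Λ}
    (ht : (Fs 0).IsTight p (Ts 0))
    (h : ∀ i, (Fs i).IsMonomialCase p (Ts i) ∧ (Fs i).WellAdapted p (Ts i) ∧
      (Ts i).Step ((Fs i).slopeDiv p (Ts i)) (Ts (i + 1)) ∧
      ¬ (Ts (i + 1)).R.sigma p < (Ts i).R.sigma p) : False := by
  -- One denominator, chosen at the start, serves for the whole sequence, so all the measures are
  -- compared on the same scale.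
  obtain ⟨D, hD0, hD⟩ := exists_common_denominator (Ts 0).E ((Fs 0).slopeDiv p (Ts 0))
  have hall : ∀ i, (Fs i).IsTight p (Ts i) ∧
      ∀ l ∈ (Ts i).E, ∃ z : ℤ, D * (Fs i).slopeDiv p (Ts i) l = z := by
    intro i
    induction i with
    | zero => exact ⟨ht, hD⟩
    | succ i ih =>
      obtain ⟨h1, h2, -⟩ := (h i).1.step_tight (h i).2.1.1 ih.1 (h (i + 1)).1 (h i).2.2.1
        (h i).2.2.2 hD0 ih.2
      exact ⟨h1, h2⟩
  have hmax : ∀ i, ∃ s, IsGammaMax (Ts i).E ((Fs i).slopeDiv p (Ts i)) s := fun i =>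
    exists_isGammaMax ((h i).1.one_lt_ordTight (pow_pos (expChar_pos k p) _) (hall i).1).le
  choose s hs using hmax
  refine not_strictAnti_of_wellFoundedLT
    (fun i => gammaMeasure (n + 1) D (Ts i).E ((Fs i).slopeDiv p (Ts i)) (s i))
    (strictAnti_nat_of_succ_lt fun i => ?_)
  exact ((h i).1.step_tight (h i).2.1.1 (hall i).1 (h (i + 1)).1 (h i).2.2.1
    (h i).2.2.2 hD0 (hall i).2).2.2 _ _ (hs i) (hs (i + 1))

end MonomialDatum.IsMonomialCase

end

theorem proposition2 {k : Type*} [Field k] [IsAlgClosed k] (p : ℕ) [ExpChar k p] {n : ℕ}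
    {Λ : Type*} [LinearOrder Λ] (T : Triplet k n Λ) (F : MonomialDatum k n Λ)
    (hF : F.IsMonomialCase p T) (hwa : F.WellAdapted p T) :
    -- (1) characterization of the tight monomial case
    ((F.IsTight p T ↔ F.TypeI p T ∨ F.TypeII p T) ∧
      (F.TypeI p T ↔ ∃ r : Λ → ℕ,
        (∀ l ∈ T.E, F.slopeDiv p T l * (p ^ F.e : ℕ) = r l ∧
          divOrder (T.pos l) (F.last p) = r l) ∧
        ∃ u : CompletedRing k n, IsUnit u ∧
          F.last p = u * ∏ l ∈ T.E, MvPowerSeries.X (T.pos l) ^ r l) ∧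
      (F.TypeII p T ↔ ∃ r : Λ → ℕ,
        (∀ l ∈ T.E, F.slopeDiv p T l * F.a = r l ∧ F.muDiv l * F.a = r l ∧
          divOrder (T.pos l) (F.M T) = r l) ∧
        ∏ l ∈ T.E, MvPowerSeries.X (T.pos l) ^ r l = F.M T)) ∧
    -- (2) resolution procedure in the tight monomial case
    (F.IsTight p T →
      -- the two descriptions of the centre agree, and it is nonsingular
      PrimeSpectrum.zeroLocus {(MvPowerSeries.X 0 : CompletedRing k n)} ∩
          T.maxLocus (F.slopeDiv p T) = T.R.sing ∩ T.maxLocus (F.slopeDiv p T) ∧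
      (∃ S, T.IsCenter (F.slopeDiv p T) S) ∧
      -- behaviour at a closed point of the singular locus over `P`
      (∀ (S : Finset (Fin (n + 1))) (G : Fin (n + 1)) (b : Fin (n + 1) → k) (ε : Λ),
        T.IsCenter (F.slopeDiv p T) S → G ∈ S → ε ∉ T.E → (T.blowup S G b ε).IsSingular →
        (T.blowup S G b ε).R.sigma p < T.R.sigma p ∨
        ((T.blowup S G b ε).R.sigma p = T.R.sigma p ∧
          ∃ F' : MonomialDatum k n Λ,
            F'.IsMonomialCase p (T.blowup S G b ε) ∧
            F'.WellAdapted p (T.blowup S G b ε) ∧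
            F'.e = F.e ∧ MvPowerSeries.X G ^ p ^ F.e * F'.h p = blowupHom S G b (F.h p) ∧
            F'.a = F.a ∧ Associated (MvPowerSeries.X G ^ F.a * F'.M (T.blowup S G b ε))
              (blowupHom S G b (F.M T)) ∧
            F'.IsTight p (T.blowup S G b ε) ∧
            (F.TypeI p T → F'.TypeI p (T.blowup S G b ε)) ∧
            (F.TypeII p T → F'.TypeII p (T.blowup S G b ε)) ∧
            (∀ l ∈ (T.blowup S G b ε).E, F'.slopeDiv p (T.blowup S G b ε) l =
              T.transformExponents S ε (F.slopeDiv p T) l) ∧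
            (T.blowup S G b ε).gamma (F'.slopeDiv p (T.blowup S G b ε))
                (IsLocalRing.closedPoint (CompletedRing k n)) <
              T.gamma (F.slopeDiv p T) (IsLocalRing.closedPoint (CompletedRing k n)))) ∧
      -- the procedure ends after finitely many steps, unless `σ` drops
      ¬ ∃ (Ts : ℕ → Triplet k n Λ) (Fs : ℕ → MonomialDatum k n Λ), Ts 0 = T ∧ Fs 0 = F ∧
        ∀ i, (Fs i).IsMonomialCase p (Ts i) ∧ (Fs i).WellAdapted p (Ts i) ∧
          (Ts i).Step ((Fs i).slopeDiv p (Ts i)) (Ts (i + 1)) ∧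
          ¬ (Ts (i + 1)).R.sigma p < (Ts i).R.sigma p) := by
  have hq : 0 < p ^ F.e := pow_pos (expChar_pos k p) _
  refine ⟨⟨hF.isTight_iff hq, hF.typeI_iff hq, hF.typeII_iff⟩, fun ht => ?_⟩
  obtain ⟨s, hs⟩ := exists_isGammaMax (hF.one_lt_ordTight hq ht).le
  refine ⟨hF.zeroLocus_inter_maxLocus hq hs, ⟨_, hF.isCenter_centreIndices hq hs⟩,
    fun S G b ε hS hG hε hsing => ?_, ?_⟩
  · exact or_iff_not_imp_left.2 fun hnd => hF.exists_transform hwa.1 ht hS hG hε hsing hnd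
  · rintro ⟨Ts, Fs, rfl, rfl, h⟩
    exact MonomialDatum.IsMonomialCase.not_exists_infinite_sequence ht h
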